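/- Notation. All rings are commutative. For a ring $R$ let $\mathcal N R$ be its nilradical, and let $\mathcal B$ be the class of rings $R$ for which $\mathcal N R$ is a nilpotent ideal. Let $\mathbb Z(R)$ be the ring of locally constant functions $\operatorname{Spec} R\to\mathbf Z$; for a unit $a$ of an $R$-algebra and $n\in\mathbb Z(R)$, $a^n$ is the unit that equals $a^k$ over the open and closed subset $\{n=k\}$. Order $\mathbf Z^2$ lexicographically; the pair $(i,j)$ is the exponent of the monomial $u^jt^i$. Let $\mathfrak m(R)=uR[[u]]+tR((u))[[t]]$ and let $\mathfrak p(R)$ be the set of nilpotent elements of $u^{-1}R[u^{-1}]+t^{-1}R((u))[t^{-1}]$. Decompositions. Let $R\in\mathcal B$. Every $f\in R((u))((t))^*$ has a unique decomposition $$f=f_{-1}\,f_0\,u^{\nu_2(f)}t^{\nu_1(f)}\,f_1,\qquad f_{-1}\in 1+\mathfrak p(R),\ f_0\in R^*,\ \nu_1(f),\nu_2(f)\in\mathbb Z(R),\ f_1\in1+\mathfrak m(R),$$ and a unique family $(a_{i,j})_{(i,j)\ne(0,0)}$ in $R$ such that $$f_1=\prod_{(i,j)>(0,0)}(1-a_{i,j}u^jt^i),\qquad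 f_{-1}=\prod_{(i,j)<(0,0)}(1-a_{i,j}u^jt^i),$$ where for $(i,j)<(0,0)$ the $a_{i,j}$ are nilpotent and those which are nonzero have $i$ and $j$ bounded below. (Convergence is with respect to the natural topology of $R((u))((t))$, with the submodules $t^NR((u))[[t]]+\sum_i u^{c_i}t^iR[[u]]$ as a base of neighbourhoods of $0$.) Let $b_{k,l}$ and $c_{m,n}$ be the families of $g$ and $h$, and put $\nu(f,g)=\nu_2(f)\nu_1(g)-\nu_2(g)\nu_1(f)$ and $$A=\nu(f,g)\nu(f,h)+\nu(g,h)\nu(g,f)+\nu(h,f)\nu(h,g)+\nu(f,g)\nu(f,h)\nu(g,h).$$ Elementary factors. Put $p_0=lm-nk$, $q_0=ni-jm$, $r_0=jk-li$. If $p_0,q_0,r_0$ are all positive or all negative, let $d$ be their greatest common divisor, taken with their common sign, and $$T(a_{i,j},b_{k,l},c_{m,n})=\bigl(1-a_{i,j}^{p_0/d}b_{k,l}^{q_0/d}c_{m,n}^{r_0/d}\bigr)^{d};$$ otherwise $T=1$. If $jk-li=0$, $jl+ik<0$ and $jl\neq0$, put, with $d=\gcd(j,l)>0$, $$S(a_{i,j},b_{k,l})=\bigl(1-a_{i,j}^{|l|/d}b_{k,l}^{|j|/d}\bigr)^{-ld/|l|};$$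 otherwise $S=1$. If $jk-li=0$, $jl+ik<0$ and $ik\ne0$, put, with $d=\gcd(i,k)>0$, $$Q(a_{i,j},b_{k,l})=\bigl(1-a_{i,j}^{|k|/d}b_{k,l}^{|i|/d}\bigr)^{kd/|k|};$$ otherwise $Q=1$. The symbol. For $R\in\mathcal B$ and $f,g,h\in R((u))((t))^*$ put $$\begin{aligned}(f,g,h)={}&(-1)^A f_0^{\nu(g,h)}g_0^{\nu(h,f)}h_0^{\nu(f,g)}\prod T(a_{i,j},b_{k,l},c_{m,n})\\&\times\prod S(a_{i,j},b_{k,l})^{\nu_1(h)}\prod Q(a_{i,j},b_{k,l})^{\nu_2(h)}\prod S(c_{m,n},a_{i,j})^{\nu_1(g)}\\&\times\prod Q(c_{m,n},a_{i,j})^{\nu_2(g)}\prod S(b_{k,l},c_{m,n})^{\nu_1(f)}\prod Q(b_{k,l},c_{m,n})^{\nu_2(f)},\end{aligned}$$ the products being over all indices in $\mathbf Z^2\setminus\{(0,0)\}$. Proposition. Let $R\in\mathcal B$. 1. The formula is well defined: the above decompositions exist and are unique, the elements $1-(\cdots)$ occurring in the nontrivial cases of $T,S,Q$ are invertible in $R$,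 and for all $f,g,h$ only finitely many of the factors $T$, $S$, $Q$ differ from $1$. 2. The resulting map $(R((u))((t))^*)^3\to R^*$ is anti-symmetric (interchanging two arguments inverts the value) and functorial: for every homomorphism $\varphi:R\to R'$ with $R'\in\mathcal B$ one has $(\varphi f,\varphi g,\varphi h)=\varphi\bigl((f,g,h)\bigr)$. 3. If $\mathbf Q\subset R$, it coincides with the exp-Res symbol. That is, it is the unique tri-multiplicative anti-symmetric map $(R((u))((t))^*)^3\to R^*$ such that: (i) if $f=f_{-1}f_1$ with $f_{-1}\in1+\mathfrak p(R)$ and $f_1\in1+\mathfrak m(R)$, then $\operatorname{Res}\bigl(\log f\cdot\frac{dg}{g}\wedge\frac{dh}{h}\bigr)$ is nilpotent and $(f,g,h)=\exp\operatorname{Res}\bigl(\log f\cdot\frac{dg}{g}\wedge\frac{dh}{h}\bigr)$, where $\log f=\log f_{-1}+\log f_1$ is defined by the formal series, $df=\frac{\partial f}{\partial u}du+\frac{\partial f}{\partial t}dt$ and $\operatorname{Res}\bigl(\sum x_{i,j}u^jt^i\,du\wedge dt\bigr)=x_{-1,-1}$; (ii) $(a,g,h)=a^{\nu(g,h)}$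 for $a\in R^*$; (iii) $(f,g,h)=(-1)^A$ if $f,g,h$ are of the form $u^{n}t^{n'}$ with $n,n'\in\mathbb Z(R)$. -/

import Mathlib

noncomputable section

namespace ContouCarrere

universe u v

/-! ### The ring `R((u))((t))` and the constant group `ℤ(R)` -/

/-- The iterated Laurent series ring `R((u))((t))`: Laurent series in `t` with coefficients in
`R((u))`. -/
abbrev DoubleLaurent (R : Type u) [CommRing R] : Type u := LaurentSeries (LaurentSeries R)

/-- `ℤ(R)`: locally constant integer valued functions on `Spec R`. -/
abbrev ZConst (R : Type u) [CommRing R] : Type u := LocallyConstant (PrimeSpectrum R) ℤ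

variable {R : Type u} [CommRing R]

/-- The coefficient of `u ^ j * t ^ i`. -/
def cf (f : DoubleLaurent R) (i j : ℤ) : R := (f.coeff i).coeff j

/-- The monomial `a * u ^ j * t ^ i`, where `x = (i, j)`. -/
def mono (x : ℤ × ℤ) (a : R) : DoubleLaurent R :=
  HahnSeries.single x.1 (HahnSeries.single x.2 a)

theorem mono_mul (x y : ℤ × ℤ) (a b : R) : mono x a * mono y b = mono (x + y) (a * b) := by
  simp [mono]

theorem mono_zero_one : mono (0 : ℤ × ℤ) (1 : R) = 1 := rfl

/-- The element `u` as a unit of `R((u))((t))`. -/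
def uUnit (R : Type u) [CommRing R] : (DoubleLaurent R)ˣ where
  val := mono (0, 1) 1
  inv := mono (0, -1) 1
  val_inv := by rw [mono_mul, ← mono_zero_one]; norm_num; rfl
  inv_val := by rw [mono_mul, ← mono_zero_one]; norm_num; rfl

/-- The element `t` as a unit of `R((u))((t))`. -/
def tUnit (R : Type u) [CommRing R] : (DoubleLaurent R)ˣ where
  val := mono (1, 0) 1
  inv := mono (-1, 0) 1
  val_inv := by rw [mono_mul, ← mono_zero_one]; norm_num; rfl
  inv_val := by rw [mono_mul, ← mono_zero_one]; norm_num; rfl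

/-- The embedding of `R` into `R((u))((t))` as constants. -/
def constHom (R : Type u) [CommRing R] : R →+* DoubleLaurent R :=
  (HahnSeries.C : LaurentSeries R →+* DoubleLaurent R).comp (HahnSeries.C : R →+* LaurentSeries R)

theorem constHom_apply (a : R) : constHom R a = mono 0 a := rfl

/-- The constant `a ∈ Rˣ` as a unit of `R((u))((t))`. -/
def constUnit (a : Rˣ) : (DoubleLaurent R)ˣ := Units.map (constHom R : R →* DoubleLaurent R) a

/-- The ring homomorphism `R((u))((t)) → S((u))((t))` applying `φ` to every coefficient. -/
def mapLaurent {A : Type u} {B : Type v} [CommRing A] [CommRing B] (φ : A →+* B) :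
    LaurentSeries A →+* LaurentSeries B where
  toFun f := HahnSeries.map f φ
  map_zero' := by ext; simp
  map_one' := HahnSeries.map_one φ.toMonoidWithZeroHom
  map_add' _ _ := by ext; simp
  map_mul' _ _ := HahnSeries.map_mul φ.toNonUnitalRingHom

/-- The map induced by `φ : R →+* S` on units of the double Laurent series rings. -/
def mapUnits {S : Type v} [CommRing S] (φ : R →+* S) :
    (DoubleLaurent R)ˣ →* (DoubleLaurent S)ˣ :=
  Units.map (mapLaurent (mapLaurent φ) : DoubleLaurent R →* DoubleLaurent S)

/-! ### Powers with exponents in `ℤ(R)` -/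

/-- The idempotent of `R` cutting out the open and closed subset of `Spec R` where `n = k`. -/
def idem (n : ZConst R) (k : ℤ) : R :=
  (PrimeSpectrum.isIdempotentElemEquivClopens.symm
    ⟨n ⁻¹' {k}, n.isLocallyConstant.isClopen_fiber k⟩ : {e : R // IsIdempotentElem e}).1

theorem idem_isIdempotent (n : ZConst R) (k : ℤ) : IsIdempotentElem (idem n k) :=
  (PrimeSpectrum.isIdempotentElemEquivClopens.symm
    ⟨n ⁻¹' {k}, n.isLocallyConstant.isClopen_fiber k⟩ : {e : R // IsIdempotentElem e}).2

theorem idem_notMem_iff (n : ZConst R) (k : ℤ) (p : PrimeSpectrum R) :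
    idem n k ∉ p.asIdeal ↔ n p = k := by
  have h := PrimeSpectrum.basicOpen_isIdempotentElemEquivClopens_symm
    (⟨n ⁻¹' {k}, n.isLocallyConstant.isClopen_fiber k⟩ :
      TopologicalSpace.Clopens (PrimeSpectrum R))
  have h2 : p ∈ PrimeSpectrum.basicOpen (idem n k) ↔ p ∈ n ⁻¹' {k} := by
    unfold idem
    rw [h]
    rfl
  simpa [PrimeSpectrum.mem_basicOpen] using h2

theorem idem_eq_zero_of_forall {e : R} (he : IsIdempotentElem e)
    (h : ∀ p : PrimeSpectrum R, e ∈ p.asIdeal) : e = 0 := by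
  have hn : IsNilpotent e := by
    rw [← mem_nilradical, nilradical_eq_sInf, Ideal.mem_sInf]
    intro I hI
    exact h ⟨I, hI⟩
  obtain ⟨m, hm⟩ := hn
  have h1 := he.pow_succ_eq m
  rw [pow_succ, hm, zero_mul] at h1
  exact h1.symm

theorem idem_mul_of_ne (n : ZConst R) {k l : ℤ} (hkl : k ≠ l) : idem n k * idem n l = 0 := by
  refine idem_eq_zero_of_forall ((idem_isIdempotent n k).mul (idem_isIdempotent n l)) ?_
  intro p
  by_contra hp
  have h1 : idem n k ∉ p.asIdeal := fun h => hp (Ideal.mul_mem_right _ _ h)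
  have h2 : idem n l ∉ p.asIdeal := fun h => hp (Ideal.mul_mem_left _ _ h)
  exact hkl (((idem_notMem_iff n k p).1 h1).symm.trans ((idem_notMem_iff n l p).1 h2))

/-- The finitely many values of `n`. -/
def valueSet (n : ZConst R) : Finset ℤ := n.range_finite.toFinset

theorem sum_idem (n : ZConst R) : ∑ k ∈ valueSet n, idem n k = 1 := by
  have hid : IsIdempotentElem (1 - ∑ k ∈ valueSet n, idem n k) := by
    refine IsIdempotentElem.one_sub ?_
    unfold IsIdempotentElem
    rw [Finset.sum_mul_sum]
    refine Finset.sum_congr rfl fun k hk => ?_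
    rw [Finset.sum_eq_single k]
    · exact idem_isIdempotent n k
    · intro l _ hl
      exact idem_mul_of_ne n hl.symm
    · intro h
      exact absurd hk h
  have h0 : 1 - ∑ k ∈ valueSet n, idem n k = 0 := by
    refine idem_eq_zero_of_forall hid fun p => ?_
    have hmem : n p ∈ valueSet n := by simp [valueSet]
    by_contra hp
    have hz : idem n (n p) * (1 - ∑ k ∈ valueSet n, idem n k) = 0 := by
      rw [mul_sub, mul_one, Finset.mul_sum, Finset.sum_eq_single (n p)]
      · rw [idem_isIdempotent n (n p), sub_self]
      · intro l _ hl
        exact idem_mul_of_ne n hl.symm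
      · intro h
        exact absurd hmem h
    have h3 : idem n (n p) * (1 - ∑ k ∈ valueSet n, idem n k) ∈ p.asIdeal := by
      rw [hz]
      exact p.asIdeal.zero_mem
    rcases p.isPrime.mem_or_mem h3 with h | h
    · exact (idem_notMem_iff n (n p) p).2 rfl h
    · exact hp h
  exact (sub_eq_zero.1 h0).symm

theorem sum_idem_mul {A : Type v} [CommRing A] (ι : R →+* A) (n : ZConst R) (a : Aˣ) :
    (∑ k ∈ valueSet n, ι (idem n k) * ((a ^ k : Aˣ) : A)) *
      (∑ k ∈ valueSet n, ι (idem n k) * (((a ^ k)⁻¹ : Aˣ) : A)) = 1 := by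
  have key : ∀ k ∈ valueSet n, ∑ l ∈ valueSet n,
      ι (idem n k) * ((a ^ k : Aˣ) : A) *
        (ι (idem n l) * (((a ^ l)⁻¹ : Aˣ) : A)) = ι (idem n k) := by
    intro k hk
    rw [Finset.sum_eq_single k]
    · rw [mul_mul_mul_comm, ← map_mul, idem_isIdempotent n k, Units.mul_inv, mul_one]
    · intro l _ hl
      rw [mul_mul_mul_comm, ← map_mul, idem_mul_of_ne n hl.symm, map_zero, zero_mul]
    · intro h
      exact absurd hk h
  rw [Finset.sum_mul_sum, Finset.sum_congr rfl key, ← map_sum, sum_idem, map_one]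

/-- The power `a ^ n` of a unit `a` of an `R`-algebra `A` with structure map `ι`, for `n ∈ ℤ(R)`: on the part of
`Spec R` where `n` has the value `k` it is `a ^ k`. -/
def powAlong {A : Type v} [CommRing A] (ι : R →+* A) (a : Aˣ) (n : ZConst R) : Aˣ where
  val := ∑ k ∈ valueSet n, ι (idem n k) * ((a ^ k : Aˣ) : A)
  inv := ∑ k ∈ valueSet n, ι (idem n k) * (((a ^ k)⁻¹ : Aˣ) : A)
  val_inv := sum_idem_mul ι n a
  inv_val := by rw [mul_comm]; exact sum_idem_mul ι n a

/-- The power `a ^ n` of a unit `a` of `R`, for `n ∈ ℤ(R)`. -/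
def lpow (a : Rˣ) (n : ZConst R) : Rˣ := powAlong (RingHom.id R) a n

/-- `u ^ n` for `n ∈ ℤ(R)`. -/
def uPow (n : ZConst R) : (DoubleLaurent R)ˣ := powAlong (constHom R) (uUnit R) n

/-- `t ^ n` for `n ∈ ℤ(R)`. -/
def tPow (n : ZConst R) : (DoubleLaurent R)ˣ := powAlong (constHom R) (tUnit R) n

/-! ### The canonical splitting of a unit of `R((u))((t))` -/

/-- Nonzero exponents; the pair `(i, j)` stands for `u ^ j * t ^ i`. -/
abbrev Idx : Type := {x : ℤ × ℤ // x ≠ 0}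

/-- `x > (0, 0)` in the lexicographic order. -/
def IsPos (x : ℤ × ℤ) : Prop := 0 < x.1 ∨ (x.1 = 0 ∧ 0 < x.2)

/-- `x < (0, 0)` in the lexicographic order. -/
def IsNeg (x : ℤ × ℤ) : Prop := x.1 < 0 ∨ (x.1 = 0 ∧ x.2 < 0)

/-- `𝔪(R) = u R[[u]] + t R((u))[[t]]`. -/
def mSet (R : Type u) [CommRing R] : Set (DoubleLaurent R) :=
  {f | ∀ i j, cf f i j ≠ 0 → IsPos (i, j)}

/-- `𝔭(R)`: the nilpotent elements of `u⁻¹ R[u⁻¹] + t⁻¹ R((u))[t⁻¹]`. -/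
def pSet (R : Type u) [CommRing R] : Set (DoubleLaurent R) :=
  {f | IsNilpotent f ∧ ∀ i j, cf f i j ≠ 0 → IsNeg (i, j)}

/-- The data `(f₋₁, f₀, ν₂, ν₁, f₁)` of a splitting `f₋₁ * f₀ * u ^ ν₂ * t ^ ν₁ * f₁`. -/
structure Splitting (R : Type u) [CommRing R] where
  neg : DoubleLaurent R
  unit : Rˣ
  n2 : ZConst R
  n1 : ZConst R
  pos : DoubleLaurent R

instance : Inhabited (Splitting R) := ⟨⟨1, 1, 0, 0, 1⟩⟩

/-- `f = f₋₁ * f₀ * u ^ ν₂ * t ^ ν₁ * f₁` with `f₋₁ ∈ 1 + 𝔭(R)`, `f₀ ∈ Rˣ`, `f₁ ∈ 1 + 𝔪(R)`. -/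
structure IsSplitting (f : (DoubleLaurent R)ˣ) (s : Splitting R) : Prop where
  neg_mem : s.neg - 1 ∈ pSet R
  pos_mem : s.pos - 1 ∈ mSet R
  eq : (f : DoubleLaurent R) = s.neg *
    ((constUnit s.unit * uPow s.n2 * tPow s.n1 : (DoubleLaurent R)ˣ) :
      DoubleLaurent R) * s.pos

/-- The splitting of `f` (it exists and is unique). -/
def splitting (f : (DoubleLaurent R)ˣ) : Splitting R := Classical.epsilon (IsSplitting f)

/-- The constant `f₀`. -/
def lead (f : (DoubleLaurent R)ˣ) : Rˣ := (splitting f).unit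

/-- `ν₁(f)`, the exponent of `t`. -/
def nu1 (f : (DoubleLaurent R)ˣ) : ZConst R := (splitting f).n1

/-- `ν₂(f)`, the exponent of `u`. -/
def nu2 (f : (DoubleLaurent R)ˣ) : ZConst R := (splitting f).n2

/-- `ν(f, g) = ν₂(f) ν₁(g) - ν₂(g) ν₁(f)`. -/
def nu (f g : (DoubleLaurent R)ˣ) : ZConst R := nu2 f * nu1 g - nu2 g * nu1 f

/-- The exponent `A` of the sign. -/
def signExp (f g h : (DoubleLaurent R)ˣ) : ZConst R :=
  nu f g * nu f h + nu g h * nu g f + nu h f * nu h g + nu f g * nu f h * nu g h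

/-! ### Infinite products -/

/-- The basic open submodule `t ^ N R((u))[[t]] + ∑ i, u ^ (c i) t ^ i R[[u]]` of the natural
linear topology of `R((u))((t))`. -/
def basicNhd (R : Type u) [CommRing R] (N : ℤ) (c : ℤ → ℤ) : Set (DoubleLaurent R) :=
  {f | ∀ i j, i < N → j < c i → cf f i j = 0}

/-- The infinite product of the family `φ` converges (unconditionally) to `F` in the natural
topology. -/
def ProdConverges {ι : Type} (φ : ι → DoubleLaurent R) (F : DoubleLaurent R) : Prop :=
  ∀ (N : ℤ) (c : ℤ → ℤ), ∃ s₀ : Finset ι, ∀ s : Finset ι, s₀ ⊆ s →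
    ∏ x ∈ s, φ x - F ∈ basicNhd R N c

/-- `a` is the family of coefficients of the product decomposition of `f`:
`f₁ = ∏ (1 - a i j * u ^ j * t ^ i)` over `(i, j) > (0, 0)` and
`f₋₁ = ∏ (1 - a i j * u ^ j * t ^ i)` over `(i, j) < (0, 0)`, where in the second product the
coefficients are nilpotent and those different from zero have `i` and `j` bounded below. -/
structure IsFactorFamily (f : (DoubleLaurent R)ˣ) (a : Idx → R) : Prop where
  pos : ProdConverges (fun x : {x : Idx // IsPos x.1} => 1 - mono x.1.1 (a x.1)) (splitting f).pos
  neg : ProdConverges (fun x : {x : Idx // IsNeg x.1} => 1 - mono x.1.1 (a x.1)) (splitting f).neg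
  nilp : ∀ x : Idx, IsNeg x.1 → IsNilpotent (a x)
  bdd : ∃ n m : ℤ, ∀ x : Idx, IsNeg x.1 → a x ≠ 0 → n < x.1.1 ∧ m < x.1.2

/-- The coefficients of the product decomposition of `f` (for nilpotent nilradical they exist and
are unique). -/
def factorCoeff (f : (DoubleLaurent R)ˣ) : Idx → R := Classical.epsilon (IsFactorFamily f)

/-! ### The elementary factors `T`, `S`, `Q` -/

/-- The unit `1 - r`; it is only used when `1 - r` is invertible (otherwise the value is `1`). -/
def oneSub (r : R) : Rˣ :=
  open Classical in if h : IsUnit (1 - r) then h.unit else 1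

/-- For `x = (i, j)`, `y = (k, l)` the determinant `j * k - l * i` with rows `(j, l)`, `(i, k)`. -/
def det2 (x y : ℤ × ℤ) : ℤ := x.2 * y.1 - y.2 * x.1

/-- The positive greatest common divisor of the integers `p`, `q`, `r`. -/
def gcd3 (p q r : ℤ) : ℕ := Nat.gcd (Int.gcd p q) r.natAbs

/-- `a ^ (p / d) * b ^ (q / d) * c ^ (r / d)` for `(p, q, r) = (p₀, q₀, r₀)` and `d` their gcd with
the common sign of `p₀, q₀, r₀`. -/
def tMon (x y z : ℤ × ℤ) (a b c : R) : R :=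
  let d := gcd3 (det2 y z) (det2 z x) (det2 x y)
  a ^ ((det2 y z).natAbs / d) * b ^ ((det2 z x).natAbs / d) * c ^ ((det2 x y).natAbs / d)

/-- `p₀, q₀, r₀ > 0`. -/
def TPos (x y z : ℤ × ℤ) : Prop := 0 < det2 y z ∧ 0 < det2 z x ∧ 0 < det2 x y

/-- `p₀, q₀, r₀ < 0`. -/
def TNeg (x y z : ℤ × ℤ) : Prop := det2 y z < 0 ∧ det2 z x < 0 ∧ det2 x y < 0

open Classical in
/-- The factor `T(a, b, c)` attached to the exponents `x = (i, j)`, `y = (k, l)`, `z = (m, n)`. -/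
def tFactor (x y z : ℤ × ℤ) (a b c : R) : Rˣ :=
  let d : ℤ := gcd3 (det2 y z) (det2 z x) (det2 x y)
  if TPos x y z then oneSub (tMon x y z a b c) ^ d
  else if TNeg x y z then oneSub (tMon x y z a b c) ^ (-d)
  else 1

/-- The negation of the three conditions that make `S` trivial. -/
def SCond (x y : ℤ × ℤ) : Prop := det2 x y = 0 ∧ x.2 * y.2 + x.1 * y.1 < 0 ∧ x.2 * y.2 ≠ 0

/-- `a ^ |l / (j, l)| * b ^ |j / (j, l)|` for `x = (i, j)`, `y = (k, l)`. -/
def sMon (x y : ℤ × ℤ) (a b : R) : R :=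
  a ^ (y.2.natAbs / Int.gcd x.2 y.2) * b ^ (x.2.natAbs / Int.gcd x.2 y.2)

open Classical in
/-- The factor `S(a, b)` attached to the exponents `x = (i, j)`, `y = (k, l)`. -/
def sFactor (x y : ℤ × ℤ) (a b : R) : Rˣ :=
  if SCond x y then oneSub (sMon x y a b) ^ (-(y.2.sign * (Int.gcd x.2 y.2 : ℤ))) else 1

/-- The negation of the three conditions that make `Q` trivial. -/
def QCond (x y : ℤ × ℤ) : Prop := det2 x y = 0 ∧ x.2 * y.2 + x.1 * y.1 < 0 ∧ x.1 * y.1 ≠ 0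

/-- `a ^ |k / (i, k)| * b ^ |i / (i, k)|` for `x = (i, j)`, `y = (k, l)`. -/
def qMon (x y : ℤ × ℤ) (a b : R) : R :=
  a ^ (y.1.natAbs / Int.gcd x.1 y.1) * b ^ (x.1.natAbs / Int.gcd x.1 y.1)

open Classical in
/-- The factor `Q(a, b)` attached to the exponents `x = (i, j)`, `y = (k, l)`. -/
def qFactor (x y : ℤ × ℤ) (a b : R) : Rˣ :=
  if QCond x y then oneSub (qMon x y a b) ^ (y.1.sign * (Int.gcd x.1 y.1 : ℤ)) else 1

/-! ### The explicit symbol -/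

/-- The family of factors `T` of `(f, g, h)`. -/
def tFamily (f g h : (DoubleLaurent R)ˣ) (w : Idx × Idx × Idx) : Rˣ :=
  tFactor w.1.1 w.2.1.1 w.2.2.1 (factorCoeff f w.1) (factorCoeff g w.2.1) (factorCoeff h w.2.2)

/-- The family of factors `S` of `(f, g)`. -/
def sFamily (f g : (DoubleLaurent R)ˣ) (w : Idx × Idx) : Rˣ :=
  sFactor w.1.1 w.2.1 (factorCoeff f w.1) (factorCoeff g w.2)

/-- The family of factors `Q` of `(f, g)`. -/
def qFamily (f g : (DoubleLaurent R)ˣ) (w : Idx × Idx) : Rˣ :=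
  qFactor w.1.1 w.2.1 (factorCoeff f w.1) (factorCoeff g w.2)

/-- The explicit formula for the two-dimensional Contou-Carrère symbol. -/
def explicitSymbol (f g h : (DoubleLaurent R)ˣ) : Rˣ :=
  lpow (-1) (signExp f g h) *
    lpow (lead f) (nu g h) * lpow (lead g) (nu h f) * lpow (lead h) (nu f g) *
    (∏ᶠ w : Idx × Idx × Idx, tFamily f g h w) *
    (∏ᶠ w : Idx × Idx, lpow (sFamily f g w) (nu1 h)) *
    (∏ᶠ w : Idx × Idx, lpow (qFamily f g w) (nu2 h)) *
    (∏ᶠ w : Idx × Idx, lpow (sFamily h f w) (nu1 g)) *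
    (∏ᶠ w : Idx × Idx, lpow (qFamily h f w) (nu2 g)) *
    (∏ᶠ w : Idx × Idx, lpow (sFamily g h w) (nu1 f)) *
    (∏ᶠ w : Idx × Idx, lpow (qFamily g h w) (nu2 f))

/-- Anti-symmetry of a multiplicative map of three arguments: each transposition inverts. -/
structure IsAntisymm {G H : Type u} [Group H] (σ : G → G → G → H) : Prop where
  swap12 : ∀ f g h, σ g f h = (σ f g h)⁻¹
  swap23 : ∀ f g h, σ f h g = (σ f g h)⁻¹
  swap13 : ∀ f g h, σ h g f = (σ f g h)⁻¹

/-- Multiplicativity in each of the three arguments. -/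
structure IsTrimultiplicative {G H : Type u} [Group G] [Group H] (σ : G → G → G → H) : Prop where
  mul1 : ∀ f f' g h, σ (f * f') g h = σ f g h * σ f' g h
  mul2 : ∀ f g g' h, σ f (g * g') h = σ f g h * σ f g' h
  mul3 : ∀ f g h h', σ f g (h * h') = σ f g h * σ f g h'

/-! ### The symbol for `ℚ`-algebras -/

/-- `∂f/∂u`. -/
def derivU (f : DoubleLaurent R) : DoubleLaurent R := HahnSeries.map f (LaurentSeries.derivative R)

/-- `∂f/∂t`. -/
def derivT (f : DoubleLaurent R) : DoubleLaurent R :=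
  LaurentSeries.derivative (LaurentSeries R) f

/-- The coefficient at `du ∧ dt` of `dg/g ∧ dh/h`. -/
def dlogWedge (g h : (DoubleLaurent R)ˣ) : DoubleLaurent R :=
  ((g⁻¹ * h⁻¹ : (DoubleLaurent R)ˣ) : DoubleLaurent R) *
    (derivU (g : DoubleLaurent R) * derivT (h : DoubleLaurent R) -
      derivU (h : DoubleLaurent R) * derivT (g : DoubleLaurent R))

/-- The residue of `f du ∧ dt`. -/
def res (f : DoubleLaurent R) : R := cf f (-1) (-1)

open Classical in
/-- The element of `R((u))((t))` with the given coefficients (`0` if there is none). -/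
def ofCoeffs (c : ℤ → ℤ → R) : DoubleLaurent R :=
  if h : ∃ f : DoubleLaurent R, ∀ i j, cf f i j = c i j then h.choose else 0

/-- The formal series `log F = ∑ (-1) ^ (n + 1) / n * (F - 1) ^ n` over `n ≥ 1`, for
`F ∈ 1 + 𝔭(R)` or `F ∈ 1 + 𝔪(R)`. For every exponent only finitely many terms contribute to the
coefficient. -/
def logSeries [Algebra ℚ R] (F : DoubleLaurent R) : DoubleLaurent R :=
  ofCoeffs fun i j => ∑ᶠ n : ℕ, ((-1 : ℚ) ^ n / (n + 1)) • cf ((F - 1) ^ (n + 1)) i j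

/-- The properties that characterize the two-dimensional Contou-Carrère symbol of a `ℚ`-algebra
`R`. In `exp_res` the element `f` is any unit with `ν₁(f) = ν₂(f) = 0` and `f₀ = 1`, that is
`f = f₋₁ * f₁`, and `log f = log f₋₁ + log f₁`. -/
structure IsExpResSymbol [Algebra ℚ R]
    (σ : (DoubleLaurent R)ˣ → (DoubleLaurent R)ˣ → (DoubleLaurent R)ˣ → Rˣ) : Prop where
  trimul : IsTrimultiplicative σ
  antisymm : IsAntisymm σ
  exp_res : ∀ (f g h : (DoubleLaurent R)ˣ) (fm fp : DoubleLaurent R),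
    fm - 1 ∈ pSet R → fp - 1 ∈ mSet R → (f : DoubleLaurent R) = fm * fp →
    IsNilpotent (res ((logSeries fm + logSeries fp) * dlogWedge g h)) ∧
    (σ f g h : R) = IsNilpotent.exp (res ((logSeries fm + logSeries fp) * dlogWedge g h))
  const : ∀ (a : Rˣ) (g h : (DoubleLaurent R)ˣ), σ (constUnit a) g h = lpow a (nu g h)
  monomial : ∀ (f g h : (DoubleLaurent R)ˣ) (j₁ i₁ j₂ i₂ j₃ i₃ : ZConst R),
    f = uPow j₁ * tPow i₁ →
    g = uPow j₂ * tPow i₂ →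
    h = uPow j₃ * tPow i₃ →
    σ f g h = lpow (-1) (signExp f g h)

end ContouCarrere

end

open ContouCarrere

/-! Write `N` for the nilradical. Everything rests on coefficientwise filtrations of `R((u))((t))`:
by powers of `N` (`nilFil`), by a weight `j + W * i` on series with positive exponents (`posFil`),
and by a mixture of the two on series with negative exponents (`negFil`). All are multiplicative.
The first is finite because `N` is nilpotent; the other two are separated, and limits are built
coefficient by coefficient.

Decompositions. At a prime `p` the reduction of a unit `f` has a lexicographic leading exponent. It
is additive in `f`, and comparing `f` with `f⁻¹` shows that it is locally constant in `p`
(`exists_nu`); this gives `ν₁` and `ν₂`. After division by the monomial, the negative coefficients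
are nilpotent and the constant one is a unit. Such a series is factored modulo `N`, and the
factorization is corrected modulo successive powers of `N` (`exists_factorization`). Uniqueness
holds because a series in `1 + 𝔭` that equals a constant times a series in `1 + 𝔪` is `1`. The
product decompositions come from one first-order expansion (`prod_sub_prod_add_sum_mem`), applied by
induction on the weight for positive exponents and on the power of `N` for negative ones.

Well-definedness, anti-symmetry, functoriality. A nontrivial factor `T`, `S` or `Q` records a
relation with positive integer coefficients between its exponents. Hence one exponent is negative,
its coefficient is nilpotent, and `1 - (...)` is a unit. Lower bounds on the exponents leave only
finitely many relations with nonzero monomial. Anti-symmetry is checked factor by factor, the sign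
being a computation in `ZMod 2`. Functoriality follows from uniqueness of the decompositions.

The case of a `ℚ`-algebra. A logarithm is characterized by its Euler derivatives and its vanishing
constant coefficient (`IsLog.unique`). Therefore the series `log (f₋₁ * f₁)` has the coefficients
predicted by the product decomposition (`co_logOf`), and it is additive in `f`. Multiplying out, the
exponential of the constant coefficient of `log f * (u ∂ log g/∂u)` is the product of the factors
`S`, that of `log f * (t ∂ log g/∂t)` is the inverse of the product of the `Q`, and the Jacobian of
`log g`, `log h` times `log f` gives the product of the `T`. In each case, the solutions of a linear
relation are the multiples of a primitive one, and summing over them produces a logarithm of `1 -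
(...)`. So the symbol is a sign times powers of leading constants times the exponential of an
explicit trilinear expression (`explicitSymbol_eq_expU`). Multiplicativity can be read off. If `ν₁ f
= ν₂ f = 0`, integration by parts turns the expression into the residue (`logSym_eq_res`).
Uniqueness follows because every unit is a constant times an element of `(1 + 𝔭)(1 + 𝔪)` times a
monomial, and the axioms prescribe the value on each kind. -/

noncomputable section

namespace ContouCarrere

universe u v

/-! ### Coefficients of double Laurent series and coefficientwise subgroups -/

section

variable {R : Type u} [CommRing R]

/-! ### Coefficients of iterated Laurent series -/

/-- The coefficient of `u ^ x.2 * t ^ x.1`. -/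
def co (f : DoubleLaurent R) (x : ℤ × ℤ) : R := cf f x.1 x.2

theorem cf_eq_co (f : DoubleLaurent R) (i j : ℤ) : cf f i j = co f (i, j) := rfl

theorem ext_co {f g : DoubleLaurent R} (h : ∀ x, co f x = co g x) : f = g := by
  ext i j
  exact h (i, j)

@[simp] theorem co_zero (x : ℤ × ℤ) : co (0 : DoubleLaurent R) x = 0 := rfl

@[simp] theorem co_add (f g : DoubleLaurent R) (x : ℤ × ℤ) : co (f + g) x = co f x + co g x := rfl

@[simp] theorem co_neg (f : DoubleLaurent R) (x : ℤ × ℤ) : co (-f) x = -co f x := rfl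

@[simp] theorem co_sub (f g : DoubleLaurent R) (x : ℤ × ℤ) : co (f - g) x = co f x - co g x := rfl

/-- The coefficient map as an additive homomorphism. -/
def coHom (x : ℤ × ℤ) : DoubleLaurent R →+ R where
  toFun f := co f x
  map_zero' := rfl
  map_add' _ _ := rfl

theorem co_sum {ι : Type*} (s : Finset ι) (f : ι → DoubleLaurent R) (x : ℤ × ℤ) :
    co (∑ i ∈ s, f i) x = ∑ i ∈ s, co (f i) x := map_sum (coHom x) f s

theorem co_mono (x : ℤ × ℤ) (a : R) (y : ℤ × ℤ) : co (mono x a) y = if y = x then a else 0 := by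
  obtain ⟨i, j⟩ := x
  obtain ⟨k, l⟩ := y
  simp only [co, cf, mono, HahnSeries.coeff_single, Prod.mk.injEq]
  by_cases h : k = i
  · simp [h, HahnSeries.coeff_single]
  · simp [h]

theorem co_one (y : ℤ × ℤ) : co (1 : DoubleLaurent R) y = if y = 0 then 1 else 0 := by
  rw [← mono_zero_one, co_mono]

theorem co_bdd (f : DoubleLaurent R) :
    ∃ (n : ℤ) (β : ℤ → ℤ), ∀ x, co f x ≠ 0 → n ≤ x.1 ∧ β x.1 ≤ x.2 := by
  refine ⟨f.order, fun i => (f.coeff i).order, fun x hx => ⟨?_, ?_⟩⟩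
  · apply HahnSeries.order_le_of_coeff_ne_zero
    intro h
    apply hx
    simp [co, cf, h]
  · exact HahnSeries.order_le_of_coeff_ne_zero hx

/-- The support condition of both Laurent layers is a lower bound for the rows together with a lower
bound inside each row. All limits and truncations below are constructed from their coefficients
through this criterion. -/
theorem exists_of_bdd (c : ℤ × ℤ → R) (n : ℤ) (β : ℤ → ℤ)
    (h : ∀ x, c x ≠ 0 → n ≤ x.1 ∧ β x.1 ≤ x.2) : ∃ f : DoubleLaurent R, ∀ x, co f x = c x := by
  have hb (i : ℤ) : BddBelow (Function.support fun j => c (i, j)) :=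
    ⟨β i, fun j hj => (h (i, j) hj).2⟩
  let g (i : ℤ) : LaurentSeries R := HahnSeries.ofSuppBddBelow (fun j => c (i, j)) (hb i)
  have hg : BddBelow (Function.support g) := by
    refine ⟨n, fun i hi => ?_⟩
    by_contra hlt
    apply hi
    ext j
    by_contra hne
    exact hlt (h (i, j) hne).1
  exact ⟨HahnSeries.ofSuppBddBelow g hg, fun x => rfl⟩

/-- Lower bounds for `p` and for `z - p` confine the row of `p` to an interval, and then `p.2` to an
interval in each of these rows. -/
theorem finite_of_bdd {n m : ℤ} {β γ : ℤ → ℤ} (z : ℤ × ℤ) :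
    {p : ℤ × ℤ | (n ≤ p.1 ∧ β p.1 ≤ p.2) ∧ (m ≤ (z - p).1 ∧ γ (z - p).1 ≤ (z - p).2)}.Finite := by
  refine ((Set.finite_Icc n (z.1 - m)).biUnion fun i _ =>
    (Set.finite_Icc (β i) (z.2 - γ (z.1 - i))).image fun j => (i, j)).subset ?_
  rintro ⟨i, j⟩ ⟨⟨h1, h2⟩, h3, h4⟩
  simp only [Prod.fst_sub, Prod.snd_sub] at h3 h4
  simp only [Set.mem_iUnion, Set.mem_image, Set.mem_Icc]
  exact ⟨i, ⟨h1, by omega⟩, j, ⟨h2, by omega⟩, rfl⟩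

theorem finite_co_mul (f g : DoubleLaurent R) (z : ℤ × ℤ) :
    {p : ℤ × ℤ | co f p ≠ 0 ∧ co g (z - p) ≠ 0}.Finite := by
  obtain ⟨n, β, h⟩ := co_bdd f
  obtain ⟨m, γ, h'⟩ := co_bdd g
  exact (finite_of_bdd z).subset fun p hp => ⟨h p hp.1, h' _ hp.2⟩

theorem coeff_mul_eq_finsum {A : Type*} [CommRing A] (x y : LaurentSeries A) (a : ℤ) :
    (x * y).coeff a = ∑ᶠ b, x.coeff b * y.coeff (a - b) ∧
      (Function.support fun b => x.coeff b * y.coeff (a - b)).Finite := by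
  have hsub : (Function.support fun b => x.coeff b * y.coeff (a - b)) ⊆
      ((Finset.antidiagonal x.isPWO_support y.isPWO_support a).image Prod.fst : Finset ℤ) := by
    intro b hb
    simp only [Finset.coe_image, Set.mem_image, Finset.mem_coe, Finset.mem_antidiagonal]
    exact ⟨(b, a - b), ⟨fun h => hb (by simp [h]), fun h => hb (by simp [h]), by simp⟩, rfl⟩
  refine ⟨?_, (Finset.finite_toSet _).subset hsub⟩
  rw [finsum_eq_sum_of_support_subset _ hsub, Finset.sum_image, HahnSeries.coeff_mul]
  · refine Finset.sum_congr rfl fun p hp => ?_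
    rw [← (Finset.mem_antidiagonal.1 hp).2.2, add_sub_cancel_left]
  · intro p hp q hq (h : p.1 = q.1)
    have h1 := (Finset.mem_antidiagonal.1 hp).2.2
    have h2 := (Finset.mem_antidiagonal.1 hq).2.2
    have h3 : p.1 = q.1 := h
    exact Prod.ext h (by omega)

/-- The two nested Cauchy products merge into one convolution over `ℤ × ℤ`, since only finitely many
pairs of exponents contribute to `z`. -/
theorem co_mul (f g : DoubleLaurent R) (z : ℤ × ℤ) :
    co (f * g) z = ∑ᶠ p, co f p * co g (z - p) := by
  have hfin : (Function.support fun p => co f p * co g (z - p)).Finite :=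
    (finite_co_mul f g z).subset fun p hp =>
      ⟨fun h => hp (by simp [h]), fun h => hp (by simp [h])⟩
  rw [finsum_curry _ hfin]
  obtain ⟨h1, h2⟩ := coeff_mul_eq_finsum f g z.1
  have : co (f * g) z = (∑ᶠ b, f.coeff b * g.coeff (z.1 - b)).coeff z.2 := by rw [← h1]; rfl
  rw [this]
  have h3 := (HahnSeries.coeff.addMonoidHom (R := R) z.2).map_finsum h2
  refine h3.trans (finsum_congr fun b => ?_)
  exact (coeff_mul_eq_finsum (f.coeff b) (g.coeff (z.1 - b)) z.2).1

theorem co_mul_of_subset (f g : DoubleLaurent R) (z : ℤ × ℤ) (T : Finset (ℤ × ℤ))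
    (hT : ∀ p, co f p ≠ 0 → co g (z - p) ≠ 0 → p ∈ T) :
    co (f * g) z = ∑ p ∈ T, co f p * co g (z - p) := by
  rw [co_mul]
  refine finsum_eq_sum_of_support_subset _ fun p hp => hT p ?_ ?_
  · exact fun h => hp (by simp [h])
  · exact fun h => hp (by simp [h])

theorem co_mul_mem (f g : DoubleLaurent R) (z : ℤ × ℤ) (B : AddSubmonoid R)
    (h : ∀ x y, x + y = z → co f x * co g y ∈ B) : co (f * g) z ∈ B := by
  rw [co_mul_of_subset f g z (finite_co_mul f g z).toFinset fun p h1 h2 => by simp [h1, h2]]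
  exact sum_mem fun p _ => h _ _ (by abel)

theorem exists_of_co_mul_ne_zero {f g : DoubleLaurent R} {z : ℤ × ℤ} (h : co (f * g) z ≠ 0) :
    ∃ x y, x + y = z ∧ co f x ≠ 0 ∧ co g y ≠ 0 := by
  by_contra hc
  push Not at hc
  refine h (co_mul_mem f g z ⊥ fun x y hxy => ?_)
  by_cases hx : co f x = 0
  · simp [hx]
  · simp [hc x y hxy hx]

theorem co_mono_mul (x : ℤ × ℤ) (a : R) (f : DoubleLaurent R) (z : ℤ × ℤ) :
    co (mono x a * f) z = a * co f (z - x) := by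
  rw [co_mul_of_subset _ _ z {x}]
  · simp [co_mono]
  · intro p hp _
    rw [co_mono] at hp
    simpa using fun h => hp (if_neg h)

theorem mono_pow (x : ℤ × ℤ) (a : R) (n : ℕ) : mono x a ^ n = mono (n • x) (a ^ n) := by
  induction n with
  | zero => simp [mono_zero_one]
  | succ n ih => rw [pow_succ, ih, mono_mul, pow_succ, succ_nsmul]

@[simp] theorem mono_zero_right (x : ℤ × ℤ) : mono x (0 : R) = 0 := by
  refine ext_co fun y => ?_
  rw [co_mono]; simp

theorem co_mapLaurent {S : Type v} [CommRing S] (φ : R →+* S) (f : DoubleLaurent R) (x : ℤ × ℤ) :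
    co (mapLaurent (mapLaurent φ) f) x = φ (co f x) := rfl

/-! ### Subgroups cut out by conditions on the coefficients -/

/-- The elements whose coefficient at `x` lies in the ideal `w x`. -/
def coeffSub (w : ℤ × ℤ → Ideal R) : AddSubgroup (DoubleLaurent R) where
  carrier := {f | ∀ x, co f x ∈ w x}
  zero_mem' _ := zero_mem _
  add_mem' hf hg x := add_mem (hf x) (hg x)
  neg_mem' hf x := neg_mem (hf x)

theorem mem_coeffSub {w : ℤ × ℤ → Ideal R} {f : DoubleLaurent R} :
    f ∈ coeffSub w ↔ ∀ x, co f x ∈ w x := Iff.rfl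

/-- All filtrations below have the form `coeffSub`, so their multiplicativity reduces to this
comparison of ideals at each pair of exponents. -/
theorem mul_mem_coeffSub {w w' w'' : ℤ × ℤ → Ideal R} (h : ∀ x y, w x * w' y ≤ w'' (x + y))
    {f g : DoubleLaurent R} (hf : f ∈ coeffSub w) (hg : g ∈ coeffSub w') : f * g ∈ coeffSub w'' := by
  intro z
  refine co_mul_mem f g z (w'' z).toAddSubmonoid fun x y hxy => ?_
  rw [← hxy]
  exact h x y (Ideal.mul_mem_mul (hf x) (hg y))

theorem mono_mem_coeffSub {w : ℤ × ℤ → Ideal R} {x : ℤ × ℤ} {a : R} (h : a ∈ w x) :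
    mono x a ∈ coeffSub w := by
  intro y
  rw [co_mono]
  split_ifs with hy
  · rwa [hy]
  · exact zero_mem _

theorem one_mem_coeffSub {w : ℤ × ℤ → Ideal R} (h : w 0 = ⊤) : (1 : DoubleLaurent R) ∈ coeffSub w :=
  mono_zero_one (R := R) ▸ mono_mem_coeffSub (by simp [h])

/-- A condition on exponents, as a family of ideals. -/
def condIdeal (R : Type u) [CommRing R] (p : Prop) : Ideal R :=
  open Classical in if p then ⊤ else ⊥

theorem mem_condIdeal {p : Prop} {a : R} : a ∈ condIdeal R p ↔ (a ≠ 0 → p) := by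
  unfold condIdeal
  split_ifs with h
  · simp [h]
  · simp [h]

theorem condIdeal_mul_le {p q r : Prop} (h : p → q → r) :
    condIdeal R p * condIdeal R q ≤ condIdeal R r := by
  by_cases hp : p
  · by_cases hq : q
    · simp [condIdeal, h hp hq]
    · simp [condIdeal, hq]
  · simp [condIdeal, hp]

/-! ### Multiplication and the natural topology -/

theorem mem_basicNhd {N : ℤ} {c : ℤ → ℤ} {f : DoubleLaurent R} :
    f ∈ basicNhd R N c ↔ ∀ x : ℤ × ℤ, x.1 < N → x.2 < c x.1 → co f x = 0 :=
  ⟨fun h x => h x.1 x.2, fun h i j => h (i, j)⟩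

end

/-! ### The nilradical and weight filtrations; the groups `1 + 𝔪` and `1 + 𝔭` -/

section

variable {R : Type u} [CommRing R]

/-! ### The filtration by powers of the nilradical -/

/-- The elements with coefficients in the `k`-th power of the nilradical. -/
def nilFil (R : Type u) [CommRing R] (k : ℕ) : AddSubgroup (DoubleLaurent R) :=
  coeffSub fun _ => nilradical R ^ k

theorem mul_mem_nilFil {k l : ℕ} {f g : DoubleLaurent R} (hf : f ∈ nilFil R k)
    (hg : g ∈ nilFil R l) : f * g ∈ nilFil R (k + l) :=
  mul_mem_coeffSub (fun _ _ => (pow_add _ _ _).ge) hf hg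

theorem mem_nilFil_zero (f : DoubleLaurent R) : f ∈ nilFil R 0 := fun x => by simp

theorem nilFil_le {k l : ℕ} (h : k ≤ l) : nilFil R l ≤ nilFil R k :=
  fun _ hf x => Ideal.pow_le_pow_right h (hf x)

theorem mul_mem_nilFil_left {k : ℕ} (f : DoubleLaurent R) {g : DoubleLaurent R}
    (hg : g ∈ nilFil R k) : f * g ∈ nilFil R k := by
  simpa using mul_mem_nilFil (mem_nilFil_zero f) hg

theorem mul_mem_nilFil_right {k : ℕ} (f : DoubleLaurent R) {g : DoubleLaurent R}
    (hg : g ∈ nilFil R k) : g * f ∈ nilFil R k := by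
  rw [mul_comm]; exact mul_mem_nilFil_left f hg

theorem mem_nilFil_one {f : DoubleLaurent R} : f ∈ nilFil R 1 ↔ ∀ x, IsNilpotent (co f x) := by
  simp only [nilFil, mem_coeffSub, pow_one, mem_nilradical]

theorem eq_zero_of_mem_nilFil {K : ℕ} (hK : nilradical R ^ K = 0) {f : DoubleLaurent R}
    (hf : f ∈ nilFil R K) : f = 0 := by
  refine ext_co fun x => ?_
  have := hf x
  simpa [hK] using this

theorem pow_mem_nilFil {f : DoubleLaurent R} (hf : f ∈ nilFil R 1) (n : ℕ) :
    f ^ n ∈ nilFil R n := by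
  induction n with
  | zero => exact mem_nilFil_zero _
  | succ n ih => rw [pow_succ]; exact mul_mem_nilFil ih hf

theorem isNilpotent_of_mem_nilFil (hR : IsNilpotent (nilradical R)) {f : DoubleLaurent R}
    (hf : f ∈ nilFil R 1) : IsNilpotent f := by
  obtain ⟨K, hK⟩ := hR
  exact ⟨K, eq_zero_of_mem_nilFil hK (pow_mem_nilFil hf K)⟩

/-- Modulo a prime the coefficient ring is a domain, hence so is the double Laurent ring over it,
and a nilpotent series reduces to `0`. So every coefficient lies in every prime. -/
theorem mem_nilFil_of_isNilpotent {f : DoubleLaurent R} (hf : IsNilpotent f) :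
    f ∈ nilFil R 1 := by
  rw [mem_nilFil_one]
  intro x
  rw [← mem_nilradical, nilradical_eq_sInf, Ideal.mem_sInf]
  intro p hp
  have hp : p.IsPrime := hp
  have h0 : mapLaurent (mapLaurent (Ideal.Quotient.mk p)) f = 0 := (hf.map _).eq_zero
  rw [← Ideal.Quotient.eq_zero_iff_mem, ← co_mapLaurent, h0, co_zero]

theorem mem_pSet (hR : IsNilpotent (nilradical R)) {f : DoubleLaurent R} :
    f ∈ pSet R ↔ (∀ x, IsNilpotent (co f x)) ∧ ∀ x, co f x ≠ 0 → IsNeg x := by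
  rw [← mem_nilFil_one]
  exact ⟨fun h => ⟨mem_nilFil_of_isNilpotent h.1, fun x => h.2 x.1 x.2⟩,
    fun h => ⟨isNilpotent_of_mem_nilFil hR h.1, fun i j => h.2 (i, j)⟩⟩

theorem mem_mSet {f : DoubleLaurent R} : f ∈ mSet R ↔ ∀ x, co f x ≠ 0 → IsPos x :=
  ⟨fun h x => h x.1 x.2, fun h i j => h (i, j)⟩

/-! ### Positive and negative exponents -/

theorem IsPos.add {x y : ℤ × ℤ} (hx : IsPos x) (hy : IsPos y) : IsPos (x + y) := by
  unfold IsPos at *; simp only [Prod.fst_add, Prod.snd_add]; omega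

theorem IsNeg.add {x y : ℤ × ℤ} (hx : IsNeg x) (hy : IsNeg y) : IsNeg (x + y) := by
  unfold IsNeg at *; simp only [Prod.fst_add, Prod.snd_add]; omega

theorem isPos_or_isNeg {x : ℤ × ℤ} (hx : x ≠ 0) : IsPos x ∨ IsNeg x := by
  have : ¬ (x.1 = 0 ∧ x.2 = 0) := fun h => hx (Prod.ext h.1 h.2)
  unfold IsPos IsNeg; omega

theorem IsPos.ne_zero {x : ℤ × ℤ} (hx : IsPos x) : x ≠ 0 := by
  rintro rfl; simp [IsPos] at hx

theorem IsNeg.ne_zero {x : ℤ × ℤ} (hx : IsNeg x) : x ≠ 0 := by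
  rintro rfl; simp [IsNeg] at hx

theorem IsPos.not_isNeg {x : ℤ × ℤ} (hx : IsPos x) : ¬ IsNeg x := by
  unfold IsPos IsNeg at *; omega

theorem IsPos.nsmul {x : ℤ × ℤ} (hx : IsPos x) {n : ℕ} (hn : 0 < n) : IsPos (n • x) := by
  have h1 : (n • x).1 = n * x.1 := by simp
  have h2 : (n • x).2 = n * x.2 := by simp
  have : (0 : ℤ) < n := by exact_mod_cast hn
  unfold IsPos at *
  rw [h1, h2]
  rcases hx with h | ⟨h, h'⟩
  · exact Or.inl (mul_pos this h)
  · exact Or.inr ⟨by simp [h], mul_pos this h'⟩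

theorem IsPos.neg {x : ℤ × ℤ} (hx : IsPos x) : IsNeg (-x) := by
  unfold IsPos IsNeg at *; simp only [Prod.fst_neg, Prod.snd_neg]; omega

/-! ### The weight filtrations on series with positive exponents -/

/-- The elements without negative powers of `t` such that the exponents `(i, j)` with `i ≤ I` have
weight `j + W * i` at least `n`. -/
def posFil (R : Type u) [CommRing R] (I W : ℤ) (n : ℕ) : AddSubgroup (DoubleLaurent R) :=
  coeffSub fun x => condIdeal R (0 ≤ x.1 ∧ (x.1 ≤ I → (n : ℤ) ≤ x.2 + W * x.1))

theorem mem_posFil {I W : ℤ} {n : ℕ} {f : DoubleLaurent R} :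
    f ∈ posFil R I W n ↔
      ∀ x, co f x ≠ 0 → 0 ≤ x.1 ∧ (x.1 ≤ I → (n : ℤ) ≤ x.2 + W * x.1) := by
  simp only [posFil, mem_coeffSub, mem_condIdeal]

theorem mul_mem_posFil {I W : ℤ} {k l : ℕ} {f g : DoubleLaurent R} (hf : f ∈ posFil R I W k)
    (hg : g ∈ posFil R I W l) : f * g ∈ posFil R I W (k + l) := by
  refine mul_mem_coeffSub (fun x y => condIdeal_mul_le fun h h' => ?_) hf hg
  refine ⟨add_nonneg h.1 h'.1, fun hI => ?_⟩
  simp only [Prod.fst_add, Prod.snd_add] at *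
  have h1 := h.2 (by omega)
  have h2 := h'.2 (by omega)
  push_cast
  linarith [mul_add W x.1 y.1]

theorem one_mem_posFil (I W : ℤ) : (1 : DoubleLaurent R) ∈ posFil R I W 0 :=
  one_mem_coeffSub (by simp [condIdeal])

theorem posFil_antitone (I W : ℤ) : Antitone (posFil R I W) := by
  intro k l hkl f hf
  rw [mem_posFil] at *
  intro x hx
  refine ⟨(hf x hx).1, fun h => ?_⟩
  have := (hf x hx).2 h
  omega

theorem mono_mem_posFil {I W : ℤ} {n : ℕ} {x : ℤ × ℤ} {a : R}
    (h : a ≠ 0 → 0 ≤ x.1 ∧ (x.1 ≤ I → (n : ℤ) ≤ x.2 + W * x.1)) :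
    mono x a ∈ posFil R I W n := mono_mem_coeffSub (mem_condIdeal.2 h)

theorem pow_mem_posFil {I W : ℤ} {f : DoubleLaurent R} (hf : f ∈ posFil R I W 1) (n : ℕ) :
    f ^ n ∈ posFil R I W n := by
  induction n with
  | zero => rw [pow_zero]; exact one_mem_posFil I W
  | succ n ih => rw [pow_succ]; exact mul_mem_posFil ih hf

theorem eq_zero_of_mem_posFil {W : ℤ → ℤ} {f : DoubleLaurent R}
    (h : ∀ I n, f ∈ posFil R I (W I) n) : f = 0 := by
  refine ext_co fun x => ?_
  by_contra hx
  have := (mem_posFil.1 (h x.1 (x.2 + W x.1 * x.1 + 1).toNat) x hx).2 le_rfl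
  omega

/-- Completeness for the weights at all levels `I` simultaneously: each coefficient stabilizes, and
the bound at level `I = i` makes row `i` of the limit bounded below. -/
theorem exists_limit {W : ℤ → ℤ} (f : ℕ → DoubleLaurent R)
    (h0 : ∀ I, f 0 ∈ posFil R I (W I) 0)
    (h : ∀ I n, f (n + 1) - f n ∈ posFil R I (W I) n) :
    ∃ g, ∀ I n, g - f n ∈ posFil R I (W I) n := by
  have hmn : ∀ I n m, n ≤ m → f m - f n ∈ posFil R I (W I) n := by
    intro I n m hm
    induction m, hm using Nat.le_induction with
    | base => simp [zero_mem]
    | succ m hm ih =>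
      have := add_mem (posFil_antitone I (W I) hm (h I m)) ih
      simpa using this
  have hall : ∀ I n, f n ∈ posFil R I (W I) 0 := fun I n => by
    have := add_mem (hmn I 0 n (Nat.zero_le _)) (h0 I)
    simpa using this
  -- `M x` exceeds the weight of `x` measured at the level of its own row, so the coefficient at `x`
  -- no longer changes after step `M x`.
  set M : ℤ × ℤ → ℕ := fun x => (x.2 + W x.1 * x.1 + 1).toNat with hM
  obtain ⟨g, hg⟩ := exists_of_bdd (fun x => co (f (M x)) x) 0 (fun i => -(W i * i)) (by
    intro x hx
    have := mem_posFil.1 (hall x.1 (M x)) x hx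
    refine ⟨this.1, ?_⟩
    have := this.2 le_rfl
    push_cast at this
    linarith)
  refine ⟨g, fun I n => mem_posFil.2 fun x hx => ?_⟩
  rw [co_sub, hg] at hx
  have h1 : co (f (max (M x) n) - f (M x)) x = 0 := by
    by_contra hne
    have := (mem_posFil.1 (hmn x.1 _ _ (le_max_left (M x) n)) x hne).2 le_rfl
    simp only [hM] at this
    omega
  refine mem_posFil.1 (hmn I n _ (le_max_right (M x) n)) x ?_
  rw [co_sub, sub_eq_zero] at h1
  rw [co_sub, h1]
  exact hx

/-- In a row `i ≥ 1` the slope needs only to be at least `1 - β i`; in row `0` positivity already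
gives weight at least `1`. A slope for all rows need not exist, as `β` may decrease faster than
linearly. This is why the weight filtrations look only at rows up to a level `I` and why `W` depends
on `I`. -/
theorem exists_weight (β : ℤ → ℤ) : ∃ W : ℤ → ℤ, ∀ I, 0 ≤ W I ∧
    ∀ x : ℤ × ℤ, IsPos x → x.1 ≤ I → β x.1 ≤ x.2 → 1 ≤ x.2 + W I * x.1 := by
  refine ⟨fun I => ∑ i ∈ Finset.Icc 1 I, |1 - β i|, fun I =>
    ⟨Finset.sum_nonneg fun i _ => abs_nonneg _, fun x hx hI hβ => ?_⟩⟩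
  rcases hx with hx | ⟨hx, hx'⟩
  · have h1 : |1 - β x.1| ≤ ∑ i ∈ Finset.Icc 1 I, |1 - β i| :=
      Finset.single_le_sum (f := fun i => |1 - β i|) (fun i _ => abs_nonneg _)
        (Finset.mem_Icc.2 ⟨hx, hI⟩)
    have h2 := le_abs_self (1 - β x.1)
    have h3 := abs_nonneg (1 - β x.1)
    nlinarith
  · rw [hx]; omega

theorem exists_weight_of_mem_mSet {f : DoubleLaurent R} (hf : f ∈ mSet R) :
    ∃ W : ℤ → ℤ, ∀ I, f ∈ posFil R I (W I) 1 := by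
  obtain ⟨n, β, h⟩ := co_bdd f
  obtain ⟨W, hW⟩ := exists_weight β
  refine ⟨W, fun I => mem_posFil.2 fun x hx => ?_⟩
  have hp := mem_mSet.1 hf x hx
  refine ⟨?_, fun hI => by exact_mod_cast (hW I).2 x hp hI (h x hx).2⟩
  rcases hp with hp | ⟨hp, -⟩
  · exact hp.le
  · exact hp.ge

theorem mem_mSet_of_mem_posFil {W : ℤ} {f : DoubleLaurent R} (h : f ∈ posFil R 0 W 1) :
    f ∈ mSet R := by
  refine mem_mSet.2 fun x hx => ?_
  obtain ⟨h1, h2⟩ := mem_posFil.1 h x hx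
  by_cases h3 : x.1 = 0
  · have := h2 h3.le
    rw [h3] at this
    exact Or.inr ⟨h3, by push_cast at this; omega⟩
  · exact Or.inl (by omega)

theorem mul_mem_mSet {f g : DoubleLaurent R} (hf : f ∈ mSet R) (hg : g ∈ mSet R) :
    f * g ∈ mSet R := by
  refine mem_mSet.2 fun z hz => ?_
  obtain ⟨x, y, rfl, hx, hy⟩ := exists_of_co_mul_ne_zero hz
  exact (mem_mSet.1 hf x hx).add (mem_mSet.1 hg y hy)

theorem add_mem_mSet {f g : DoubleLaurent R} (hf : f ∈ mSet R) (hg : g ∈ mSet R) :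
    f + g ∈ mSet R := by
  refine mem_mSet.2 fun x hx => ?_
  by_cases h : co f x = 0
  · exact mem_mSet.1 hg x fun h' => hx (by simp [h, h'])
  · exact mem_mSet.1 hf x h

theorem mul_sub_one_mem_mSet {f g : DoubleLaurent R} (hf : f - 1 ∈ mSet R) (hg : g - 1 ∈ mSet R) :
    f * g - 1 ∈ mSet R := by
  have : f * g - 1 = (f - 1) * (g - 1) + ((f - 1) + (g - 1)) := by ring
  rw [this]
  exact add_mem_mSet (mul_mem_mSet hf hg) (add_mem_mSet hf hg)

theorem neg_mem_mSet {f : DoubleLaurent R} (hf : f ∈ mSet R) : -f ∈ mSet R :=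
  mem_mSet.2 fun x hx => mem_mSet.1 hf x fun h => hx (by simp [h])

/-- The geometric series in `-(f - 1)` converges because its `n`-th term has weight at least `n` at
every level. -/
theorem exists_inv_of_sub_one_mem_mSet {f : DoubleLaurent R} (hf : f - 1 ∈ mSet R) :
    ∃ g, f * g = 1 ∧ g - 1 ∈ mSet R := by
  obtain ⟨W, hW⟩ := exists_weight_of_mem_mSet (neg_mem_mSet hf)
  obtain ⟨g, hg⟩ := exists_limit (W := W) (fun n => ∑ k ∈ Finset.range n, (-(f - 1)) ^ k)
    (fun I => by simp [zero_mem]) (fun I n => by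
      rw [Finset.sum_range_succ, add_sub_cancel_left]
      exact pow_mem_posFil (hW I) n)
  refine ⟨g, ?_, mem_mSet_of_mem_posFil (W := W 0) (by simpa using hg 0 1)⟩
  rw [← sub_eq_zero]
  refine eq_zero_of_mem_posFil (W := W) fun I n => ?_
  have h1 : f * g - 1 = f * (g - ∑ k ∈ Finset.range n, (-(f - 1)) ^ k) - (-(f - 1)) ^ n := by
    have := mul_neg_geom_sum (-(f - 1)) n
    linear_combination this
  rw [h1]
  refine sub_mem ?_ (pow_mem_posFil (hW I) n)
  have h2 : f ∈ posFil R I (W I) 0 := by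
    have := sub_mem (one_mem_posFil I (W I)) (posFil_antitone I (W I) zero_le_one (hW I))
    simpa using this
  simpa using mul_mem_posFil h2 (hg I n)

/-! ### The group `1 + 𝔭` -/

theorem mul_mem_pSet (hR : IsNilpotent (nilradical R)) {f g : DoubleLaurent R} (hf : f ∈ pSet R)
    (hg : g ∈ pSet R) : f * g ∈ pSet R := by
  rw [mem_pSet hR, ← mem_nilFil_one] at *
  refine ⟨mul_mem_nilFil_left _ hg.1, fun z hz => ?_⟩
  obtain ⟨x, y, rfl, hx, hy⟩ := exists_of_co_mul_ne_zero hz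
  exact (hf.2 x hx).add (hg.2 y hy)

theorem add_mem_pSet (hR : IsNilpotent (nilradical R)) {f g : DoubleLaurent R} (hf : f ∈ pSet R)
    (hg : g ∈ pSet R) : f + g ∈ pSet R := by
  rw [mem_pSet hR, ← mem_nilFil_one] at *
  refine ⟨add_mem hf.1 hg.1, fun x hx => ?_⟩
  by_cases h : co f x = 0
  · exact hg.2 x fun h' => hx (by simp [h, h'])
  · exact hf.2 x h

theorem zero_mem_pSet : (0 : DoubleLaurent R) ∈ pSet R := ⟨IsNilpotent.zero, by simp [cf]⟩

theorem zero_mem_mSet : (0 : DoubleLaurent R) ∈ mSet R := by simp [mSet, cf]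

theorem neg_mem_pSet {f : DoubleLaurent R} (hf : f ∈ pSet R) : -f ∈ pSet R :=
  ⟨hf.1.neg, fun i j h => hf.2 i j fun h' => h (by rw [cf_eq_co, co_neg, ← cf_eq_co, h', neg_zero])⟩

theorem mul_sub_one_mem_pSet (hR : IsNilpotent (nilradical R)) {f g : DoubleLaurent R}
    (hf : f - 1 ∈ pSet R) (hg : g - 1 ∈ pSet R) : f * g - 1 ∈ pSet R := by
  have : f * g - 1 = (f - 1) * (g - 1) + ((f - 1) + (g - 1)) := by ring
  rw [this]
  exact add_mem_pSet hR (mul_mem_pSet hR hf hg) (add_mem_pSet hR hf hg)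

theorem exists_inv_of_sub_one_mem_pSet (hR : IsNilpotent (nilradical R)) {f : DoubleLaurent R}
    (hf : f - 1 ∈ pSet R) : ∃ g, f * g = 1 ∧ g - 1 ∈ pSet R := by
  have hy := neg_mem_pSet hf
  have hpow : ∀ k : ℕ, (-(f - 1)) ^ (k + 1) ∈ pSet R := by
    intro k
    induction k with
    | zero => simpa using hy
    | succ k ih => rw [pow_succ]; exact mul_mem_pSet hR ih hy
  have hsum : ∀ k : ℕ, ∑ l ∈ Finset.range k, (-(f - 1)) ^ (l + 1) ∈ pSet R := by
    intro k
    induction k with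
    | zero => simpa using zero_mem_pSet
    | succ k ih => rw [Finset.sum_range_succ]; exact add_mem_pSet hR ih (hpow k)
  obtain ⟨n, hn⟩ := hy.1
  refine ⟨∑ l ∈ Finset.range (n + 1), (-(f - 1)) ^ l, ?_, ?_⟩
  · have := mul_neg_geom_sum (-(f - 1)) (n + 1)
    rw [pow_succ, hn] at this
    linear_combination this
  · rw [Finset.sum_range_succ', pow_zero, add_sub_cancel_right]
    exact hsum n

end

/-! ### Idempotents and powers with locally constant exponents -/

section

variable {R : Type u} [CommRing R]

/-! ### Idempotents and powers with locally constant exponents -/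

theorem idem_mem_iff (n : ZConst R) (k : ℤ) (p : PrimeSpectrum R) :
    idem n k ∈ p.asIdeal ↔ n p ≠ k := by
  rw [ne_eq, ← idem_notMem_iff n k p, not_not]

/-- An idempotent is determined by its open and closed subset: `e * (1 - e')` is an idempotent lying
in every prime, hence `0`, and symmetrically. -/
theorem eq_of_isIdempotentElem {e e' : R} (he : IsIdempotentElem e) (he' : IsIdempotentElem e')
    (h : ∀ p : PrimeSpectrum R, e ∈ p.asIdeal ↔ e' ∈ p.asIdeal) : e = e' := by
  have key : ∀ {a b : R}, IsIdempotentElem a → IsIdempotentElem b →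
      (∀ p : PrimeSpectrum R, a ∈ p.asIdeal ↔ b ∈ p.asIdeal) → a * (1 - b) = 0 := by
    intro a b ha hb hab
    refine idem_eq_zero_of_forall (ha.mul hb.one_sub) fun p => ?_
    by_cases hp : a ∈ p.asIdeal
    · exact Ideal.mul_mem_right _ _ hp
    · have h0 : b * (1 - b) = 0 := by rw [mul_sub, mul_one, hb.eq, sub_self]
      have h1 : b * (1 - b) ∈ p.asIdeal := h0 ▸ zero_mem _
      exact Ideal.mul_mem_left _ _ ((p.isPrime.mem_or_mem h1).resolve_left fun h => hp ((hab p).2 h))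
  have h1 := key he he' h
  have h2 := key he' he fun p => (h p).symm
  linear_combination h1 - h2

theorem idem_eq_zero_of_notMem {n : ZConst R} {k : ℤ} (h : k ∉ valueSet n) : idem n k = 0 := by
  refine idem_eq_zero_of_forall (idem_isIdempotent n k) fun p => ?_
  rw [idem_mem_iff]
  rintro rfl
  simp [valueSet] at h

theorem idem_mul_idem_mul_idem {n m r : ZConst R} {k l q : ℤ}
    (h : ∀ p, n p = k → m p = l → r p = q) :
    idem n k * idem m l * idem r q = idem n k * idem m l := by
  have h1 := (idem_isIdempotent n k).mul (idem_isIdempotent m l)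
  refine eq_of_isIdempotentElem (h1.mul (idem_isIdempotent r q)) h1 fun p => ?_
  simp only [p.isPrime.mul_mem_iff_mem_or_mem, idem_mem_iff]
  have := h p
  tauto

/-- The idempotents of `n` sum to `1`, so identities may be checked on each piece `{n = k}`, where a
power with exponent `n` is an ordinary `k`-th power. -/
theorem eq_of_idem_mul_eq {A : Type v} [CommRing A] (ι : R →+* A) (n : ZConst R) {a b : A}
    (h : ∀ k, ι (idem n k) * a = ι (idem n k) * b) : a = b := by
  have h1 : ∀ c : A, c = ∑ k ∈ valueSet n, ι (idem n k) * c := fun c => by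
    rw [← Finset.sum_mul, ← map_sum, sum_idem, map_one, one_mul]
  rw [h1 a, h1 b]
  exact Finset.sum_congr rfl fun k _ => h k

theorem idem_mul_powAlong {A : Type v} [CommRing A] (ι : R →+* A) (a : Aˣ) (n : ZConst R) (k : ℤ) :
    ι (idem n k) * (powAlong ι a n : A) = ι (idem n k) * ((a ^ k : Aˣ) : A) := by
  change ι (idem n k) * ∑ l ∈ valueSet n, ι (idem n l) * ((a ^ l : Aˣ) : A) = _
  rw [Finset.mul_sum]
  rw [Finset.sum_eq_single k]
  · rw [← mul_assoc, ← map_mul, idem_isIdempotent]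
  · intro l _ hl
    rw [← mul_assoc, ← map_mul, idem_mul_of_ne n hl.symm, map_zero, zero_mul]
  · intro h
    rw [← mul_assoc, ← map_mul, idem_isIdempotent, idem_eq_zero_of_notMem h, map_zero, zero_mul]

theorem mul_powAlong_of_idem {A : Type v} [CommRing A] (ι : R →+* A) (a : Aˣ) (n : ZConst R) (k : ℤ)
    {e : R} (he : e * idem n k = e) :
    ι e * (powAlong ι a n : A) = ι e * ((a ^ k : Aˣ) : A) := by
  rw [← he, map_mul, mul_assoc, idem_mul_powAlong, mul_assoc]

theorem powAlong_ext {A : Type v} [CommRing A] (ι : R →+* A) (a b : Aˣ) (n : ZConst R)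
    (h : ∀ k, ι (idem n k) * (b : A) = ι (idem n k) * ((a ^ k : Aˣ) : A)) :
    powAlong ι a n = b :=
  Units.ext (eq_of_idem_mul_eq ι n fun k => by rw [idem_mul_powAlong, h k])

theorem powAlong_mul {A : Type v} [CommRing A] (ι : R →+* A) (a b : Aˣ) (n : ZConst R) :
    powAlong ι (a * b) n = powAlong ι a n * powAlong ι b n := by
  refine powAlong_ext ι _ _ n fun k => ?_
  rw [Units.val_mul, ← mul_assoc, idem_mul_powAlong, mul_right_comm, idem_mul_powAlong,
    mul_zpow, Units.val_mul]
  ring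

theorem powAlong_add {A : Type v} [CommRing A] (ι : R →+* A) (a : Aˣ) (n m : ZConst R) :
    powAlong ι a (n + m) = powAlong ι a n * powAlong ι a m := by
  refine Units.ext (eq_of_idem_mul_eq ι n fun k => eq_of_idem_mul_eq ι m fun l => ?_)
  have h := idem_mul_idem_mul_idem (n := n) (m := m) (r := n + m) (k := k) (l := l) (q := k + l)
    fun p h1 h2 => by simp [h1, h2]
  have h1 : idem n k * idem m l * idem n k = idem n k * idem m l := by
    rw [mul_right_comm, idem_isIdempotent]
  have h2 : idem n k * idem m l * idem m l = idem n k * idem m l := by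
    rw [mul_assoc, idem_isIdempotent]
  have e := mul_powAlong_of_idem ι a (n + m) (k + l) h
  have e1 := mul_powAlong_of_idem ι a n k h1
  have e2 := mul_powAlong_of_idem ι a m l h2
  rw [zpow_add, Units.val_mul] at e
  simp only [map_mul] at e e1 e2
  rw [Units.val_mul]
  linear_combination e - (powAlong ι a m : A) * e1 - ((a ^ k : Aˣ) : A) * e2

@[simp] theorem powAlong_zero {A : Type v} [CommRing A] (ι : R →+* A) (a : Aˣ) :
    powAlong ι a 0 = 1 := by
  have := powAlong_add ι a 0 0
  simpa using this

@[simp] theorem powAlong_one_left {A : Type v} [CommRing A] (ι : R →+* A) (n : ZConst R) :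
    powAlong ι 1 n = 1 := by
  have := powAlong_mul ι 1 1 n
  simpa using this

/-- `a ↦ a ^ n` as a homomorphism. -/
def lpowHom (n : ZConst R) : Rˣ →* Rˣ where
  toFun a := lpow a n
  map_one' := powAlong_one_left _ n
  map_mul' a b := powAlong_mul _ a b n

theorem lpow_mul (a b : Rˣ) (n : ZConst R) : lpow (a * b) n = lpow a n * lpow b n :=
  powAlong_mul _ a b n

theorem lpow_add (a : Rˣ) (n m : ZConst R) : lpow a (n + m) = lpow a n * lpow a m :=
  powAlong_add _ a n m

@[simp] theorem lpow_zero (a : Rˣ) : lpow a 0 = 1 := powAlong_zero _ a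

@[simp] theorem lpow_one_left (n : ZConst R) : lpow (1 : Rˣ) n = 1 := powAlong_one_left _ n

theorem lpow_inv (a : Rˣ) (n : ZConst R) : lpow a⁻¹ n = (lpow a n)⁻¹ := map_inv (lpowHom n) a

theorem lpow_neg (a : Rˣ) (n : ZConst R) : lpow a (-n) = (lpow a n)⁻¹ := by
  rw [eq_inv_iff_mul_eq_one, ← lpow_add]; simp

theorem uPow_add (n m : ZConst R) : uPow (n + m) = uPow n * uPow m := powAlong_add _ _ n m

theorem tPow_add (n m : ZConst R) : tPow (n + m) = tPow n * tPow m := powAlong_add _ _ n m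

@[simp] theorem uPow_zero : uPow (0 : ZConst R) = 1 := powAlong_zero _ _

@[simp] theorem tPow_zero : tPow (0 : ZConst R) = 1 := powAlong_zero _ _

/-- On a piece `{n = k, m = l}` either `k` and `l` have equal parity and the two powers agree, or
the piece is empty and its idempotent vanishes. -/
theorem lpow_neg_one_congr {n m : ZConst R} (h : ∀ p, (n p : ZMod 2) = m p) :
    lpow (-1 : Rˣ) n = lpow (-1) m := by
  refine Units.ext (eq_of_idem_mul_eq (RingHom.id R) n fun k =>
    eq_of_idem_mul_eq (RingHom.id R) m fun l => ?_)
  by_cases hkl : (k : ZMod 2) = l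
  · have h1 := idem_mul_powAlong (RingHom.id R) (-1) n k
    have h2 := idem_mul_powAlong (RingHom.id R) (-1) m l
    have h3 : ((-1 : Rˣ) ^ k) = (-1) ^ l := by
      rw [ZMod.intCast_eq_intCast_iff_dvd_sub] at hkl
      obtain ⟨c, hc⟩ := hkl
      rw [show l = k + 2 * c by push_cast at hc; omega, zpow_add, zpow_mul]
      simp
    rw [← h3] at h2
    change (RingHom.id R) (idem m l) * (RingHom.id R (idem n k) *
      (powAlong (RingHom.id R) (-1) n : R)) = RingHom.id R (idem m l) * (RingHom.id R (idem n k) *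
      (powAlong (RingHom.id R) (-1) m : R))
    rw [h1, mul_left_comm, ← mul_assoc, mul_left_comm _ _ (powAlong (RingHom.id R) (-1) m : R), h2]
    ring
  · have h0 : idem n k * idem m l = 0 := by
      refine idem_eq_zero_of_forall ((idem_isIdempotent n k).mul (idem_isIdempotent m l)) fun p => ?_
      rw [p.isPrime.mul_mem_iff_mem_or_mem, idem_mem_iff, idem_mem_iff]
      by_contra hc
      push Not at hc
      exact hkl (by rw [← hc.1, ← hc.2, h p])
    simp only [RingHom.id_apply, ← mul_assoc]
    rw [mul_comm (idem m l), h0, zero_mul, zero_mul]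

theorem lpow_neg_one_eq_inv (n : ZConst R) : (lpow (-1 : Rˣ) n)⁻¹ = lpow (-1) n := by
  rw [← lpow_inv]; simp

/-! ### Functoriality of powers -/

/-- The pull-back `ℤ(R) → ℤ(S)`. -/
def comapZ {S : Type v} [CommRing S] (φ : R →+* S) (n : ZConst R) : ZConst S :=
  n.comap ⟨PrimeSpectrum.comap φ, PrimeSpectrum.continuous_comap φ⟩

@[simp] theorem comapZ_apply {S : Type v} [CommRing S] (φ : R →+* S) (n : ZConst R)
    (p : PrimeSpectrum S) : comapZ φ n p = n (PrimeSpectrum.comap φ p) := rfl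

theorem idem_comapZ {S : Type v} [CommRing S] (φ : R →+* S) (n : ZConst R) (k : ℤ) :
    idem (comapZ φ n) k = φ (idem n k) := by
  refine eq_of_isIdempotentElem (idem_isIdempotent _ k) ((idem_isIdempotent n k).map φ) fun p => ?_
  rw [idem_mem_iff, comapZ_apply, ← idem_mem_iff]
  rfl

theorem map_powAlong {S : Type v} [CommRing S] (φ : R →+* S) {A B : Type*} [CommRing A]
    [CommRing B] (ι : R →+* A) (ι' : S →+* B) (ψ : A →+* B) (h : ∀ r, ψ (ι r) = ι' (φ r))
    (a : Aˣ) (n : ZConst R) :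
    Units.map (ψ : A →* B) (powAlong ι a n) =
      powAlong ι' (Units.map (ψ : A →* B) a) (comapZ φ n) := by
  symm
  refine powAlong_ext ι' _ _ _ fun k => ?_
  have := congrArg ψ (idem_mul_powAlong ι a n k)
  rw [map_mul, map_mul, h] at this
  rw [idem_comapZ, ← map_zpow]
  exact this

theorem map_lpow {S : Type v} [CommRing S] (φ : R →+* S) (a : Rˣ) (n : ZConst R) :
    Units.map (φ : R →* S) (lpow a n) = lpow (Units.map (φ : R →* S) a) (comapZ φ n) :=
  map_powAlong φ _ _ φ (fun _ => rfl) a n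

theorem mapLaurent_mono {S : Type v} [CommRing S] (φ : R →+* S) (x : ℤ × ℤ) (a : R) :
    mapLaurent (mapLaurent φ) (mono x a) = mono x (φ a) := by
  refine ext_co fun y => ?_
  rw [co_mapLaurent, co_mono, co_mono]
  split_ifs <;> simp

theorem mapUnits_val {S : Type v} [CommRing S] (φ : R →+* S) (f : (DoubleLaurent R)ˣ) :
    (mapUnits φ f : DoubleLaurent S) = mapLaurent (mapLaurent φ) f := rfl

theorem mapUnits_uPow {S : Type v} [CommRing S] (φ : R →+* S) (n : ZConst R) :
    mapUnits φ (uPow n) = uPow (comapZ φ n) := by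
  refine (map_powAlong φ (constHom R) (constHom S) (mapLaurent (mapLaurent φ))
    (fun r => mapLaurent_mono φ 0 r) (uUnit R) n).trans ?_
  congr 1
  refine Units.ext ?_
  change mapLaurent (mapLaurent φ) (mono (0, 1) 1) = mono (0, 1) 1
  rw [mapLaurent_mono, map_one]

theorem mapUnits_tPow {S : Type v} [CommRing S] (φ : R →+* S) (n : ZConst R) :
    mapUnits φ (tPow n) = tPow (comapZ φ n) := by
  refine (map_powAlong φ (constHom R) (constHom S) (mapLaurent (mapLaurent φ))
    (fun r => mapLaurent_mono φ 0 r) (tUnit R) n).trans ?_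
  congr 1
  refine Units.ext ?_
  change mapLaurent (mapLaurent φ) (mono (1, 0) 1) = mono (1, 0) 1
  rw [mapLaurent_mono, map_one]

theorem mapUnits_constUnit {S : Type v} [CommRing S] (φ : R →+* S) (a : Rˣ) :
    mapUnits φ (constUnit a) = constUnit (Units.map (φ : R →* S) a) :=
  Units.ext (mapLaurent_mono φ 0 a)

end

/-! ### Leading exponents at primes and the splitting of a unit -/

section

variable {R : Type u} [CommRing R]

/-! ### Lexicographic valuations at primes -/

theorem constHom_co (a : R) (f : DoubleLaurent R) (x : ℤ × ℤ) :
    co (constHom R a * f) x = a * co f x := by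
  rw [constHom_apply, co_mono_mul, sub_zero]

/-- `x` is the lexicographic valuation of the reduction of `f` modulo `p`. -/
def IsLexVal (f : DoubleLaurent R) (p : PrimeSpectrum R) (x : ℤ × ℤ) : Prop :=
  (∀ y, IsNeg (y - x) → co f y ∈ p.asIdeal) ∧ co f x ∉ p.asIdeal

theorem IsLexVal.unique {f : DoubleLaurent R} {p : PrimeSpectrum R} {x y : ℤ × ℤ}
    (hx : IsLexVal f p x) (hy : IsLexVal f p y) : x = y := by
  by_contra hne
  rcases isPos_or_isNeg (sub_ne_zero.2 hne) with h | h
  · exact hy.2 (hx.1 y (by simpa using h.neg))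
  · exact hx.2 (hy.1 x h)

/-- Modulo `p`, a pair of exponents with sum `x + y` other than `(x, y)` has one member below its
bound. Only the product of the two leading coefficients survives, and it is nonzero since `p` is
prime. -/
theorem IsLexVal.mul {f g : DoubleLaurent R} {p : PrimeSpectrum R} {x y : ℤ × ℤ}
    (hx : IsLexVal f p x) (hy : IsLexVal g p y) : IsLexVal (f * g) p (x + y) := by
  constructor
  · intro z hz
    refine co_mul_mem f g z p.asIdeal.toAddSubmonoid fun a b hab => ?_
    have : IsNeg (a - x) ∨ IsNeg (b - y) := by
      rw [← hab] at hz
      unfold IsNeg at *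
      simp only [Prod.fst_sub, Prod.snd_sub, Prod.fst_add, Prod.snd_add] at *
      omega
    rcases this with h | h
    · exact Ideal.mul_mem_right _ _ (hx.1 a h)
    · exact Ideal.mul_mem_left _ _ (hy.1 b h)
  · have h1 : co (f * g) (x + y) =
        co f x * co g y + co ((f - mono x (co f x)) * g) (x + y) := by
      rw [sub_mul, co_sub, co_mono_mul, add_sub_cancel_left]; ring
    have h2 : co ((f - mono x (co f x)) * g) (x + y) ∈ p.asIdeal := by
      refine co_mul_mem _ g _ p.asIdeal.toAddSubmonoid fun a b hab => ?_
      by_cases hax : a = x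
      · have : co (f - mono x (co f x)) a = 0 := by rw [co_sub, co_mono, hax]; simp
        rw [this, zero_mul]
        exact zero_mem _
      · rw [co_sub, co_mono, if_neg hax, sub_zero]
        rcases isPos_or_isNeg (sub_ne_zero.2 hax) with h | h
        · refine Ideal.mul_mem_left _ _ (hy.1 b ?_)
          have : b - y = -(a - x) := by linear_combination hab
          rw [this]
          exact h.neg
        · exact Ideal.mul_mem_right _ _ (hx.1 a h)
    rw [h1]
    intro h3
    rcases p.isPrime.mem_or_mem ((Ideal.add_mem_iff_left _ h2).1 h3) with h | h
    · exact hx.2 h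
    · exact hy.2 h

theorem IsLexVal.congr_of_mul {f g : DoubleLaurent R} {p : PrimeSpectrum R} {x : ℤ × ℤ} {e : R}
    (he : e ∉ p.asIdeal) (h : constHom R e * f = constHom R e * g) (hg : IsLexVal g p x) :
    IsLexVal f p x := by
  have key : ∀ y, co f y ∈ p.asIdeal ↔ co g y ∈ p.asIdeal := fun y => by
    have := congrArg (fun F => co F y ∈ p.asIdeal) h
    simp only [constHom_co, p.isPrime.mul_mem_iff_mem_or_mem, he, false_or] at this
    exact iff_of_eq this
  exact ⟨fun y hy => (key y).2 (hg.1 y hy), fun h' => hg.2 ((key x).1 h')⟩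

theorem isLexVal_mono (x : ℤ × ℤ) (p : PrimeSpectrum R) : IsLexVal (mono x (1 : R)) p x := by
  refine ⟨fun y hy => ?_, ?_⟩
  · rw [co_mono, if_neg (fun h => hy.ne_zero (by rw [h, sub_self]))]
    exact zero_mem _
  · rw [co_mono, if_pos rfl]
    exact fun h => p.isPrime.ne_top ((Ideal.eq_top_iff_one _).2 h)

theorem isLexVal_constUnit (a : Rˣ) (p : PrimeSpectrum R) :
    IsLexVal (constUnit a : DoubleLaurent R) p 0 := by
  have h : ∀ y, co (constUnit a : DoubleLaurent R) y = if y = 0 then (a : R) else 0 :=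
    co_mono 0 (a : R)
  refine ⟨fun y hy => ?_, ?_⟩
  · rw [h, if_neg (fun h0 => hy.ne_zero (by rw [h0, sub_self]))]
    exact zero_mem _
  · rw [h, if_pos rfl]
    exact fun h => p.isPrime.ne_top (Ideal.eq_top_of_isUnit_mem _ h a.isUnit)

theorem isLexVal_one (p : PrimeSpectrum R) : IsLexVal (1 : DoubleLaurent R) p 0 :=
  mono_zero_one (R := R) ▸ isLexVal_mono 0 p

/-- Not all coefficients of a unit lie in `p`; the lower bounds of the support provide a first
surviving row, and then a first surviving entry in it. -/
theorem exists_isLexVal {f g : DoubleLaurent R} (hfg : f * g = 1) (p : PrimeSpectrum R) :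
    ∃ x, IsLexVal f p x := by
  have hne : ∃ i j, co f (i, j) ∉ p.asIdeal := by
    by_contra hc
    push Not at hc
    have h1 : co (f * g) 0 ∈ p.asIdeal :=
      co_mul_mem f g 0 p.asIdeal.toAddSubmonoid fun x y _ => Ideal.mul_mem_right _ _ (hc x.1 x.2)
    rw [hfg, co_one, if_pos rfl] at h1
    exact p.isPrime.ne_top ((Ideal.eq_top_iff_one _).2 h1)
  obtain ⟨n, β, hb⟩ := co_bdd f
  have hb' : ∀ x, co f x ∉ p.asIdeal → n ≤ x.1 ∧ β x.1 ≤ x.2 :=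
    fun x hx => hb x fun h => hx (h ▸ zero_mem _)
  obtain ⟨i, ⟨j₀, hj₀⟩, hi⟩ := Int.exists_least_of_bdd (P := fun i => ∃ j, co f (i, j) ∉ p.asIdeal)
    ⟨n, fun i ⟨j, hj⟩ => (hb' _ hj).1⟩ hne
  obtain ⟨j, hj, hj'⟩ := Int.exists_least_of_bdd (P := fun j => co f (i, j) ∉ p.asIdeal)
    ⟨β i, fun j hj => (hb' _ hj).2⟩ ⟨j₀, hj₀⟩
  refine ⟨(i, j), fun y hy => ?_, hj⟩
  by_contra hc
  have h1 := hi y.1 ⟨y.2, hc⟩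
  rcases hy with hy | ⟨hy, hy'⟩
  · simp only [Prod.fst_sub] at hy; omega
  · simp only [Prod.fst_sub, Prod.snd_sub] at hy hy'
    have : y.1 = i := by omega
    have h2 := hj' y.2 (this ▸ hc)
    omega

theorem isLexVal_of_sub_one_mem_mSet {f : DoubleLaurent R} (hf : f - 1 ∈ mSet R)
    (p : PrimeSpectrum R) : IsLexVal f p 0 := by
  have key : ∀ y, ¬ IsPos y → co f y = co 1 y := fun y hy => by
    by_contra h
    exact hy (mem_mSet.1 hf y (sub_ne_zero.2 h))
  obtain ⟨h1, h2⟩ := isLexVal_one (R := R) p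
  refine ⟨fun y hy => ?_, ?_⟩
  · rw [key y fun h => h.not_isNeg (by simpa using hy)]
    exact h1 y hy
  · rwa [key 0 (by simp [IsPos])]

theorem isLexVal_of_sub_one_mem_pSet (hR : IsNilpotent (nilradical R)) {f : DoubleLaurent R}
    (hf : f - 1 ∈ pSet R) (p : PrimeSpectrum R) : IsLexVal f p 0 := by
  rw [mem_pSet hR] at hf
  obtain ⟨h1, h2⟩ := isLexVal_one (R := R) p
  have key : ∀ y, co (f - 1) y ∈ p.asIdeal := fun y =>
    nilradical_le_prime p.asIdeal (mem_nilradical.2 (hf.1 y))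
  have key' : ∀ y, co f y = co (f - 1) y + co 1 y := fun y => by simp
  refine ⟨fun y hy => ?_, fun h => h2 ?_⟩
  · rw [key']; exact add_mem (key y) (h1 y hy)
  · rwa [key', Ideal.add_mem_iff_right _ (key 0)] at h

/-- The monomial `u ^ x.2 * t ^ x.1` as a unit. -/
def monoHom (R : Type u) [CommRing R] : Multiplicative (ℤ × ℤ) →* (DoubleLaurent R)ˣ where
  toFun x := ⟨mono x.toAdd 1, mono (-x.toAdd) 1, by rw [mono_mul]; simp [mono_zero_one],
    by rw [mono_mul]; simp [mono_zero_one]⟩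
  map_one' := rfl
  map_mul' x y := by ext1; simp [mono_mul]

theorem uUnit_zpow (k : ℤ) : ((uUnit R ^ k : (DoubleLaurent R)ˣ) : DoubleLaurent R) =
    mono (0, k) 1 := by
  have h : uUnit R = monoHom R (Multiplicative.ofAdd (0, 1)) := rfl
  rw [h, ← map_zpow, ← ofAdd_zsmul]
  change mono (k • ((0 : ℤ), (1 : ℤ))) 1 = _
  simp

theorem tUnit_zpow (k : ℤ) : ((tUnit R ^ k : (DoubleLaurent R)ˣ) : DoubleLaurent R) =
    mono (k, 0) 1 := by
  have h : tUnit R = monoHom R (Multiplicative.ofAdd (1, 0)) := rfl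
  rw [h, ← map_zpow, ← ofAdd_zsmul]
  change mono (k • ((1 : ℤ), (0 : ℤ))) 1 = _
  simp

theorem isLexVal_uPow (n : ZConst R) (p : PrimeSpectrum R) :
    IsLexVal (uPow n : DoubleLaurent R) p (0, n p) :=
  ((isLexVal_mono _ p).congr_of_mul ((idem_notMem_iff n (n p) p).2 rfl)
    (by rw [← uUnit_zpow]; exact idem_mul_powAlong (constHom R) (uUnit R) n (n p)))

theorem isLexVal_tPow (n : ZConst R) (p : PrimeSpectrum R) :
    IsLexVal (tPow n : DoubleLaurent R) p (n p, 0) :=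
  ((isLexVal_mono _ p).congr_of_mul ((idem_notMem_iff n (n p) p).2 rfl)
    (by rw [← tUnit_zpow]; exact idem_mul_powAlong (constHom R) (tUnit R) n (n p)))

theorem IsSplitting.isLexVal (hR : IsNilpotent (nilradical R)) {f : (DoubleLaurent R)ˣ}
    {s : Splitting R} (h : IsSplitting f s) (p : PrimeSpectrum R) :
    IsLexVal (f : DoubleLaurent R) p (s.n1 p, s.n2 p) := by
  rw [h.eq]
  have := ((isLexVal_of_sub_one_mem_pSet hR h.neg_mem p).mul
    (((isLexVal_constUnit s.unit p).mul (isLexVal_uPow s.n2 p)).mul (isLexVal_tPow s.n1 p))).mul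
    (isLexVal_of_sub_one_mem_mSet h.pos_mem p)
  simpa using this

/-- Having leading exponent at most `x` is an open condition on the prime, as it says that some
coefficient at an exponent `≤ x` does not vanish there. The leading exponents of `f` and `f⁻¹` add
up to `0`, so the same condition for `f⁻¹` and `-x` says "at least `x`". Thus every fiber is open.
-/
theorem exists_nu (f : (DoubleLaurent R)ˣ) : ∃ n1 n2 : ZConst R, ∀ p,
    IsLexVal (f : DoubleLaurent R) p (n1 p, n2 p) := by
  choose v hv using exists_isLexVal f.mul_inv
  choose w hw using exists_isLexVal f.inv_mul
  have hvw : ∀ p, v p + w p = 0 := fun p => by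
    have h1 := (hv p).mul (hw p)
    rw [f.mul_inv] at h1
    exact h1.unique (isLexVal_one p)
  have hopen : ∀ (g : DoubleLaurent R) (x : ℤ × ℤ),
      IsOpen {p : PrimeSpectrum R | ∃ y, ¬ IsPos (y - x) ∧ co g y ∉ p.asIdeal} := fun g x => by
    have : {p : PrimeSpectrum R | ∃ y, ¬ IsPos (y - x) ∧ co g y ∉ p.asIdeal} =
        ⋃ y : ℤ × ℤ, ⋃ _ : ¬ IsPos (y - x), (PrimeSpectrum.basicOpen (co g y) : Set _) := by
      ext p; simp
    rw [this]
    exact isOpen_iUnion fun y => isOpen_iUnion fun _ => PrimeSpectrum.isOpen_basicOpen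
  have hloc : IsLocallyConstant v := by
    rw [IsLocallyConstant.iff_isOpen_fiber]
    intro x
    have : v ⁻¹' {x} = {p | ∃ y, ¬ IsPos (y - x) ∧ co (f : DoubleLaurent R) y ∉ p.asIdeal} ∩
        {p | ∃ y, ¬ IsPos (y - -x) ∧ co (↑f⁻¹ : DoubleLaurent R) y ∉ p.asIdeal} := by
      ext p
      simp only [Set.mem_preimage, Set.mem_singleton_iff, Set.mem_inter_iff, Set.mem_ofPred_eq]
      constructor
      · rintro rfl
        have h : w p = -v p := by linear_combination hvw p
        exact ⟨⟨v p, by simp [IsPos], (hv p).2⟩, ⟨w p, by simp [IsPos, h], (hw p).2⟩⟩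
      · rintro ⟨⟨y, hy, hy'⟩, z, hz, hz'⟩
        have h1 : ¬ IsNeg (y - v p) := fun h => hy' ((hv p).1 y h)
        have h2 : ¬ IsNeg (z - w p) := fun h => hz' ((hw p).1 z h)
        have h3 := congrArg Prod.fst (hvw p)
        have h4 := congrArg Prod.snd (hvw p)
        unfold IsPos IsNeg at *
        simp only [Prod.fst_sub, Prod.snd_sub, Prod.fst_add, Prod.snd_add, Prod.fst_neg,
          Prod.snd_neg, Prod.fst_zero, Prod.snd_zero] at *
        exact Prod.ext (by omega) (by omega)
    rw [this]
    exact (hopen _ _).inter (hopen _ _)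
  exact ⟨⟨fun p => (v p).1, hloc.comp Prod.fst⟩, ⟨fun p => (v p).2, hloc.comp Prod.snd⟩, hv⟩

/-! ### Existence and uniqueness of the splitting -/

theorem exists_trunc (P : ℤ × ℤ → Prop) (f : DoubleLaurent R) :
    ∃ g : DoubleLaurent R, ∀ x, (P x → co g x = co f x) ∧ (¬ P x → co g x = 0) := by
  classical
  obtain ⟨n, β, h⟩ := co_bdd f
  obtain ⟨g, hg⟩ := exists_of_bdd (fun x => if P x then co f x else 0) n β fun x hx =>
    h x fun h0 => hx (by simp [h0])
  exact ⟨g, fun x => ⟨fun hx => by rw [hg, if_pos hx], fun hx => by rw [hg, if_neg hx]⟩⟩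

theorem exists_neg_zero_pos (f : DoubleLaurent R) :
    ∃ fm fp : DoubleLaurent R, f = fm + constHom R (co f 0) + fp ∧ fp ∈ mSet R ∧
      (∀ x, co fm x ≠ 0 → IsNeg x) ∧ (∀ x, co fm x ≠ 0 → co fm x = co f x) := by
  obtain ⟨fm, hm⟩ := exists_trunc IsNeg f
  obtain ⟨fp, hp⟩ := exists_trunc IsPos f
  refine ⟨fm, fp, ext_co fun x => ?_, mem_mSet.2 fun x hx => ?_, fun x hx => ?_, fun x hx => ?_⟩
  · simp only [co_add, constHom_apply, co_mono]
    by_cases hx : x = 0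
    · subst hx
      rw [(hm 0).2 (by simp [IsNeg]), (hp 0).2 (by simp [IsPos])]; simp
    · rcases isPos_or_isNeg hx with h | h
      · rw [(hm x).2 h.not_isNeg, (hp x).1 h, if_neg hx]; simp
      · rw [(hm x).1 h, (hp x).2 fun h' => h'.not_isNeg h, if_neg hx]; simp
  · by_contra h; exact hx ((hp x).2 h)
  · by_contra h; exact hx ((hm x).2 h)
  · by_cases h : IsNeg x
    · exact (hm x).1 h
    · exact absurd ((hm x).2 h) hx

/-- Successive approximation along powers of the nilradical: if the error has coefficients in the
power `k + 1`, its negative, constant and positive parts are absorbed into the three factors, and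
the new error is quadratic in these parts. The approximation is exact once the power vanishes. -/
theorem exists_factorization (hR : IsNilpotent (nilradical R)) (f : DoubleLaurent R)
    (hneg : ∀ x, IsNeg x → IsNilpotent (co f x)) (h0 : IsUnit (co f 0)) :
    ∃ (fm : DoubleLaurent R) (a : Rˣ) (fp : DoubleLaurent R), fm - 1 ∈ pSet R ∧ fp - 1 ∈ mSet R ∧
      f = fm * (constUnit a : DoubleLaurent R) * fp := by
  have key : ∀ k : ℕ, ∃ (fm : DoubleLaurent R) (a : Rˣ) (fp : DoubleLaurent R),
      fm - 1 ∈ pSet R ∧ fp - 1 ∈ mSet R ∧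
      f - fm * (constUnit a : DoubleLaurent R) * fp ∈ nilFil R (k + 1) := by
    intro k
    induction k with
    | zero =>
      obtain ⟨fm, fp, e, hp, hm, hm'⟩ := exists_neg_zero_pos f
      have hc : (constUnit h0.unit : DoubleLaurent R) = constHom R (co f 0) := rfl
      -- Modulo the nilradical `f` is its constant plus its positive part; what is left over is
      -- exactly the negative part, with nilpotent coefficients.
      refine ⟨1, h0.unit, 1 + (↑(constUnit h0.unit)⁻¹ : DoubleLaurent R) * fp, ?_, ?_, ?_⟩
      · simpa using zero_mem_pSet
      · rw [add_sub_cancel_left]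
        refine mem_mSet.2 fun x hx => mem_mSet.1 hp x fun h => hx ?_
        have : (↑(constUnit h0.unit)⁻¹ : DoubleLaurent R) = constHom R ↑(h0.unit⁻¹) := rfl
        rw [this, constHom_co, h, mul_zero]
      · have : f - 1 * (constUnit h0.unit : DoubleLaurent R) *
            (1 + (↑(constUnit h0.unit)⁻¹ : DoubleLaurent R) * fp) = fm := by
          rw [one_mul, mul_add, mul_one, Units.mul_inv_cancel_left, hc]
          linear_combination e
        rw [this, zero_add, mem_nilFil_one]
        intro x
        by_cases hx : co fm x = 0
        · rw [hx]; exact IsNilpotent.zero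
        · rw [hm' x hx]; exact hneg x (hm x hx)
    | succ k ih =>
      obtain ⟨fm, a, fp, h1, h2, h3⟩ := ih
      obtain ⟨gm, hgm, -⟩ := exists_inv_of_sub_one_mem_pSet hR h1
      obtain ⟨gp, hgp, -⟩ := exists_inv_of_sub_one_mem_mSet h2
      have ha : (constUnit a : DoubleLaurent R) * (↑(constUnit a)⁻¹ : DoubleLaurent R) = 1 :=
        (constUnit a).mul_inv
      set A : DoubleLaurent R := (constUnit a : DoubleLaurent R) with hA
      set A' : DoubleLaurent R := (↑(constUnit a)⁻¹ : DoubleLaurent R)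
      set z := (f - fm * A * fp) * (gm * A' * gp) with hz
      have hzk : z ∈ nilFil R (k + 1) := mul_mem_nilFil_right _ h3
      have hf : f = fm * A * fp * (1 + z) := by
        have : fm * A * fp * (gm * A' * gp) = 1 := by
          rw [show fm * A * fp * (gm * A' * gp) = (fm * gm) * (A * A') * (fp * gp) by ring, hgm, hgp,
            ha]; ring
        rw [hz, mul_add, mul_left_comm, this]; ring
      obtain ⟨zm, zp, e, hp, hm, hm'⟩ := exists_neg_zero_pos z
      have hzn : ∀ x, IsNilpotent (co z x) := mem_nilFil_one.1 (nilFil_le (by omega) hzk)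
      have hzm : zm ∈ nilFil R (k + 1) := fun x => by
        by_cases hx : co zm x = 0
        · rw [hx]; exact zero_mem _
        · rw [hm' x hx]; exact hzk x
      have hz0 : constHom R (co z 0) ∈ nilFil R (k + 1) :=
        mono_mem_coeffSub (w := fun _ => nilradical R ^ (k + 1)) (x := 0) (hzk 0)
      have hzp : zp ∈ nilFil R (k + 1) := by
        have : zp = z - zm - constHom R (co z 0) := by linear_combination -e
        rw [this]
        exact sub_mem (sub_mem hzk hzm) hz0
      have hu : IsUnit (1 + co z 0) := (hzn 0).isUnit_one_add
      refine ⟨fm * (1 + zm), a * hu.unit, fp * (1 + zp), ?_, ?_, ?_⟩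
      · refine mul_sub_one_mem_pSet hR h1 ?_
        rw [add_sub_cancel_left, mem_pSet hR]
        exact ⟨mem_nilFil_one.1 (nilFil_le (by omega) hzm), hm⟩
      · exact mul_sub_one_mem_mSet h2 (by rwa [add_sub_cancel_left])
      · have hc : (constUnit (a * hu.unit) : DoubleLaurent R) = A * (1 + constHom R (co z 0)) := by
          change constHom R (a * (1 + co z 0)) = constHom R a * _
          rw [map_mul, map_add, map_one]
        rw [hc]
        -- Since `z = zm + z₀ + zp`, expanding `(1 + zm)(1 + z₀)(1 + zp)` leaves only products of at
        -- least two of the parts, which lie in the power `2 (k + 1)`.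
        have : f - fm * (1 + zm) * (A * (1 + constHom R (co z 0))) * (fp * (1 + zp)) =
            -(fm * A * fp) * (zm * constHom R (co z 0) + (zm + constHom R (co z 0) +
              zm * constHom R (co z 0)) * zp) := by
          rw [hf]
          linear_combination (fm * A * fp) * e
        rw [this]
        refine nilFil_le (show k + 1 + 1 ≤ (k + 1) + (k + 1) by omega) ?_
        refine mul_mem_nilFil_left _ (add_mem (mul_mem_nilFil hzm hz0) (mul_mem_nilFil ?_ hzp))
        exact add_mem (add_mem hzm hz0) (mul_mem_nilFil_left _ hz0)
  obtain ⟨K, hK⟩ := hR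
  obtain ⟨fm, a, fp, h1, h2, h3⟩ := key K
  refine ⟨fm, a, fp, h1, h2, sub_eq_zero.1 (eq_zero_of_mem_nilFil hK (nilFil_le (by omega) h3))⟩

theorem exists_isSplitting (hR : IsNilpotent (nilradical R)) (f : (DoubleLaurent R)ˣ) :
    ∃ s, IsSplitting f s := by
  obtain ⟨n1, n2, hn⟩ := exists_nu f
  set g : (DoubleLaurent R)ˣ := uPow n2 * tPow n1 with hg
  have hv : ∀ p, IsLexVal ((f * g⁻¹ : (DoubleLaurent R)ˣ) : DoubleLaurent R) p 0 := fun p => by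
    obtain ⟨x, hx⟩ := exists_isLexVal (f * g⁻¹).mul_inv p
    have h1 : IsLexVal (g : DoubleLaurent R) p (n1 p, n2 p) := by
      have := (isLexVal_uPow n2 p).mul (isLexVal_tPow n1 p)
      simpa [hg] using this
    have h2 := hx.mul h1
    rw [← Units.val_mul, inv_mul_cancel_right] at h2
    have h3 : x = 0 := by simpa using h2.unique (hn p)
    rwa [h3] at hx
  -- After division by the monomial the leading exponent is `0` at every prime: negative
  -- coefficients lie in all primes and so are nilpotent, and the constant coefficient avoids all
  -- maximal ideals and so is a unit.
  obtain ⟨fm, a, fp, h1, h2, h3⟩ := exists_factorization hR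
    ((f * g⁻¹ : (DoubleLaurent R)ˣ) : DoubleLaurent R)
    (fun x hx => by
      rw [← mem_nilradical, nilradical_eq_sInf, Ideal.mem_sInf]
      intro I hI
      exact (hv ⟨I, hI⟩).1 x (by simpa using hx))
    (by
      by_contra hu
      obtain ⟨M, hM, hmem⟩ := exists_max_ideal_of_mem_nonunits hu
      exact (hv ⟨M, hM.isPrime⟩).2 hmem)
  refine ⟨⟨fm, a, n2, n1, fp⟩, h1, h2, ?_⟩
  have : (f : DoubleLaurent R) = ((f * g⁻¹ : (DoubleLaurent R)ˣ) : DoubleLaurent R) * g := by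
    rw [← Units.val_mul, inv_mul_cancel_right]
  rw [this, h3, mul_assoc (constUnit a), Units.val_mul (constUnit a)]
  ring

/-- Moving the negative factors to one side and the positive ones to the other gives an equality
between a series with exponents `≤ 0` and one with exponents `≥ 0`. Both are constant; the constant
coefficients give `a = b`, and then both quotients are `1`. -/
theorem factorization_unique (hR : IsNilpotent (nilradical R)) {fm fp gm gp : DoubleLaurent R}
    {a b : Rˣ} (h1 : fm - 1 ∈ pSet R) (h2 : fp - 1 ∈ mSet R) (h3 : gm - 1 ∈ pSet R)
    (h4 : gp - 1 ∈ mSet R)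
    (h : fm * (constUnit a : DoubleLaurent R) * fp = gm * (constUnit b : DoubleLaurent R) * gp) :
    fm = gm ∧ a = b ∧ fp = gp := by
  obtain ⟨gm', hgm, h5⟩ := exists_inv_of_sub_one_mem_pSet hR h3
  obtain ⟨fp', hfp, h6⟩ := exists_inv_of_sub_one_mem_mSet h2
  have e : fm * gm' * constHom R a = constHom R b * (gp * fp') := by
    have h' : fm * constHom R a * fp = gm * constHom R b * gp := h
    linear_combination gm' * fp' * h' - fm * gm' * constHom R a * hfp + constHom R b * gp * fp' * hgm
  have hl := mul_sub_one_mem_pSet hR h1 h5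
  have hr := mul_sub_one_mem_mSet h4 h6
  have hl0 : ∀ x, ¬ IsNeg x → co (fm * gm') x = co 1 x := fun x hx => by
    by_contra hc
    exact hx (hl.2 x.1 x.2 (sub_ne_zero.2 hc))
  have hr0 : ∀ x, ¬ IsPos x → co (gp * fp') x = co 1 x := fun x hx => by
    by_contra hc
    exact hx (mem_mSet.1 hr x (sub_ne_zero.2 hc))
  have e' : ∀ x, co (fm * gm') x * a = b * co (gp * fp') x := fun x => by
    rw [← constHom_co, ← e, mul_comm _ (constHom R a), constHom_co, mul_comm]
  have hab : a = b := by
    have := e' 0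
    rw [hl0 0 (by simp [IsNeg]), hr0 0 (by simp [IsPos]), co_one, if_pos rfl] at this
    exact Units.ext (by simpa using this)
  subst hab
  have e'' : ∀ x, co (fm * gm') x = co (gp * fp') x := fun x => by
    have := e' x
    rw [mul_comm] at this
    exact a.isUnit.mul_left_cancel this
  have hfm : fm * gm' = 1 := ext_co fun x => by
    by_cases hx : IsNeg x
    · rw [e'', hr0 x fun h => h.not_isNeg hx]
    · exact hl0 x hx
  have hgp : gp * fp' = 1 := ext_co fun x => by rw [← e'', hfm]
  refine ⟨?_, rfl, ?_⟩
  · linear_combination gm * hfm - fm * hgm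
  · linear_combination gp * hfp - fp * hgp

/-- The splitting displays the leading exponent at every prime, so `ν₁` and `ν₂` are determined; the
monomial cancels and the rest is `factorization_unique`. -/
theorem IsSplitting.unique (hR : IsNilpotent (nilradical R)) {f : (DoubleLaurent R)ˣ}
    {s s' : Splitting R} (h : IsSplitting f s) (h' : IsSplitting f s') : s = s' := by
  have hv : ∀ p, (s.n1 p, s.n2 p) = (s'.n1 p, s'.n2 p) := fun p =>
    (h.isLexVal hR p).unique (h'.isLexVal hR p)
  have hn1 : s.n1 = s'.n1 := LocallyConstant.ext fun p => congrArg Prod.fst (hv p)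
  have hn2 : s.n2 = s'.n2 := LocallyConstant.ext fun p => congrArg Prod.snd (hv p)
  have e := h.eq.symm.trans h'.eq
  rw [← hn1, ← hn2] at e
  have e2 : s.neg * (constUnit s.unit : DoubleLaurent R) * s.pos =
      s'.neg * (constUnit s'.unit : DoubleLaurent R) * s'.pos := by
    have hu := (uPow s.n2 * tPow s.n1).isUnit
    refine hu.mul_left_cancel ?_
    simp only [Units.val_mul] at e ⊢
    linear_combination e
  obtain ⟨h1, h2, h3⟩ := factorization_unique hR h.neg_mem h.pos_mem h'.neg_mem h'.pos_mem e2
  cases s; cases s'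
  simp_all

theorem existsUnique_isSplitting (hR : IsNilpotent (nilradical R)) (f : (DoubleLaurent R)ˣ) :
    ∃! s, IsSplitting f s := by
  obtain ⟨s, hs⟩ := exists_isSplitting hR f
  exact ⟨s, hs, fun s' hs' => hs'.unique hR hs⟩

theorem isSplitting_splitting (hR : IsNilpotent (nilradical R)) (f : (DoubleLaurent R)ˣ) :
    IsSplitting f (splitting f) := Classical.epsilon_spec (exists_isSplitting hR f)

theorem IsSplitting.splitting_eq (hR : IsNilpotent (nilradical R)) {f : (DoubleLaurent R)ˣ}
    {s : Splitting R} (h : IsSplitting f s) : splitting f = s :=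
  (isSplitting_splitting hR f).unique hR h

end

/-! ### Multiplicative filtrations and product decompositions over positive exponents -/

section

variable {R : Type u} [CommRing R]

/-! ### Multiplicative filtrations -/

/-- A decreasing multiplicative filtration by additive subgroups. -/
structure IsMulFiltration {A : Type*} [CommRing A] (Fil : ℕ → AddSubgroup A) : Prop where
  one_mem : 1 ∈ Fil 0
  mul_mem : ∀ {k l : ℕ} {f g : A}, f ∈ Fil k → g ∈ Fil l → f * g ∈ Fil (k + l)
  antitone : Antitone Fil

namespace IsMulFiltration

variable {A : Type*} [CommRing A] {Fil : ℕ → AddSubgroup A} (h : IsMulFiltration Fil)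
include h

theorem mem_zero {n : ℕ} {f : A} (hf : f ∈ Fil n) : f ∈ Fil 0 := h.antitone (Nat.zero_le n) hf

theorem mul_mem_left {n : ℕ} {f g : A} (hf : f ∈ Fil 0) (hg : g ∈ Fil n) : f * g ∈ Fil n := by
  simpa using h.mul_mem hf hg

theorem mul_mem_right {n : ℕ} {f g : A} (hf : f ∈ Fil n) (hg : g ∈ Fil 0) : f * g ∈ Fil n := by
  simpa using h.mul_mem hf hg

theorem prod_mem {ι : Type*} (s : Finset ι) (f : ι → A) (hf : ∀ x ∈ s, f x ∈ Fil 0) :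
    ∏ x ∈ s, f x ∈ Fil 0 := by
  classical
  induction s using Finset.induction_on with
  | empty => simpa using h.one_mem
  | insert x s hx ih =>
    rw [Finset.prod_insert hx]
    exact h.mul_mem_left (hf x (Finset.mem_insert_self _ _))
      (ih fun y hy => hf y (Finset.mem_insert_of_mem hy))

theorem prod_one_sub_mem {ι : Type*} (s : Finset ι) (f : ι → A) (hf : ∀ x ∈ s, f x ∈ Fil 0) :
    ∏ x ∈ s, (1 - f x) ∈ Fil 0 :=
  h.prod_mem s _ fun x hx => sub_mem h.one_mem (hf x hx)

theorem prod_sub_prod_mem {ι : Type*} (s : Finset ι) (f g : ι → A) {n : ℕ}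
    (hf : ∀ x ∈ s, f x ∈ Fil 0) (hfg : ∀ x ∈ s, f x - g x ∈ Fil n) :
    ∏ x ∈ s, (1 - f x) - ∏ x ∈ s, (1 - g x) ∈ Fil n := by
  classical
  induction s using Finset.induction_on with
  | empty => simp [zero_mem]
  | insert x s hx ih =>
    have hg : ∀ y ∈ insert x s, g y ∈ Fil 0 := fun y hy => by
      simpa using sub_mem (hf y hy) (h.mem_zero (hfg y hy))
    have ih' := ih (fun y hy => hf y (Finset.mem_insert_of_mem hy))
      fun y hy => hfg y (Finset.mem_insert_of_mem hy)
    have hB := h.prod_one_sub_mem s g fun y hy => hg y (Finset.mem_insert_of_mem hy)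
    have hx0 := sub_mem h.one_mem (hf x (Finset.mem_insert_self _ _))
    rw [Finset.prod_insert hx, Finset.prod_insert hx]
    have e : (1 - f x) * ∏ y ∈ s, (1 - f y) - (1 - g x) * ∏ y ∈ s, (1 - g y) =
        (1 - f x) * (∏ y ∈ s, (1 - f y) - ∏ y ∈ s, (1 - g y)) -
          (f x - g x) * ∏ y ∈ s, (1 - g y) := by ring
    rw [e]
    exact sub_mem (h.mul_mem_left hx0 ih')
      (h.mul_mem_right (hfg x (Finset.mem_insert_self _ _)) hB)

theorem prod_sub_one_mem {ι : Type*} (s : Finset ι) (f : ι → A) {n : ℕ}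
    (hf : ∀ x ∈ s, f x ∈ Fil n) : ∏ x ∈ s, (1 - f x) - 1 ∈ Fil n := by
  have := h.prod_sub_prod_mem s f (fun _ => 0) (fun x hx => h.mem_zero (hf x hx))
    (fun x hx => by simpa using hf x hx)
  simpa using this

/-- Changing the factors by terms of order `n` changes the product by minus the sum of the changes,
up to order `n + 1`: every further term contains a change and another factor of order `1`. This
governs existence and uniqueness of the product decompositions. -/
theorem prod_sub_prod_add_sum_mem {ι : Type*} (s : Finset ι) (f g : ι → A) {n : ℕ}
    (hf : ∀ x ∈ s, f x ∈ Fil 1) (hg : ∀ x ∈ s, g x ∈ Fil 1) (hfg : ∀ x ∈ s, f x - g x ∈ Fil n) :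
    ∏ x ∈ s, (1 - f x) - ∏ x ∈ s, (1 - g x) + ∑ x ∈ s, (f x - g x) ∈ Fil (n + 1) := by
  classical
  induction s using Finset.induction_on with
  | empty => simp [zero_mem]
  | insert x s hx ih =>
    have hf' := fun y hy => hf y (Finset.mem_insert_of_mem (a := y) (b := x) (s := s) hy)
    have hg' := fun y hy => hg y (Finset.mem_insert_of_mem (a := y) (b := x) (s := s) hy)
    have hfg' := fun y hy => hfg y (Finset.mem_insert_of_mem (a := y) (b := x) (s := s) hy)
    have h1 := ih hf' hg' hfg'
    have h2 := h.prod_sub_prod_mem s f g (fun y hy => h.mem_zero (hf' y hy)) hfg'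
    have h3 := h.prod_sub_one_mem s g hg'
    rw [Finset.prod_insert hx, Finset.prod_insert hx, Finset.sum_insert hx]
    have e : (1 - f x) * ∏ y ∈ s, (1 - f y) - (1 - g x) * ∏ y ∈ s, (1 - g y) +
        (f x - g x + ∑ y ∈ s, (f y - g y)) =
        (∏ y ∈ s, (1 - f y) - ∏ y ∈ s, (1 - g y) + ∑ y ∈ s, (f y - g y)) -
        (∏ y ∈ s, (1 - f y) - ∏ y ∈ s, (1 - g y)) * f x -
        (f x - g x) * (∏ y ∈ s, (1 - g y) - 1) := by ring
    rw [e]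
    exact sub_mem (sub_mem h1 (h.mul_mem h2 (hf x (Finset.mem_insert_self _ _))))
      (h.mul_mem (hfg x (Finset.mem_insert_self _ _)) h3)

/-- If the product over `s₀` approximates `F` and the other factors are close to `1`, then every
larger product approximates `F`. -/
theorem prod_sub_mem_of_subset {ι : Type*} {s₀ s : Finset ι} (hs : s₀ ⊆ s) (f : ι → A)
    {F : A} {n : ℕ} (hf : ∀ x ∈ s₀, f x ∈ Fil 0) (hf' : ∀ x ∈ s, x ∉ s₀ → f x ∈ Fil n)
    (hF : ∏ x ∈ s₀, (1 - f x) - F ∈ Fil n) : ∏ x ∈ s, (1 - f x) - F ∈ Fil n := by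
  classical
  rw [← Finset.prod_sdiff hs]
  have h1 := h.prod_sub_one_mem (s \ s₀) f (n := n) fun x hx =>
    hf' x (Finset.mem_sdiff.1 hx).1 (Finset.mem_sdiff.1 hx).2
  have h2 := h.prod_one_sub_mem s₀ f hf
  have e : (∏ x ∈ s \ s₀, (1 - f x)) * ∏ x ∈ s₀, (1 - f x) - F =
      (∏ x ∈ s \ s₀, (1 - f x) - 1) * ∏ x ∈ s₀, (1 - f x) + (∏ x ∈ s₀, (1 - f x) - F) := by ring
  rw [e]
  exact add_mem (h.mul_mem_right h1 h2) hF

end IsMulFiltration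

theorem isMulFiltration_nilFil : IsMulFiltration (nilFil R) where
  one_mem := mem_nilFil_zero _
  mul_mem := mul_mem_nilFil
  antitone _ _ := nilFil_le

theorem isMulFiltration_posFil (I W : ℤ) : IsMulFiltration (posFil R I W) where
  one_mem := one_mem_posFil I W
  mul_mem := mul_mem_posFil
  antitone := posFil_antitone I W

/-! ### Product decompositions over positive exponents -/

/-- The exponents `(i, j) > (0, 0)`. -/
abbrev PosIdx : Type := {x : Idx // IsPos x.1}

/-- The exponents `(i, j) < (0, 0)`. -/
abbrev NegIdx : Type := {x : Idx // IsNeg x.1}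

theorem sum_co_mono {ι : Type} (e : ι → ℤ × ℤ) (he : Function.Injective e) (s : Finset ι)
    (b : ι → R) {x : ι} (hx : x ∈ s) : ∑ y ∈ s, co (mono (e y) (b y)) (e x) = b x := by
  rw [Finset.sum_eq_single x]
  · rw [co_mono, if_pos rfl]
  · intro y _ hy
    rw [co_mono, if_neg fun h => hy (he h).symm]
  · exact fun h => absurd hx h

theorem posIdx_injective : Function.Injective fun x : PosIdx => x.1.1 :=
  fun _ _ h => Subtype.ext (Subtype.ext h)

theorem negIdx_injective : Function.Injective fun x : NegIdx => x.1.1 :=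
  fun _ _ h => Subtype.ext (Subtype.ext h)

/-- The product over positive exponents converges to `F` for the filtration `posFil R I W`. -/
structure PosConv (I W : ℤ) (a : PosIdx → R) (F : DoubleLaurent R) : Prop where
  weight : ∀ x : PosIdx, x.1.1.1 ≤ I → a x ≠ 0 → 1 ≤ x.1.1.2 + W * x.1.1.1
  conv : ∀ n : ℕ, ∃ s₀ : Finset PosIdx, ∀ s, s₀ ⊆ s →
    ∏ x ∈ s, (1 - mono x.1.1 (a x)) - F ∈ posFil R I W n

theorem IsPos.fst_nonneg {x : ℤ × ℤ} (h : IsPos x) : 0 ≤ x.1 := by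
  unfold IsPos at h; omega

theorem posFil_mono {I I' W W' : ℤ} (hI : I' ≤ I) (hW : W ≤ W') (n : ℕ) :
    posFil R I W n ≤ posFil R I' W' n := by
  intro f hf
  rw [mem_posFil] at *
  intro x hx
  obtain ⟨h1, h2⟩ := hf x hx
  refine ⟨h1, fun h => ?_⟩
  have := h2 (h.trans hI)
  nlinarith

theorem PosConv.of_le {I I' W W' : ℤ} (hI : I' ≤ I) (hW : W ≤ W') {a : PosIdx → R}
    {F : DoubleLaurent R} (h : PosConv I W a F) : PosConv I' W' a F where
  weight x hx hax := by
    have h1 := h.weight x (hx.trans hI) hax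
    have h2 := x.2.fst_nonneg
    nlinarith
  conv n := by
    obtain ⟨s₀, hs⟩ := h.conv n
    exact ⟨s₀, fun s hs' => posFil_mono hI hW n (hs s hs')⟩

theorem PosConv.mono_mem {I W : ℤ} {a : PosIdx → R} {F : DoubleLaurent R} (h : PosConv I W a F)
    (x : PosIdx) : mono x.1.1 (a x) ∈ posFil R I W 1 :=
  mono_mem_posFil fun ha => ⟨x.2.fst_nonneg, fun hI => by exact_mod_cast h.weight x hI ha⟩

theorem PosConv.congr {I W : ℤ} {a b : PosIdx → R} {F : DoubleLaurent R} (h : PosConv I W a F)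
    (hab : ∀ x : PosIdx, x.1.1.1 ≤ I → b x = a x) : PosConv I W b F where
  weight x hx hb := h.weight x hx (hab x hx ▸ hb)
  conv n := by
    obtain ⟨s₀, hs⟩ := h.conv n
    refine ⟨s₀, fun s hs' => ?_⟩
    have h1 := (isMulFiltration_posFil (R := R) I W).prod_sub_prod_mem s
      (fun x => mono x.1.1 (a x)) (fun x => mono x.1.1 (b x)) (n := n)
      (fun x _ => (isMulFiltration_posFil I W).mem_zero (h.mono_mem x)) (fun x _ => by
        by_cases hx : x.1.1.1 ≤ I
        · rw [hab x hx, sub_self]; exact zero_mem _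
        · exact sub_mem (mono_mem_posFil fun _ => ⟨x.2.fst_nonneg, fun h => absurd h hx⟩)
            (mono_mem_posFil fun _ => ⟨x.2.fst_nonneg, fun h => absurd h hx⟩))
    simpa using sub_mem (hs s hs') h1

/-- Induction on the weight. If the families agree in weights below `n`, the two products differ
modulo weight `n + 1` by the sum of the differing monomials; both approximate `F`, so the
coefficients in weight `n` agree as well. -/
theorem PosConv.unique {I W : ℤ} {a b : PosIdx → R} {F : DoubleLaurent R} (ha : PosConv I W a F)
    (hb : PosConv I W b F) (x : PosIdx) (hx : x.1.1.1 ≤ I) : a x = b x := by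
  classical
  have key : ∀ n : ℕ, ∀ x : PosIdx, x.1.1.1 ≤ I → x.1.1.2 + W * x.1.1.1 < n → a x = b x := by
    intro n
    induction n with
    | zero =>
      intro x hx hn
      have h1 : a x = 0 := by
        by_contra h
        have := ha.weight x hx h
        push_cast at hn
        omega
      have h2 : b x = 0 := by
        by_contra h
        have := hb.weight x hx h
        push_cast at hn
        omega
      rw [h1, h2]
    | succ n ih =>
      intro x hx hn
      obtain ⟨s₀, hs⟩ := ha.conv (n + 1)
      obtain ⟨s₁, hs'⟩ := hb.conv (n + 1)
      set s := insert x (s₀ ∪ s₁) with hsdef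
      have h1 := hs s (by grind)
      have h2 := hs' s (by grind)
      have h3 := (isMulFiltration_posFil (R := R) I W).prod_sub_prod_add_sum_mem s
        (fun x => mono x.1.1 (a x)) (fun x => mono x.1.1 (b x)) (n := n)
        (fun x _ => ha.mono_mem x) (fun x _ => hb.mono_mem x) (fun y _ => by
          by_cases hy : y.1.1.1 ≤ I ∧ y.1.1.2 + W * y.1.1.1 < n
          · rw [ih y hy.1 hy.2, sub_self]; exact zero_mem _
          · have h4 : y.1.1.1 ≤ I → (n : ℤ) ≤ y.1.1.2 + W * y.1.1.1 := fun h => by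
              by_contra hc; exact hy ⟨h, by omega⟩
            exact sub_mem (mono_mem_posFil fun _ => ⟨y.2.fst_nonneg, h4⟩)
              (mono_mem_posFil fun _ => ⟨y.2.fst_nonneg, h4⟩))
      have h5 := sub_mem h3 (sub_mem h1 h2)
      rw [sub_sub_sub_cancel_right, add_sub_cancel_left] at h5
      have h6 : co (∑ y ∈ s, (mono y.1.1 (a y) - mono y.1.1 (b y))) x.1.1
          = a x - b x := by
        rw [Finset.sum_sub_distrib, co_sub, co_sum, co_sum,
          sum_co_mono (fun x : PosIdx => x.1.1) posIdx_injective s a (Finset.mem_insert_self _ _),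
          sum_co_mono (fun x : PosIdx => x.1.1) posIdx_injective s b (Finset.mem_insert_self _ _)]
      by_contra hne
      have h7 := (mem_posFil.1 h5 x.1.1 (by rw [h6]; exact sub_ne_zero.2 hne)).2 hx
      omega
  exact key (x.1.1.2 + W * x.1.1.1 + 1).toNat x hx (by omega)

theorem finite_posIdx_weight (I W n : ℤ) :
    {x : PosIdx | x.1.1.1 ≤ I ∧ 1 ≤ x.1.1.2 + W * x.1.1.1 ∧ x.1.1.2 + W * x.1.1.1 < n}.Finite := by
  have : {y : ℤ × ℤ | 0 ≤ y.1 ∧ y.1 ≤ I ∧ 1 ≤ y.2 + W * y.1 ∧ y.2 + W * y.1 < n}.Finite := by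
    refine ((Set.finite_Icc (0 : ℤ) I).biUnion fun i _ =>
      (Set.finite_Icc (1 - W * i) (n - W * i)).image fun j => (i, j)).subset ?_
    rintro ⟨i, j⟩ ⟨h1, h2, h3, h4⟩
    simp only [Set.mem_iUnion, Set.mem_image, Set.mem_Icc]
    simp only at h1 h2 h3 h4
    exact ⟨i, ⟨h1, h2⟩, j, ⟨by linarith, by linarith⟩, rfl⟩
  refine (this.preimage (posIdx_injective.injOn)).subset fun x hx => ?_
  exact ⟨x.2.fst_nonneg, hx⟩

/-- The exponents with `i ≤ I` and weight in `[1, n)`. -/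
def posBox (I W n : ℤ) : Finset PosIdx := (finite_posIdx_weight I W n).toFinset

theorem mem_posBox {I W n : ℤ} {x : PosIdx} : x ∈ posBox I W n ↔
    x.1.1.1 ≤ I ∧ 1 ≤ x.1.1.2 + W * x.1.1.1 ∧ x.1.1.2 + W * x.1.1.1 < n := by
  simp [posBox]

/-- The exponents with `i ≤ I` and weight `n ≥ 1`. -/
def posLayer (I W n : ℤ) : Finset PosIdx :=
  open Classical in posBox I W (n + 1) \ posBox I W n

theorem mem_posLayer {I W n : ℤ} {x : PosIdx} : x ∈ posLayer I W n ↔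
    x.1.1.1 ≤ I ∧ 1 ≤ x.1.1.2 + W * x.1.1.1 ∧ x.1.1.2 + W * x.1.1.1 = n := by
  simp only [posLayer, Finset.mem_sdiff, mem_posBox]; omega

/-- Successive approximations of `F` by finite products. -/
def posApprox (I W : ℤ) (F : DoubleLaurent R) : ℕ → DoubleLaurent R
  | 0 => 1
  | k + 1 => posApprox I W F k * ∏ x ∈ posLayer I W (k + 1),
      (1 - mono x.1.1 (-co (F - posApprox I W F k) x.1.1))

/-- The factors of step `k` are chosen so that, to first order, they remove the coefficients of `F -
posApprox I W F k` in weight `k + 1` and rows at most `I`. -/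
theorem posApprox_mem {I W : ℤ} {F : DoubleLaurent R} (hF : F - 1 ∈ posFil R I W 1)
    (hF' : F - 1 ∈ mSet R) (k : ℕ) :
    F - posApprox I W F k ∈ posFil R I W (k + 1) ∧ posApprox I W F k - 1 ∈ posFil R I W 1 ∧
      posApprox I W F k - 1 ∈ mSet R := by
  have hfil := isMulFiltration_posFil (R := R) I W
  induction k with
  | zero => exact ⟨hF, by simp [posApprox, zero_mem], by simpa [posApprox] using zero_mem_mSet⟩
  | succ k ih =>
    obtain ⟨ih1, ih2, ih3⟩ := ih
    set Q := posApprox I W F k with hQ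
    set α : PosIdx → DoubleLaurent R := fun x => mono x.1.1 (-co (F - Q) x.1.1) with hα
    set S := posLayer I W (k + 1) with hS
    have hα1 : ∀ x ∈ S, α x ∈ posFil R I W (k + 1) := fun x hx => by
      have := mem_posLayer.1 hx
      exact mono_mem_posFil fun _ => ⟨x.2.fst_nonneg, fun _ => by push_cast; omega⟩
    have hα2 : ∀ x ∈ S, α x ∈ posFil R I W 1 := fun x hx => hfil.antitone (by omega) (hα1 x hx)
    have h1 := hfil.prod_sub_prod_add_sum_mem S α (fun _ => 0) (n := k + 1) hα2
      (fun _ _ => zero_mem _) (fun x hx => by simpa using hα1 x hx)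
    simp only [sub_zero, Finset.prod_const_one] at h1
    have hsum : ∑ x ∈ S, α x ∈ posFil R I W (k + 1) := sum_mem hα1
    have hs : posApprox I W F (k + 1) = Q * ∏ x ∈ S, (1 - α x) := rfl
    refine ⟨?_, ?_, ?_⟩
    -- In the first bracket the layer of weight `k + 1` cancels; the other two terms have order at
    -- least `k + 2` because `Q - 1` and the monomials have positive weight.
    · have e : F - posApprox I W F (k + 1) = (F - Q + ∑ x ∈ S, α x) + (Q - 1) * ∑ x ∈ S, α x
          - Q * (∏ x ∈ S, (1 - α x) - 1 + ∑ x ∈ S, α x) := by rw [hs]; ring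
      rw [e]
      have hQ0 : Q ∈ posFil R I W 0 := by
        simpa using add_mem (hfil.mem_zero ih2) hfil.one_mem
      refine sub_mem (add_mem ?_ ?_) (hfil.mul_mem_left hQ0 h1)
      · rw [mem_posFil]
        intro x hx
        have hx1 := mem_posFil.1 (add_mem ih1 hsum) x hx
        refine ⟨hx1.1, fun hI => ?_⟩
        by_contra hlt
        have hw : x.2 + W * x.1 = k + 1 := by
          have := hx1.2 hI
          push_cast at this hlt
          omega
        have hcl : ∀ y : ℤ × ℤ, co (F - Q) y ≠ 0 → IsPos y := fun y hy => by
          have : F - Q = (F - 1) + -(Q - 1) := by ring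
          rw [this] at hy
          exact mem_mSet.1 (add_mem_mSet hF' (neg_mem_mSet ih3)) y hy
        by_cases hp : IsPos x
        · set z : PosIdx := ⟨⟨x, hp.ne_zero⟩, hp⟩ with hz
          have hzS : z ∈ S := by
            rw [hS, mem_posLayer]
            refine ⟨hI, ?_, hw⟩
            change 1 ≤ x.2 + W * x.1
            omega
          apply hx
          rw [co_add, co_sum]
          have := sum_co_mono (fun x : PosIdx => x.1.1) posIdx_injective S
            (fun x => -co (F - Q) x.1.1) hzS
          rw [show ∑ i ∈ S, co (α i) x = -co (F - Q) x from this]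
          ring
        · apply hx
          have h0 : co (F - Q) x = 0 := by by_contra h; exact hp (hcl x h)
          rw [co_add, co_sum, h0, zero_add]
          refine Finset.sum_eq_zero fun y _ => ?_
          rw [hα, co_mono, if_neg]
          rintro rfl
          exact hp y.2
      · exact hfil.antitone (by omega) (hfil.mul_mem ih2 hsum)
    · have h2 := hfil.prod_sub_one_mem S α hα2
      have e : posApprox I W F (k + 1) - 1 = (Q - 1) * ∏ x ∈ S, (1 - α x) +
          (∏ x ∈ S, (1 - α x) - 1) := by rw [hs]; ring
      rw [e]
      exact add_mem (hfil.mul_mem_right ih2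
        (hfil.prod_one_sub_mem S α fun x hx => hfil.mem_zero (hα2 x hx))) h2
    · rw [hs]
      refine mul_sub_one_mem_mSet ih3 ?_
      have : ∀ T : Finset PosIdx, ∏ x ∈ T, (1 - α x) - 1 ∈ mSet R := fun T => by
        classical
        induction T using Finset.induction_on with
        | empty => simpa using zero_mem_mSet
        | insert x T hx ih =>
          rw [Finset.prod_insert hx]
          refine mul_sub_one_mem_mSet (mem_mSet.2 fun y hy => ?_) ih
          rw [sub_sub_cancel_left, co_neg, co_mono, neg_ne_zero] at hy
          by_cases hxy : y = x.1.1
          · rw [hxy]; exact x.2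
          · exact absurd (if_neg hxy) hy
      exact this S

theorem exists_posConv_level {I W : ℤ} {F : DoubleLaurent R} (hF : F - 1 ∈ posFil R I W 1)
    (hF' : F - 1 ∈ mSet R) : ∃ a : PosIdx → R, PosConv I W a F := by
  classical
  have hfil := isMulFiltration_posFil (R := R) I W
  -- An exponent of weight `k + 1` takes the coefficient used in step `k`, hence the subtraction of
  -- `1`; for weight at most `0` the coefficient must vanish.
  set a : PosIdx → R := fun x => if 1 ≤ x.1.1.2 + W * x.1.1.1 then
    -co (F - posApprox I W F (x.1.1.2 + W * x.1.1.1 - 1).toNat) x.1.1 else 0 with ha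
  have hprod : ∀ k : ℕ, ∏ x ∈ posBox I W (k + 1), (1 - mono x.1.1 (a x)) = posApprox I W F k := by
    intro k
    induction k with
    | zero =>
      have : posBox I W ((0 : ℕ) + 1) = ∅ := by
        ext x; simp only [mem_posBox]; push_cast; constructor
        · intro h; omega
        · simp
      rw [this]; rfl
    | succ k ih =>
      have hsub : posBox I W (k + 1) ⊆ posBox I W ((k + 1 : ℕ) + 1) := fun x hx => by
        rw [mem_posBox] at *; push_cast; omega
      rw [← Finset.prod_sdiff hsub, ih, mul_comm]
      change _ = posApprox I W F k * ∏ x ∈ posLayer I W (k + 1), _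
      congr 1
      have hl : posLayer I W (k + 1) = posBox I W ((k + 1 : ℕ) + 1) \ posBox I W (k + 1) := by
        rw [posLayer]; push_cast; rfl
      rw [← hl]
      refine Finset.prod_congr rfl fun x hx => ?_
      have hx := mem_posLayer.1 hx
      have : (x.1.1.2 + W * x.1.1.1 - 1).toNat = k := by omega
      rw [ha]
      simp only [if_pos hx.2.1, this]
  have hw : ∀ x : PosIdx, x.1.1.1 ≤ I → a x ≠ 0 → 1 ≤ x.1.1.2 + W * x.1.1.1 := fun x _ hx => by
    by_contra h; exact hx (if_neg h)
  refine ⟨a, hw, fun n => ⟨posBox I W (n + 1), fun s hs => ?_⟩⟩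
  refine hfil.prod_sub_mem_of_subset hs _ (fun x _ => mono_mem_posFil fun h =>
      ⟨x.2.fst_nonneg, fun hI => ?_⟩) (fun x _ hx => mono_mem_posFil fun h =>
      ⟨x.2.fst_nonneg, fun hI => ?_⟩) ?_
  · have := hw x hI h; push_cast; omega
  · have := hw x hI h
    rw [mem_posBox] at hx
    omega
  · rw [hprod, ← neg_sub]
    exact neg_mem (hfil.antitone (by omega) (posApprox_mem hF hF' n).1)

theorem exists_posConv {W : ℤ → ℤ} {F : DoubleLaurent R} (hF : ∀ I, F - 1 ∈ posFil R I (W I) 1)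
    (hF' : F - 1 ∈ mSet R) : ∃ a : PosIdx → R, ∀ I, PosConv I (W I) a F := by
  choose a ha using fun I => exists_posConv_level (hF I) hF'
  -- Each exponent takes its coefficient from the level of its own row. By uniqueness, for the
  -- larger of the two slopes, this agrees with every higher level.
  refine ⟨fun x => a x.1.1.1 x, fun I => (ha I).congr fun x hx => ?_⟩
  exact ((ha x.1.1.1).of_le le_rfl (le_max_left _ (W I))).unique
    ((ha I).of_le hx (le_max_right (W x.1.1.1) (W I))) x le_rfl

theorem prodConverges_of_posConv {W : ℤ → ℤ} {a : PosIdx → R} {F : DoubleLaurent R}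
    (h : ∀ I, PosConv I (W I) a F) : ProdConverges (fun x : PosIdx => 1 - mono x.1.1 (a x)) F := by
  intro N c
  -- The sum over the finitely many relevant rows dominates the weight needed in each of them.
  obtain ⟨s₀, hs⟩ := (h N).conv (∑ i ∈ Finset.Icc 0 N, (c i + W N * i).toNat)
  refine ⟨s₀, fun s hs' => mem_basicNhd.2 fun x hx hx' => ?_⟩
  by_contra hne
  obtain ⟨h1, h2⟩ := mem_posFil.1 (hs s hs') x hne
  have h3 := h2 hx.le
  have h4 : (c x.1 + W N * x.1).toNat ≤ ∑ i ∈ Finset.Icc 0 N, (c i + W N * i).toNat :=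
    Finset.single_le_sum (f := fun i => (c i + W N * i).toNat) (fun _ _ => Nat.zero_le _)
    (Finset.mem_Icc.2 ⟨h1, hx.le⟩)
  omega

theorem prod_pos_sub_one_mem_mSet (a : PosIdx → R) (s : Finset PosIdx) :
    ∏ x ∈ s, (1 - mono x.1.1 (a x)) - 1 ∈ mSet R := by
  classical
  induction s using Finset.induction_on with
  | empty => simpa using zero_mem_mSet
  | insert x T hx ih =>
    rw [Finset.prod_insert hx]
    refine mul_sub_one_mem_mSet (mem_mSet.2 fun y hy => ?_) ih
    rw [sub_sub_cancel_left, co_neg, co_mono, neg_ne_zero] at hy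
    by_cases hxy : y = x.1.1
    · rw [hxy]; exact x.2
    · exact absurd (if_neg hxy) hy

/-- Convergence in the natural topology forces each row of `a` to be bounded below: adding the
factor at `x` to a good finite product changes its coefficient at `x` by `-a x`, since finite
products have constant coefficient `1`. For `x` outside a finite set and `x.2 < 0` this change must
be `0`. A slope adapted to these bounds and to `F` then gives convergence by weight. -/
theorem exists_posConv_of_prodConverges {a : PosIdx → R} {F : DoubleLaurent R}
    (hF : F - 1 ∈ mSet R) (h : ProdConverges (fun x : PosIdx => 1 - mono x.1.1 (a x)) F) :
    ∃ W : ℤ → ℤ, ∀ I, 0 ≤ W I ∧ F - 1 ∈ posFil R I (W I) 1 ∧ PosConv I (W I) a F := by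
  classical
  have hb : ∀ i : ℤ, ∃ b : ℤ, ∀ x : PosIdx, x.1.1.1 = i → a x ≠ 0 → b ≤ x.1.1.2 := by
    intro i
    obtain ⟨s₀, hs⟩ := h (i + 1) fun _ => 0
    refine ⟨-∑ x ∈ s₀, |x.1.1.2|, fun x hx hax => ?_⟩
    have hnn : 0 ≤ ∑ x ∈ s₀, |x.1.1.2| := Finset.sum_nonneg fun _ _ => abs_nonneg _
    by_cases hxs : x ∈ s₀
    · have : |x.1.1.2| ≤ ∑ x ∈ s₀, |x.1.1.2| :=
        Finset.single_le_sum (f := fun x : PosIdx => |x.1.1.2|) (fun _ _ => abs_nonneg _) hxs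
      have h2 := neg_abs_le x.1.1.2
      omega
    · by_contra hlt
      have h1 := mem_basicNhd.1 (hs s₀ subset_rfl) x.1.1 (by omega) (by omega)
      have h2 := mem_basicNhd.1 (hs (insert x s₀) (Finset.subset_insert _ _)) x.1.1 (by omega)
        (by omega)
      rw [Finset.prod_insert hxs] at h2
      have h3 := congrArg₂ (· - ·) h1 h2
      simp only [← co_sub] at h3
      rw [show ∀ P m F : DoubleLaurent R, P - F - ((1 - m) * P - F) = m * P from
        fun P m F => by ring, co_mono_mul, sub_self, sub_zero] at h3
      have h4 : co (∏ x ∈ s₀, (1 - mono x.1.1 (a x))) 0 = 1 := by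
        have : co (∏ x ∈ s₀, (1 - mono x.1.1 (a x)) - 1) 0 = 0 := by
          by_contra hc
          exact (mem_mSet.1 (prod_pos_sub_one_mem_mSet a s₀) 0 hc).ne_zero rfl
        rwa [co_sub, co_one, if_pos rfl, sub_eq_zero] at this
      rw [h4, mul_one] at h3
      exact hax h3
  choose b hb using hb
  obtain ⟨n, β, hβ⟩ := co_bdd (F - 1)
  obtain ⟨W, hW⟩ := exists_weight fun i => min (b i) (β i)
  have hF1 : ∀ I, F - 1 ∈ posFil R I (W I) 1 := fun I => mem_posFil.2 fun x hx =>
    ⟨(mem_mSet.1 hF x hx).fst_nonneg, fun hI => by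
      exact_mod_cast (hW I).2 x (mem_mSet.1 hF x hx) hI ((min_le_right _ _).trans (hβ x hx).2)⟩
  have hw : ∀ I, ∀ x : PosIdx, x.1.1.1 ≤ I → a x ≠ 0 → 1 ≤ x.1.1.2 + W I * x.1.1.1 :=
    fun I x hx hax => (hW I).2 _ x.2 hx ((min_le_left _ _).trans (hb _ x rfl hax))
  refine ⟨W, fun I => ⟨(hW I).1, hF1 I, hw I, fun n => ?_⟩⟩
  have hfil := isMulFiltration_posFil (R := R) I (W I)
  -- This neighbourhood demands vanishing at exactly the exponents with row at most `I` and weight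
  -- below `n`.
  obtain ⟨s₀, hs⟩ := h (I + 1) fun i => n - W I * i
  refine ⟨s₀, fun s hs' => mem_posFil.2 fun x hx => ⟨?_, fun hI => ?_⟩⟩
  · have h1 : ∏ x ∈ s, (1 - mono x.1.1 (a x)) - F ∈ posFil R I (W I) 0 := by
      have h2 := hfil.prod_one_sub_mem s (fun x => mono x.1.1 (a x)) fun x _ =>
        hfil.mem_zero (n := 1) (mono_mem_posFil fun h => ⟨x.2.fst_nonneg, fun hI => by
          exact_mod_cast hw I x hI h⟩)
      have h3 := add_mem (hfil.mem_zero (hF1 I)) hfil.one_mem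
      rw [sub_add_cancel] at h3
      exact sub_mem h2 h3
    exact (mem_posFil.1 h1 x hx).1
  · by_contra hlt
    exact hx (mem_basicNhd.1 (hs s hs') x (by omega) (by omega))

theorem existsUnique_pos_family {F : DoubleLaurent R} (hF : F - 1 ∈ mSet R) :
    ∃! a : PosIdx → R, ProdConverges (fun x : PosIdx => 1 - mono x.1.1 (a x)) F := by
  obtain ⟨W, hW⟩ := exists_weight_of_mem_mSet hF
  obtain ⟨a, ha⟩ := exists_posConv hW hF
  refine ⟨a, prodConverges_of_posConv ha, fun b hb => ?_⟩
  obtain ⟨W', hW'⟩ := exists_posConv_of_prodConverges hF hb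
  funext x
  exact ((hW' x.1.1.1).2.2.of_le le_rfl (le_max_left _ (W x.1.1.1))).unique
    ((ha x.1.1.1).of_le le_rfl (le_max_right (W' x.1.1.1) _)) x le_rfl

end

/-! ### Product decompositions over negative exponents -/

section

variable {R : Type u} [CommRing R]

/-! ### The filtration on series with negative exponents -/

/-- The power of the nilradical required at the exponent `x`. -/
def negExp (C : ℤ) (n : ℕ) (x : ℤ × ℤ) : ℕ := (max (-((x.2 - n) / C)) (-(x.1 / C))).toNat

/-- The elements without positive powers of `t` whose coefficient at `x` lies in the power
`negExp C n x` of the nilradical. -/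
def negFil (R : Type u) [CommRing R] (C : ℤ) (n : ℕ) : AddSubgroup (DoubleLaurent R) :=
  coeffSub fun x => nilradical R ^ negExp C n x ⊓ condIdeal R (x.1 ≤ 0)

theorem mem_negFil {C : ℤ} {n : ℕ} {f : DoubleLaurent R} : f ∈ negFil R C n ↔
    ∀ x, co f x ∈ nilradical R ^ negExp C n x ∧ (co f x ≠ 0 → x.1 ≤ 0) := by
  simp only [negFil, mem_coeffSub, Ideal.mem_inf, mem_condIdeal]

/-- The idea of `negExp` is that each nilpotent factor may lower either exponent by at most `C`:
reaching row `i`, or column `j` measured from `n`, costs about `-i / C`, respectively `(n - j) / C`,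
factors from the nilradical. Subadditivity comes from superadditivity of integer division. -/
theorem negExp_add_le {C : ℤ} (hC : 0 < C) (k l : ℕ) (x y : ℤ × ℤ) :
    negExp C (k + l) (x + y) ≤ negExp C k x + negExp C l y := by
  have h : ∀ a b : ℤ, a / C + b / C ≤ (a + b) / C := fun a b => by
    rw [Int.le_ediv_iff_mul_le hC, add_mul]
    exact add_le_add (Int.ediv_mul_le a hC.ne') (Int.ediv_mul_le b hC.ne')
  have h1 := h (x.2 - k) (y.2 - l)
  have h2 := h x.1 y.1
  have h3 : x.2 - k + (y.2 - l) = (x + y).2 - ((k + l : ℕ) : ℤ) := by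
    simp only [Prod.snd_add]; push_cast; ring
  rw [h3] at h1
  unfold negExp
  simp only [Prod.fst_add]
  omega

theorem isMulFiltration_negFil {C : ℤ} (hC : 0 < C) : IsMulFiltration (negFil R C) where
  one_mem := one_mem_coeffSub (by simp [negExp, condIdeal])
  mul_mem {k l f g} hf hg := by
    refine mul_mem_coeffSub (fun x y => ?_) hf hg
    refine le_inf ?_ ?_
    · refine (Ideal.mul_mono inf_le_left inf_le_left).trans ?_
      rw [← pow_add]
      exact Ideal.pow_le_pow_right (negExp_add_le hC k l x y)
    · refine (Ideal.mul_mono inf_le_right inf_le_right).trans ?_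
      exact condIdeal_mul_le fun h h' => by simp only [Prod.fst_add]; omega
  antitone k l hkl := by
    intro f hf x
    refine ⟨Ideal.pow_le_pow_right ?_ (hf x).1, (hf x).2⟩
    unfold negExp
    have : (x.2 - l) / C ≤ (x.2 - k) / C := Int.ediv_le_ediv hC (by omega)
    omega

/-- When the `K`-th power of the nilradical vanishes, fewer than `K` nilpotent factors can be
present. The algebraic condition thus becomes a lower bound on exponents, which moves off to
infinity in `j` as `n` grows. -/
theorem bdd_of_mem_negFil {C : ℤ} (hC : 0 < C) {K : ℕ} (hK : nilradical R ^ K = 0) {n : ℕ}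
    {f : DoubleLaurent R} (hf : f ∈ negFil R C n) {x : ℤ × ℤ} (hx : co f x ≠ 0) :
    -(K * C) ≤ x.1 ∧ x.1 ≤ 0 ∧ n - K * C ≤ x.2 := by
  obtain ⟨h1, h2⟩ := mem_negFil.1 hf x
  have h3 : negExp C n x < K := by
    by_contra h
    have := Ideal.pow_le_pow_right (not_lt.1 h) h1
    rw [hK] at this
    exact hx (by simpa using this)
  unfold negExp at h3
  have h4 := Int.ediv_mul_le (x.2 - n) hC.ne'
  have h5 := Int.ediv_mul_le x.1 hC.ne'
  have h6 : -(K : ℤ) ≤ (x.2 - n) / C := by omega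
  have h7 : -(K : ℤ) ≤ x.1 / C := by omega
  refine ⟨by nlinarith, h2 hx, by nlinarith⟩

theorem eq_zero_of_mem_negFil (hR : IsNilpotent (nilradical R)) {C : ℤ} (hC : 0 < C)
    {f : DoubleLaurent R} (h : ∀ n, f ∈ negFil R C n) : f = 0 := by
  obtain ⟨K, hK⟩ := hR
  refine ext_co fun x => ?_
  by_contra hx
  have := (bdd_of_mem_negFil hC hK (h (x.2 + K * C + 1).toNat) hx).2.2
  omega

theorem mem_negFil_of {C : ℤ} (hC : 0 < C) {n : ℕ} {f : DoubleLaurent R} (hf : f ∈ nilFil R 1)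
    (h : ∀ x, co f x ≠ 0 → -C ≤ x.1 ∧ x.1 ≤ 0 ∧ n - C ≤ x.2) : f ∈ negFil R C n := by
  rw [mem_negFil]
  intro x
  refine ⟨?_, fun hx => (h x hx).2.1⟩
  by_cases hx : co f x = 0
  · rw [hx]; exact zero_mem _
  · obtain ⟨h1, h2, h3⟩ := h x hx
    refine Ideal.pow_le_pow_right ?_ (hf x)
    have h4 : -1 ≤ (x.2 - n) / C := by rw [Int.le_ediv_iff_mul_le hC]; omega
    have h5 : -1 ≤ x.1 / C := by rw [Int.le_ediv_iff_mul_le hC]; omega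
    unfold negExp
    omega

theorem mono_mem_negFil {C : ℤ} (hC : 0 < C) {n : ℕ} {x : ℤ × ℤ} {a : R} (ha : IsNilpotent a)
    (h : a ≠ 0 → -C ≤ x.1 ∧ x.1 ≤ 0 ∧ n - C ≤ x.2) : mono x a ∈ negFil R C n := by
  refine mem_negFil_of hC (mem_nilFil_one.2 fun y => ?_) fun y hy => ?_
  · rw [co_mono]; split_ifs
    · exact ha
    · exact IsNilpotent.zero
  · rw [co_mono] at hy
    split_ifs at hy with h'
    · rw [h']; exact h hy
    · exact absurd rfl hy

theorem IsNeg.fst_nonpos {x : ℤ × ℤ} (h : IsNeg x) : x.1 ≤ 0 := by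
  unfold IsNeg at h; omega

theorem exists_bound_of_mem_pSet {f : DoubleLaurent R} (hf : f ∈ pSet R) :
    ∃ C : ℤ, ∀ x, co f x ≠ 0 → -C ≤ x.1 ∧ -C ≤ x.2 := by
  obtain ⟨n, β, h⟩ := co_bdd f
  refine ⟨|n| + ∑ i ∈ Finset.Icc n 0, |β i|, fun x hx => ?_⟩
  obtain ⟨h1, h2⟩ := h x hx
  have h3 : IsNeg x := hf.2 x.1 x.2 hx
  have h4 : |β x.1| ≤ ∑ i ∈ Finset.Icc n 0, |β i| :=
    Finset.single_le_sum (f := fun i => |β i|) (fun _ _ => abs_nonneg _)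
      (Finset.mem_Icc.2 ⟨h1, h3.fst_nonpos⟩)
  have h5 := neg_abs_le (β x.1)
  have h6 := neg_abs_le n
  have h7 := abs_nonneg (β x.1)
  have h8 := abs_nonneg n
  constructor <;> linarith

theorem mem_negFil_one_of_mem_pSet (hR : IsNilpotent (nilradical R)) {f : DoubleLaurent R}
    (hf : f ∈ pSet R) {C : ℤ} (h : ∀ x, co f x ≠ 0 → -C ≤ x.1 ∧ 1 - C ≤ x.2) (hC : 0 < C) :
    f ∈ negFil R C 1 :=
  mem_negFil_of hC (mem_nilFil_one.2 ((mem_pSet hR).1 hf).1) fun x hx =>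
    ⟨(h x hx).1, (hf.2 x.1 x.2 hx : IsNeg x).fst_nonpos, (h x hx).2⟩

/-! ### Product decompositions over negative exponents -/

/-- The family `a` is nilpotent with support bounded by `C`. -/
structure NegBdd (C : ℤ) (a : NegIdx → R) : Prop where
  pos : 0 < C
  nilp : ∀ x, IsNilpotent (a x)
  bdd : ∀ x : NegIdx, a x ≠ 0 → -C ≤ x.1.1.1 ∧ 1 - C ≤ x.1.1.2

theorem NegBdd.mono_mem {C : ℤ} {a : NegIdx → R} (h : NegBdd C a) (x : NegIdx) :
    mono x.1.1 (a x) ∈ negFil R C 1 :=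
  mono_mem_negFil h.pos (h.nilp x) fun hx => ⟨(h.bdd x hx).1, x.2.fst_nonpos, (h.bdd x hx).2⟩

theorem mono_mem_pSet {x : NegIdx} {a : R} (ha : IsNilpotent a) : mono x.1.1 a ∈ pSet R := by
  obtain ⟨k, hk⟩ := ha
  refine ⟨⟨k, by rw [mono_pow, hk, mono_zero_right]⟩, fun i j hij => ?_⟩
  rw [cf_eq_co, co_mono] at hij
  by_cases h : (i, j) = x.1.1
  · rw [h]; exact x.2
  · exact absurd (if_neg h) hij

theorem prod_neg_sub_one_mem_pSet (hR : IsNilpotent (nilradical R)) {a : NegIdx → R}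
    (ha : ∀ x, IsNilpotent (a x)) (s : Finset NegIdx) :
    ∏ x ∈ s, (1 - mono x.1.1 (a x)) - 1 ∈ pSet R := by
  classical
  induction s using Finset.induction_on with
  | empty => simpa using zero_mem_pSet
  | insert x T hx ih =>
    rw [Finset.prod_insert hx]
    refine mul_sub_one_mem_pSet hR ?_ ih
    rw [sub_sub_cancel_left]
    exact neg_mem_pSet (mono_mem_pSet (ha x))

/-- The exponents `(i, j) < (0, 0)` with `-C ≤ i` and `1 - C ≤ j < n`. -/
theorem finite_negIdx (C n : ℤ) :
    {x : NegIdx | -C ≤ x.1.1.1 ∧ -C ≤ x.1.1.2 ∧ x.1.1.2 < n}.Finite := by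
  refine (((Set.finite_Icc (-C) 0).prod (Set.finite_Ico (-C) n)).preimage
    negIdx_injective.injOn).subset fun x hx => ?_
  exact ⟨⟨hx.1, x.2.fst_nonpos⟩, hx.2⟩

/-- The exponents `(i, j) < (0, 0)` with `-C ≤ i` and `-C ≤ j < n`. -/
def negBox (C n : ℤ) : Finset NegIdx := (finite_negIdx C n).toFinset

theorem mem_negBox {C n : ℤ} {x : NegIdx} :
    x ∈ negBox C n ↔ -C ≤ x.1.1.1 ∧ -C ≤ x.1.1.2 ∧ x.1.1.2 < n := by
  simp [negBox]

theorem NegBdd.prod_sub_prod_mem {C : ℤ} {a : NegIdx → R} (h : NegBdd C a) {n : ℕ}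
    {s : Finset NegIdx} (hs : negBox C n ⊆ s) :
    ∏ x ∈ s, (1 - mono x.1.1 (a x)) - ∏ x ∈ negBox C n, (1 - mono x.1.1 (a x)) ∈
      negFil R C n := by
  have hfil := isMulFiltration_negFil (R := R) h.pos
  refine hfil.prod_sub_mem_of_subset hs _ (fun x _ => hfil.mem_zero (h.mono_mem x))
    (fun x _ hx => mono_mem_negFil h.pos (h.nilp x) fun hax => ?_) (by simp [zero_mem])
  obtain ⟨h1, h2⟩ := h.bdd x hax
  have h3 := h.pos
  rw [mem_negBox] at hx
  exact ⟨h1, x.2.fst_nonpos, by omega⟩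

/-- The products over the growing boxes `negBox C n` stabilize at each exponent, since enlarging the
box from `n` changes them only within `negFil R C n`. -/
theorem NegBdd.exists_limit (hR : IsNilpotent (nilradical R)) {C : ℤ} {a : NegIdx → R}
    (h : NegBdd C a) : ∃ F : DoubleLaurent R, F - 1 ∈ pSet R ∧
      (∀ n : ℕ, ∀ s, negBox C n ⊆ s → ∏ x ∈ s, (1 - mono x.1.1 (a x)) - F ∈ negFil R C n) := by
  have hfil := isMulFiltration_negFil (R := R) h.pos
  obtain ⟨K, hK⟩ := id hR
  set Q : ℕ → DoubleLaurent R := fun n => ∏ x ∈ negBox C n, (1 - mono x.1.1 (a x)) with hQ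
  have hsub : ∀ m n : ℕ, m ≤ n → negBox C m ⊆ negBox C n := fun m n hmn x hx => by
    rw [mem_negBox] at *; omega
  have hQ0 : ∀ n, Q n ∈ negFil R C 0 := fun n =>
    hfil.prod_one_sub_mem _ _ fun x _ => hfil.mem_zero (h.mono_mem x)
  set M : ℤ × ℤ → ℕ := fun x => (x.2 + K * C + 1).toNat with hM
  have hstab : ∀ x m, M x ≤ m → co (Q m) x = co (Q (M x)) x := fun x m hm => by
    by_contra hne
    rw [← ne_eq, ← sub_ne_zero, ← co_sub] at hne
    have := (bdd_of_mem_negFil h.pos hK (h.prod_sub_prod_mem (hsub _ _ hm)) hne).2.2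
    simp only [hM] at this
    omega
  obtain ⟨F, hF⟩ := exists_of_bdd (fun x => co (Q (M x)) x) (-(K * C)) (fun _ => -(K * C))
    fun x hx => by
      have := bdd_of_mem_negFil h.pos hK (hQ0 (M x)) hx
      exact ⟨this.1, by have := this.2.2; push_cast at this; linarith⟩
  have hQp : ∀ n, Q n - 1 ∈ pSet R := fun n => prod_neg_sub_one_mem_pSet hR h.nilp _
  refine ⟨F, ?_, fun n s hs => ?_⟩
  · rw [mem_pSet hR]
    have hx : ∀ x, co (F - 1) x = co (Q (M x) - 1) x := fun x => by rw [co_sub, co_sub, hF]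
    exact ⟨fun x => by rw [hx]; exact ((mem_pSet hR).1 (hQp _)).1 x,
      fun x hne => by rw [hx] at hne; exact ((mem_pSet hR).1 (hQp _)).2 x hne⟩
  · rw [mem_negFil]
    intro x
    have h2 := mem_negFil.1 (sub_mem (h.prod_sub_prod_mem hs)
      (h.prod_sub_prod_mem (hsub n (max n (M x)) (le_max_left _ _)))) x
    rw [sub_sub_sub_cancel_right, co_sub] at h2
    change co _ x - co (Q (max n (M x))) x ∈ _ ∧ (co _ x - co (Q (max n (M x))) x ≠ 0 → _) at h2
    rw [hstab x _ (le_max_right _ _), ← hF] at h2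
    rwa [co_sub]

theorem prodConverges_of_negFil (hR : IsNilpotent (nilradical R)) {C : ℤ} (hC : 0 < C)
    {a : NegIdx → R} {F : DoubleLaurent R}
    (h : ∀ n : ℕ, ∃ s₀ : Finset NegIdx, ∀ s, s₀ ⊆ s →
      ∏ x ∈ s, (1 - mono x.1.1 (a x)) - F ∈ negFil R C n) :
    ProdConverges (fun x : NegIdx => 1 - mono x.1.1 (a x)) F := by
  obtain ⟨K, hK⟩ := hR
  intro N c
  obtain ⟨s₀, hs⟩ := h (∑ i ∈ Finset.Icc (-(K * C)) 0, (c i + K * C).toNat)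
  refine ⟨s₀, fun s hs' => mem_basicNhd.2 fun x hx hx' => ?_⟩
  by_contra hne
  obtain ⟨h1, h2, h3⟩ := bdd_of_mem_negFil hC hK (hs s hs') hne
  have h4 : (c x.1 + K * C).toNat ≤ ∑ i ∈ Finset.Icc (-(K * C)) 0, (c i + K * C).toNat :=
    Finset.single_le_sum (f := fun i => (c i + K * C).toNat) (fun _ _ => Nat.zero_le _)
      (Finset.mem_Icc.2 ⟨h1, h2⟩)
  omega

theorem negFil_conv_of_prodConverges {C : ℤ} {a : NegIdx → R}
    (ha : NegBdd C a) {F : DoubleLaurent R} (hF : F - 1 ∈ negFil R C 1)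
    (h : ProdConverges (fun x : NegIdx => 1 - mono x.1.1 (a x)) F) (n : ℕ) :
    ∃ s₀ : Finset NegIdx, ∀ s, s₀ ⊆ s →
      ∏ x ∈ s, (1 - mono x.1.1 (a x)) - F ∈ negFil R C n := by
  have hfil := isMulFiltration_negFil (R := R) ha.pos
  -- Rows are nonpositive, so `N = 1` covers them all. Where `j ≥ n`, the condition of order `n`
  -- concerns only `i` and already follows from order `0`.
  obtain ⟨s₀, hs⟩ := h 1 fun _ => n
  refine ⟨s₀, fun s hs' => mem_negFil.2 fun x => ?_⟩
  have h1 : ∏ x ∈ s, (1 - mono x.1.1 (a x)) - F ∈ negFil R C 0 := by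
    have h2 := hfil.prod_one_sub_mem s (fun x => mono x.1.1 (a x)) fun x _ =>
      hfil.mem_zero (ha.mono_mem x)
    have h3 := add_mem (hfil.mem_zero hF) hfil.one_mem
    rw [sub_add_cancel] at h3
    exact sub_mem h2 h3
  obtain ⟨h2, h3⟩ := mem_negFil.1 h1 x
  refine ⟨?_, h3⟩
  by_cases hx : x.1 < 1 ∧ x.2 < n
  · rw [mem_basicNhd.1 (hs s hs') x hx.1 hx.2]; exact zero_mem _
  · by_cases h0 : co (∏ x ∈ s, (1 - mono x.1.1 (a x)) - F) x = 0
    · rw [h0]; exact zero_mem _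
    · refine Ideal.pow_le_pow_right ?_ h2
      have h4 := h3 h0
      have h5 : 0 ≤ (x.2 - n) / C := Int.ediv_nonneg (by omega) ha.pos.le
      unfold negExp
      omega

theorem nil_mono_mem {x : ℤ × ℤ} {a : R} {k : ℕ} (ha : a ∈ nilradical R ^ k) :
    mono x a ∈ nilFil R k := mono_mem_coeffSub (w := fun _ => nilradical R ^ k) ha

/-- Induction on the power of the nilradical containing the differences `a x - b x`: modulo the next
power the two products differ by the sum of these monomials, yet both converge to `F`. -/
theorem neg_family_unique (hR : IsNilpotent (nilradical R)) {a b : NegIdx → R}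
    (ha : ∀ x, IsNilpotent (a x)) (hb : ∀ x, IsNilpotent (b x)) {F : DoubleLaurent R}
    (h : ProdConverges (fun x : NegIdx => 1 - mono x.1.1 (a x)) F)
    (h' : ProdConverges (fun x : NegIdx => 1 - mono x.1.1 (b x)) F) : a = b := by
  classical
  have key : ∀ k : ℕ, ∀ x, a x - b x ∈ nilradical R ^ (k + 1) := by
    intro k
    induction k with
    | zero => exact fun x => by simpa using sub_mem (mem_nilradical.2 (ha x)) (mem_nilradical.2 (hb x))
    | succ k ih =>
      intro x
      obtain ⟨s₀, hs⟩ := h (x.1.1.1 + 1) fun _ => x.1.1.2 + 1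
      obtain ⟨s₁, hs'⟩ := h' (x.1.1.1 + 1) fun _ => x.1.1.2 + 1
      set s := insert x (s₀ ∪ s₁) with hsdef
      have h1 := mem_basicNhd.1 (hs s (by grind)) x.1.1 (by omega) (by omega)
      have h2 := mem_basicNhd.1 (hs' s (by grind)) x.1.1 (by omega) (by omega)
      have h3 := isMulFiltration_nilFil.prod_sub_prod_add_sum_mem s
        (fun x => mono x.1.1 (a x)) (fun x => mono x.1.1 (b x)) (n := k + 1)
        (fun y _ => nil_mono_mem (by simpa [mem_nilradical] using ha y))
        (fun y _ => nil_mono_mem (by simpa [mem_nilradical] using hb y))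
        (fun y _ => by
          have : mono y.1.1 (a y) - mono y.1.1 (b y) = mono y.1.1 (a y - b y) :=
            ext_co fun z => by simp only [co_sub, co_mono]; split_ifs <;> simp
          rw [this]
          exact nil_mono_mem (ih y)) x.1.1
      rw [Finset.sum_sub_distrib, co_add, co_sub, co_sub, co_sum, co_sum,
          sum_co_mono (fun x : NegIdx => x.1.1) negIdx_injective s a (Finset.mem_insert_self _ _),
          sum_co_mono (fun x : NegIdx => x.1.1) negIdx_injective s b (Finset.mem_insert_self _ _)]
        at h3
      rw [co_sub, sub_eq_zero] at h1 h2
      rw [h1, h2, sub_self, zero_add] at h3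
      exact h3
  obtain ⟨K, hK⟩ := hR
  funext x
  have := Ideal.pow_le_pow_right (Nat.le_succ K) (key K x)
  rw [hK] at this
  exact sub_eq_zero.1 (by simpa using this)

/-- Start with the empty product, which equals `F` modulo the nilradical, and correct the family by
the coefficients of the error. Each round gains one power of the nilradical, so finitely many rounds
suffice. -/
theorem exists_neg_family (hR : IsNilpotent (nilradical R)) {F : DoubleLaurent R}
    (hF : F - 1 ∈ pSet R) : ∃ (C : ℤ) (a : NegIdx → R), NegBdd C a ∧
      ProdConverges (fun x : NegIdx => 1 - mono x.1.1 (a x)) F := by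
  classical
  have key : ∀ k : ℕ, ∃ (C : ℤ) (a : NegIdx → R) (P : DoubleLaurent R), NegBdd C a ∧
      P - 1 ∈ pSet R ∧ ProdConverges (fun x : NegIdx => 1 - mono x.1.1 (a x)) P ∧
      F - P ∈ nilFil R (k + 1) := by
    intro k
    induction k with
    | zero =>
      refine ⟨1, fun _ => 0, 1, ⟨one_pos, fun _ => IsNilpotent.zero, by simp⟩,
        by simpa using zero_mem_pSet, fun N c => ⟨∅, fun s _ => ?_⟩,
        mem_nilFil_one.2 ((mem_pSet hR).1 hF).1⟩
      simp [basicNhd, cf]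
    | succ k ih =>
      obtain ⟨C, a, P, ha, hP, hconv, hk⟩ := ih
      have he : F - P ∈ pSet R := by
        have := add_mem_pSet hR hF (neg_mem_pSet hP)
        rwa [show F - 1 + -(P - 1) = F - P by ring] at this
      obtain ⟨D, hD⟩ := exists_bound_of_mem_pSet he
      -- To first order, subtracting the error coefficients from the family adds the error `F - P`
      -- to the product.
      set b : NegIdx → R := fun x => a x - co (F - P) x.1.1 with hb
      have hbb : NegBdd (max C (D + 1)) b := by
        refine ⟨lt_max_of_lt_left ha.pos, fun x => ?_, fun x hx => ?_⟩
        · exact (Commute.all _ _).isNilpotent_sub (ha.nilp x) (((mem_pSet hR).1 he).1 _)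
        · have h1 := le_max_left C (D + 1)
          have h2 := le_max_right C (D + 1)
          by_cases hax : a x = 0
          · have := hD x.1.1 fun h => hx (by simp only [hb, hax, h, sub_zero])
            omega
          · have := ha.bdd x hax
            omega
      obtain ⟨Q, hQ, hQc⟩ := hbb.exists_limit hR
      have hQc' := prodConverges_of_negFil hR hbb.pos fun n => ⟨_, hQc n⟩
      refine ⟨_, b, Q, hbb, hQ, hQc', fun x => ?_⟩
      by_cases hx : IsNeg x
      · set z : NegIdx := ⟨⟨x, hx.ne_zero⟩, hx⟩ with hz
        obtain ⟨s₀, hs⟩ := hconv (x.1 + 1) fun _ => x.2 + 1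
        obtain ⟨s₁, hs'⟩ := hQc' (x.1 + 1) fun _ => x.2 + 1
        set s := insert z (s₀ ∪ s₁) with hsdef
        have h1 := mem_basicNhd.1 (hs s (by grind)) x (by omega) (by omega)
        have h2 := mem_basicNhd.1 (hs' s (by grind)) x (by omega) (by omega)
        have h3 := isMulFiltration_nilFil.prod_sub_prod_add_sum_mem s
          (fun x => mono x.1.1 (a x)) (fun x => mono x.1.1 (b x)) (n := k + 1)
          (fun y _ => nil_mono_mem (by simpa [mem_nilradical] using ha.nilp y))
          (fun y _ => nil_mono_mem (by simpa [mem_nilradical] using hbb.nilp y))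
          (fun y _ => by
            have : mono y.1.1 (a y) - mono y.1.1 (b y) = mono y.1.1 (co (F - P) y.1.1) :=
              ext_co fun z => by simp only [co_sub, co_mono, hb]; split_ifs <;> simp
            rw [this]
            exact nil_mono_mem (hk y.1.1)) x
        rw [Finset.sum_sub_distrib, co_add, co_sub, co_sub, co_sum, co_sum] at h3
        have e1 : ∑ y ∈ s, co (mono y.1.1 (a y)) x = a z :=
          sum_co_mono (fun x : NegIdx => x.1.1) negIdx_injective s a (Finset.mem_insert_self _ _)
        have e2 : ∑ y ∈ s, co (mono y.1.1 (b y)) x = b z :=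
          sum_co_mono (fun x : NegIdx => x.1.1) negIdx_injective s b (Finset.mem_insert_self _ _)
        rw [co_sub, sub_eq_zero] at h1 h2
        rw [h1, h2, e1, e2] at h3
        have e3 : co P x - co Q x + (a z - b z) = co (F - Q) x := by
          simp only [hb, co_sub, hz]; ring
        rwa [e3] at h3
      · have h0 : co (F - Q) x = 0 := by
          have h1 : co (F - 1) x = 0 := by
            by_contra hc; exact hx (hF.2 x.1 x.2 hc)
          have h2 : co (Q - 1) x = 0 := by
            by_contra hc; exact hx (hQ.2 x.1 x.2 hc)
          rw [co_sub] at *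
          linear_combination h1 - h2
        rw [h0]; exact zero_mem _
  obtain ⟨K, hK⟩ := id hR
  obtain ⟨C, a, P, ha, hP, hconv, hk⟩ := key K
  have : F = P := sub_eq_zero.1 (eq_zero_of_mem_nilFil hK (nilFil_le (by omega) hk))
  exact ⟨C, a, ha, this ▸ hconv⟩

/-! ### Existence and uniqueness of the factor family -/

theorem existsUnique_isFactorFamily (hR : IsNilpotent (nilradical R)) (f : (DoubleLaurent R)ˣ) :
    ∃! a, IsFactorFamily f a := by
  classical
  have hs := isSplitting_splitting hR f
  obtain ⟨ap, hap, hapu⟩ := existsUnique_pos_family hs.pos_mem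
  obtain ⟨C, an, han, hanc⟩ := exists_neg_family hR hs.neg_mem
  set a : Idx → R := fun x => if h : IsPos x.1 then ap ⟨x, h⟩ else
    if h : IsNeg x.1 then an ⟨x, h⟩ else 0 with ha
  have h1 : ∀ x : PosIdx, a x.1 = ap x := fun x => by rw [ha]; exact dif_pos x.2
  have h2 : ∀ x : NegIdx, a x.1 = an x := fun x => by
    rw [ha]
    exact (dif_neg fun h => h.not_isNeg x.2).trans (dif_pos x.2)
  refine ⟨a, ⟨?_, ?_, fun x hx => ?_, -C - 1, -C, fun x hx hax => ?_⟩, fun b hb => ?_⟩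
  · simpa only [h1] using hap
  · simpa only [h2] using hanc
  · rw [h2 ⟨x, hx⟩]; exact han.nilp _
  · rw [h2 ⟨x, hx⟩] at hax
    have := han.bdd _ hax
    simp only at this
    omega
  · funext x
    rcases isPos_or_isNeg x.2 with hx | hx
    · rw [h1 ⟨x, hx⟩, ← hapu _ hb.pos]
    · rw [h2 ⟨x, hx⟩]
      exact congrFun (neg_family_unique hR (fun x : NegIdx => hb.nilp x.1 x.2) han.nilp hb.neg hanc)
        ⟨x, hx⟩

theorem isFactorFamily_factorCoeff (hR : IsNilpotent (nilradical R)) (f : (DoubleLaurent R)ˣ) :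
    IsFactorFamily f (factorCoeff f) :=
  Classical.epsilon_spec (existsUnique_isFactorFamily hR f).exists

theorem IsFactorFamily.factorCoeff_eq (hR : IsNilpotent (nilradical R)) {f : (DoubleLaurent R)ˣ}
    {a : Idx → R} (h : IsFactorFamily f a) : factorCoeff f = a :=
  (existsUnique_isFactorFamily hR f).unique (isFactorFamily_factorCoeff hR f) h

end

/-! ### Finiteness and nilpotence in the elementary factors -/

section

variable {R : Type u} [CommRing R]

/-! ### Boundedness and finiteness -/

/-- Sets of exponents on which `i` is bounded below and `j` is bounded below for every `i`. -/
def IsBdd (B : Set (ℤ × ℤ)) : Prop :=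
  ∃ (n : ℤ) (β : ℤ → ℤ), ∀ x ∈ B, n ≤ x.1 ∧ β x.1 ≤ x.2

theorem IsBdd.exists_lower {B : Set (ℤ × ℤ)} (h : IsBdd B) :
    ∃ n : ℤ, ∀ M : ℤ, ∃ b : ℤ, ∀ x ∈ B, n ≤ x.1 ∧ (x.1 ≤ M → b ≤ x.2) := by
  obtain ⟨n, β, hβ⟩ := h
  refine ⟨n, fun M => ⟨-∑ i ∈ Finset.Icc n M, |β i|, fun x hx => ⟨(hβ x hx).1, fun hM => ?_⟩⟩⟩
  obtain ⟨h1, h2⟩ := hβ x hx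
  have h3 : |β x.1| ≤ ∑ i ∈ Finset.Icc n M, |β i| :=
    Finset.single_le_sum (f := fun i => |β i|) (fun _ _ => abs_nonneg _)
      (Finset.mem_Icc.2 ⟨h1, hM⟩)
  have h4 := neg_abs_le (β x.1)
  linarith

/-- Rows bounded below with sum `0` are bounded above. On the resulting finite range of rows the
columns are uniformly bounded below, and again have sum `0`. -/
theorem finite_triples {A B C : Set (ℤ × ℤ)} (hA : IsBdd A) (hB : IsBdd B) (hC : IsBdd C) :
    {w : (ℤ × ℤ) × (ℤ × ℤ) × (ℤ × ℤ) |
      w.1 ∈ A ∧ w.2.1 ∈ B ∧ w.2.2 ∈ C ∧ w.1 + w.2.1 + w.2.2 = 0}.Finite := by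
  obtain ⟨n₁, h₁⟩ := hA.exists_lower
  obtain ⟨n₂, h₂⟩ := hB.exists_lower
  obtain ⟨n₃, h₃⟩ := hC.exists_lower
  obtain ⟨b₁, h₁⟩ := h₁ (-n₂ - n₃)
  obtain ⟨b₂, h₂⟩ := h₂ (-n₁ - n₃)
  obtain ⟨b₃, h₃⟩ := h₃ (-n₁ - n₂)
  refine (((Set.finite_Icc n₁ (-n₂ - n₃)).prod (Set.finite_Icc b₁ (-b₂ - b₃))).prod
    (((Set.finite_Icc n₂ (-n₁ - n₃)).prod (Set.finite_Icc b₂ (-b₁ - b₃))).prod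
    ((Set.finite_Icc n₃ (-n₁ - n₂)).prod (Set.finite_Icc b₃ (-b₁ - b₂))))).subset ?_
  rintro ⟨⟨i, j⟩, ⟨k, l⟩, m, n⟩ ⟨ha, hb, hc, h0⟩
  have e1 := congrArg Prod.fst h0
  have e2 := congrArg Prod.snd h0
  have g1 := h₁ _ ha
  have g2 := h₂ _ hb
  have g3 := h₃ _ hc
  simp only [Prod.mk_add_mk, Prod.fst_zero, Prod.snd_zero] at e1 e2 g1 g2 g3
  have g1' := g1.2 (by omega)
  have g2' := g2.2 (by omega)
  have g3' := g3.2 (by omega)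
  simp only [Set.mem_prod, Set.mem_Icc]
  omega

/-- The exponent `(s + 1) x` attached to `(x, s)`. -/
def pex (p : Idx × ℕ) : ℤ × ℤ := (p.2 + 1) • p.1.1

theorem pex_fst (p : Idx × ℕ) : (pex p).1 = (p.2 + 1) * p.1.1.1 := by simp [pex]

theorem pex_snd (p : Idx × ℕ) : (pex p).2 = (p.2 + 1) * p.1.1.2 := by simp [pex]

/-- If `(s + 1) x = z` with `x ≠ 0`, the coordinates of `x` are no larger than those of `z`, and
some nonzero coordinate bounds `s`. -/
theorem finite_pex_fiber (z : ℤ × ℤ) : (pex ⁻¹' {z}).Finite := by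
  have h : ∀ (s : ℕ) (i : ℤ), |i| ≤ |(s + 1) * i| := fun s i => by
    rw [abs_mul]
    have : (1 : ℤ) ≤ |(s + 1 : ℤ)| := by rw [abs_of_nonneg (by positivity)]; omega
    nlinarith [abs_nonneg i]
  have h' : ∀ (s : ℕ) (i : ℤ), i ≠ 0 → (s : ℤ) ≤ |(s + 1) * i| := fun s i hi => by
    rw [abs_mul, abs_of_nonneg (by positivity : (0 : ℤ) ≤ s + 1)]
    have : 1 ≤ |i| := Int.one_le_abs hi
    nlinarith
  have hfin : {p : Idx × ℕ | (|p.1.1.1| ≤ |z.1| ∧ |p.1.1.2| ≤ |z.2|) ∧ (p.2 : ℤ) ≤ |z.1| + |z.2|}.Finite := by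
    have h1 := (((Set.finite_Icc (-|z.1|) |z.1|).prod (Set.finite_Icc (-|z.2|) |z.2|)).preimage
      (Subtype.val_injective (p := fun x : ℤ × ℤ => x ≠ 0)).injOn).prod
      (Set.finite_Iic (|z.1| + |z.2|).toNat)
    refine h1.subset fun p hp => ?_
    exact ⟨⟨abs_le.1 hp.1.1, abs_le.1 hp.1.2⟩, by have := hp.2; simp only [Set.mem_Iic]; omega⟩
  refine hfin.subset fun p hp => ?_
  have hp : pex p = z := hp
  rw [← hp, pex_fst, pex_snd]
  refine ⟨⟨h _ _, h _ _⟩, ?_⟩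
  rcases not_and_or.1 fun h0 : p.1.1.1 = 0 ∧ p.1.1.2 = 0 => p.1.2 (Prod.ext h0.1 h0.2) with h0 | h0
  · have := h' p.2 _ h0
    have := abs_nonneg ((p.2 + 1) * p.1.1.2 : ℤ)
    omega
  · have := h' p.2 _ h0
    have := abs_nonneg ((p.2 + 1) * p.1.1.1 : ℤ)
    omega

/-- The exponents at which some power of a member of the family contributes. -/
def powSupp (a : Idx → R) : Set (ℤ × ℤ) := {z | ∃ p, a p.1 ^ (p.2 + 1) ≠ 0 ∧ pex p = z}

/-- For positive `x` the weight of a multiple is a positive multiple of a positive weight, which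
bounds the column below in terms of the row. For negative `x` nilpotence bounds the number of
nonzero powers, and the family itself has exponents bounded below. -/
theorem isBdd_powSupp (hR : IsNilpotent (nilradical R)) (f : (DoubleLaurent R)ˣ) :
    IsBdd (powSupp (factorCoeff f)) := by
  have hf := isFactorFamily_factorCoeff hR f
  set a := factorCoeff f with ha
  obtain ⟨W, hW⟩ := exists_posConv_of_prodConverges (a := fun x => a x.1)
    (isSplitting_splitting hR f).pos_mem hf.pos
  obtain ⟨n, m, hb⟩ := hf.bdd
  obtain ⟨K, hK⟩ := hR
  refine ⟨-(K * |n|), fun i => min (-(W i * i)) (-(K * |m|)), ?_⟩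
  rintro _ ⟨p, hp, rfl⟩
  have hs : (0 : ℤ) ≤ p.2 := by positivity
  have hax : a p.1 ≠ 0 := fun h => hp (by rw [h, zero_pow (Nat.succ_ne_zero _)])
  rcases isPos_or_isNeg p.1.2 with hx | hx
  · have h0 := hx.fst_nonneg
    have h1 : 0 ≤ (pex p).1 := by rw [pex_fst]; positivity
    have h2 : p.1.1.1 ≤ (pex p).1 := by rw [pex_fst]; nlinarith
    -- The slope is taken at the row of the multiple, not of `x`, so that the resulting bound
    -- depends only on that row.
    have h3 := (hW (pex p).1).2.2.weight ⟨p.1, hx⟩ h2 hax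
    refine ⟨le_trans (by simp only [Left.neg_nonpos_iff]; positivity) h1,
      (min_le_left _ _).trans ?_⟩
    simp only at h3
    have h4 : 0 ≤ (p.2 + 1 : ℤ) * (p.1.1.2 + W (pex p).1 * p.1.1.1) := by
      apply mul_nonneg <;> linarith
    have h5 : (p.2 + 1 : ℤ) * (p.1.1.2 + W (pex p).1 * p.1.1.1) =
        (pex p).2 + W (pex p).1 * (pex p).1 := by
      rw [pex_snd, mul_add, mul_left_comm, ← pex_fst]
    linarith
  · have hlt : p.2 + 1 < K := by
      by_contra hc
      have h1 := Ideal.pow_mem_pow (mem_nilradical.2 (hf.nilp p.1 hx)) (p.2 + 1)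
      have h2 := Ideal.pow_le_pow_right (not_lt.1 hc) h1
      rw [hK] at h2
      exact hp (by simpa using h2)
    obtain ⟨h1, h2⟩ := hb p.1 hx hax
    have h3 := neg_abs_le n
    have h4 := neg_abs_le m
    have h5 := abs_nonneg n
    have h6 := abs_nonneg m
    have h7 : ((p.2 + 1 : ℕ) : ℤ) ≤ K := by exact_mod_cast hlt.le
    push_cast at h7
    rw [pex_fst, pex_snd]
    refine ⟨by nlinarith, (min_le_right _ _).trans (by nlinarith)⟩

theorem finite_pow_triples (hR : IsNilpotent (nilradical R)) (f g h : (DoubleLaurent R)ˣ) :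
    {w : (Idx × ℕ) × (Idx × ℕ) × (Idx × ℕ) | factorCoeff f w.1.1 ^ (w.1.2 + 1) ≠ 0 ∧
      factorCoeff g w.2.1.1 ^ (w.2.1.2 + 1) ≠ 0 ∧ factorCoeff h w.2.2.1 ^ (w.2.2.2 + 1) ≠ 0 ∧
      pex w.1 + pex w.2.1 + pex w.2.2 = 0}.Finite := by
  have h1 := finite_triples (isBdd_powSupp hR f) (isBdd_powSupp hR g) (isBdd_powSupp hR h)
  refine (h1.preimage' (f := Prod.map pex (Prod.map pex pex)) fun b _ => ?_).subset
    fun w hw => ⟨⟨w.1, hw.1, rfl⟩, ⟨w.2.1, hw.2.1, rfl⟩, ⟨w.2.2, hw.2.2.1, rfl⟩, hw.2.2.2⟩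
  refine ((finite_pex_fiber b.1).prod ((finite_pex_fiber b.2.1).prod
    (finite_pex_fiber b.2.2))).subset fun w hw => ?_
  have hw : Prod.map pex (Prod.map pex pex) w = b := hw
  rw [← hw]
  exact ⟨rfl, rfl, rfl⟩

theorem finite_pow_pairs (hR : IsNilpotent (nilradical R)) (f g : (DoubleLaurent R)ˣ) :
    {w : (Idx × ℕ) × (Idx × ℕ) | factorCoeff f w.1.1 ^ (w.1.2 + 1) ≠ 0 ∧
      factorCoeff g w.2.1 ^ (w.2.2 + 1) ≠ 0 ∧ pex w.1 + pex w.2 = 0}.Finite := by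
  have h1 := finite_triples (isBdd_powSupp hR f) (isBdd_powSupp hR g) (C := {0})
    ⟨0, fun _ => 0, by simp⟩
  refine (h1.preimage' (f := fun w : (Idx × ℕ) × (Idx × ℕ) => (pex w.1, pex w.2, (0 : ℤ × ℤ)))
    fun b _ => ?_).subset
    fun w hw => ⟨⟨w.1, hw.1, rfl⟩, ⟨w.2, hw.2.1, rfl⟩, rfl, by simpa using hw.2.2⟩
  refine ((finite_pex_fiber b.1).prod (finite_pex_fiber b.2.1)).subset fun w hw => ?_
  have hw : (pex w.1, pex w.2, (0 : ℤ × ℤ)) = b := hw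
  rw [← hw]
  exact ⟨rfl, rfl⟩

/-! ### The relations between the exponents in the elementary factors -/

/-- A combination of lexicographically positive vectors with positive integer coefficients is
positive, hence not `0`. -/
theorem isNeg_of_nsmul_add {x y z : ℤ × ℤ} (hx : x ≠ 0) (hy : y ≠ 0) (hz : z ≠ 0) {s t r : ℕ}
    (hs : 0 < s) (ht : 0 < t) (hr : 0 < r) (h : s • x + t • y + r • z = 0) :
    IsNeg x ∨ IsNeg y ∨ IsNeg z := by
  by_contra hc
  push Not at hc
  have h1 := ((((isPos_or_isNeg hx).resolve_right hc.1).nsmul hs).add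
    (((isPos_or_isNeg hy).resolve_right hc.2.1).nsmul ht)).add
    (((isPos_or_isNeg hz).resolve_right hc.2.2).nsmul hr)
  exact h1.ne_zero h

theorem isNeg_of_nsmul_add_pair {x y : ℤ × ℤ} (hx : x ≠ 0) (hy : y ≠ 0) {s t : ℕ}
    (hs : 0 < s) (ht : 0 < t) (h : s • x + t • y = 0) : IsNeg x ∨ IsNeg y := by
  by_contra hc
  push Not at hc
  have h1 := (((isPos_or_isNeg hx).resolve_right hc.1).nsmul hs).add
    (((isPos_or_isNeg hy).resolve_right hc.2).nsmul ht)
  exact h1.ne_zero h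

theorem det2_swap (x y : ℤ × ℤ) : det2 y x = -det2 x y := by unfold det2; ring

theorem gcd3_pos {p q r : ℤ} (hp : p ≠ 0) : 0 < gcd3 p q r :=
  Nat.gcd_pos_of_pos_left _ (Int.gcd_pos_of_ne_zero_left _ hp)

theorem gcd3_dvd (p q r : ℤ) :
    gcd3 p q r ∣ p.natAbs ∧ gcd3 p q r ∣ q.natAbs ∧ gcd3 p q r ∣ r.natAbs :=
  ⟨(Nat.gcd_dvd_left _ _).trans (Nat.gcd_dvd_left _ _),
    (Nat.gcd_dvd_left _ _).trans (Nat.gcd_dvd_right _ _), Nat.gcd_dvd_right _ _⟩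

/-- Cramer's rule for three vectors in the plane; it explains the exponents `p₀`, `q₀`, `r₀` in `T`.
-/
theorem det2_rel (x y z : ℤ × ℤ) :
    det2 y z • x + det2 z x • y + det2 x y • z = 0 := by
  ext
  · simp [det2]; ring
  · simp [det2]; ring

/-- The relation between the exponents in the factor `T`. -/
theorem t_rel {x y z : ℤ × ℤ} (h : TPos x y z ∨ TNeg x y z) {d : ℕ}
    (hd : d = gcd3 (det2 y z) (det2 z x) (det2 x y)) :
    0 < d ∧ 0 < (det2 y z).natAbs / d ∧ 0 < (det2 z x).natAbs / d ∧ 0 < (det2 x y).natAbs / d ∧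
      ((det2 y z).natAbs / d) • x + ((det2 z x).natAbs / d) • y +
        ((det2 x y).natAbs / d) • z = 0 := by
  have hne : det2 y z ≠ 0 ∧ det2 z x ≠ 0 ∧ det2 x y ≠ 0 := by
    rcases h with ⟨a, b, c⟩ | ⟨a, b, c⟩ <;> omega
  have hd0 : 0 < d := hd ▸ gcd3_pos hne.1
  obtain ⟨h1, h2, h3⟩ := gcd3_dvd (det2 y z) (det2 z x) (det2 x y)
  rw [← hd] at h1 h2 h3
  have key : ∀ m : ℤ, m ≠ 0 → d ∣ m.natAbs → 0 < m.natAbs / d := fun m hm hdm =>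
    Nat.div_pos (Nat.le_of_dvd (Int.natAbs_pos.2 hm) hdm) hd0
  refine ⟨hd0, key _ hne.1 h1, key _ hne.2.1 h2, key _ hne.2.2 h3, ?_⟩
  have hs : d • (((det2 y z).natAbs / d) • x + ((det2 z x).natAbs / d) • y +
      ((det2 x y).natAbs / d) • z) = 0 := by
    rw [smul_add, smul_add, smul_smul, smul_smul, smul_smul, Nat.mul_div_cancel' h1,
      Nat.mul_div_cancel' h2, Nat.mul_div_cancel' h3]
    simp only [← natCast_zsmul, Int.natCast_natAbs]
    have hrel := det2_rel x y z
    rcases h with h | h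
    · obtain ⟨a1, a2, a3⟩ := h
      rw [abs_of_pos a1, abs_of_pos a2, abs_of_pos a3]
      exact hrel
    · obtain ⟨a1, a2, a3⟩ := h
      rw [abs_of_neg a1, abs_of_neg a2, abs_of_neg a3, neg_smul, neg_smul, neg_smul, ← neg_add,
        ← neg_add, hrel, neg_zero]
  exact (smul_eq_zero.1 hs).resolve_left hd0.ne'

/-- For proportional exponents `(jl)(ik) = (jk)²`, so `jl` and `ik` never have opposite signs; if
`jl` were positive, their sum could not be negative. -/
theorem SCond.mul_neg {x y : ℤ × ℤ} (h : SCond x y) : x.2 * y.2 < 0 := by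
  obtain ⟨h1, h2, h3⟩ := h
  unfold det2 at h1
  by_contra hc
  have h4 : 0 < x.2 * y.2 := lt_of_le_of_ne (not_lt.1 hc) h3.symm
  have h5 : (x.2 * y.2) * (x.1 * y.1) = (x.2 * y.1) * (x.2 * y.1) := by
    linear_combination -(x.2 * y.1) * h1
  have h6 : x.1 * y.1 < 0 := by linarith
  nlinarith [mul_self_nonneg (x.2 * y.1), mul_pos h4 (neg_pos.2 h6)]

/-- The relation between the exponents in the factor `S`. -/
theorem s_rel {x y : ℤ × ℤ} (h : SCond x y) :
    0 < Int.gcd x.2 y.2 ∧ 0 < y.2.natAbs / Int.gcd x.2 y.2 ∧ 0 < x.2.natAbs / Int.gcd x.2 y.2 ∧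
      (y.2.natAbs / Int.gcd x.2 y.2) • x + (x.2.natAbs / Int.gcd x.2 y.2) • y = 0 := by
  have hx : x.2 ≠ 0 := left_ne_zero_of_mul h.2.2
  have hy : y.2 ≠ 0 := right_ne_zero_of_mul h.2.2
  have hneg := h.mul_neg
  set d := Int.gcd x.2 y.2 with hd
  have hd0 : 0 < d := Int.gcd_pos_of_ne_zero_left _ hx
  have h1 : d ∣ x.2.natAbs := Nat.gcd_dvd_left _ _
  have h2 : d ∣ y.2.natAbs := Nat.gcd_dvd_right _ _
  refine ⟨hd0, Nat.div_pos (Nat.le_of_dvd (Int.natAbs_pos.2 hy) h2) hd0,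
    Nat.div_pos (Nat.le_of_dvd (Int.natAbs_pos.2 hx) h1) hd0, ?_⟩
  have hs : d • ((y.2.natAbs / d) • x + (x.2.natAbs / d) • y) = 0 := by
    rw [smul_add, smul_smul, smul_smul, Nat.mul_div_cancel' h1, Nat.mul_div_cancel' h2]
    simp only [← natCast_zsmul, Int.natCast_natAbs]
    have hdet := h.1
    unfold det2 at hdet
    rcases lt_or_gt_of_ne hx with h3 | h3
    · have h4 : 0 < y.2 := by nlinarith
      rw [abs_of_neg h3, abs_of_pos h4]
      ext
      · simp; linarith
      · simp; linarith
    · have h4 : y.2 < 0 := by nlinarith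
      rw [abs_of_neg h4, abs_of_pos h3]
      ext
      · simp; linarith
      · simp; linarith
  exact (smul_eq_zero.1 hs).resolve_left hd0.ne'

/-- Exchanging `u` and `t` turns `Q` into `S`, up to inversion; the facts about `Q` are deduced in
this way. -/
theorem qCond_iff (x y : ℤ × ℤ) : QCond x y ↔ SCond x.swap y.swap := by
  unfold QCond SCond det2
  simp only [Prod.fst_swap, Prod.snd_swap]
  constructor
  · rintro ⟨h1, h2, h3⟩; exact ⟨by linarith, by linarith, h3⟩
  · rintro ⟨h1, h2, h3⟩; exact ⟨by linarith, by linarith, h3⟩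

theorem qMon_eq (x y : ℤ × ℤ) (a b : R) : qMon x y a b = sMon x.swap y.swap a b := rfl

theorem q_rel {x y : ℤ × ℤ} (h : QCond x y) :
    0 < Int.gcd x.1 y.1 ∧ 0 < y.1.natAbs / Int.gcd x.1 y.1 ∧ 0 < x.1.natAbs / Int.gcd x.1 y.1 ∧
      (y.1.natAbs / Int.gcd x.1 y.1) • x + (x.1.natAbs / Int.gcd x.1 y.1) • y = 0 := by
  obtain ⟨h1, h2, h3, h4⟩ := s_rel ((qCond_iff x y).1 h)
  refine ⟨h1, h2, h3, ?_⟩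
  have h5 := congrArg Prod.swap h4
  simpa [Prod.ext_iff] using h5

/-! ### Nilpotence of the monomials in the elementary factors -/

/-- The exponents of the monomial are the coefficients of a positive relation between `x`, `y`, `z`.
One of these is therefore negative, and its coefficient occurs to a positive power. -/
theorem isNilpotent_tMon {x y z : Idx} {a b c : R} (ha : IsNeg x.1 → IsNilpotent a)
    (hb : IsNeg y.1 → IsNilpotent b) (hc : IsNeg z.1 → IsNilpotent c)
    (h : TPos x.1 y.1 z.1 ∨ TNeg x.1 y.1 z.1) : IsNilpotent (tMon x.1 y.1 z.1 a b c) := by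
  obtain ⟨-, h1, h2, h3, h4⟩ := t_rel h rfl
  unfold tMon
  rcases isNeg_of_nsmul_add x.2 y.2 z.2 h1 h2 h3 h4 with h | h | h
  · exact (Commute.all _ _).isNilpotent_mul_right
      ((Commute.all _ _).isNilpotent_mul_right ((ha h).pow_of_pos h1.ne'))
  · exact (Commute.all _ _).isNilpotent_mul_right
      ((Commute.all _ _).isNilpotent_mul_left ((hb h).pow_of_pos h2.ne'))
  · exact (Commute.all _ _).isNilpotent_mul_left ((hc h).pow_of_pos h3.ne')

theorem isNilpotent_sMon {x y : Idx} {a b : R} (ha : IsNeg x.1 → IsNilpotent a)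
    (hb : IsNeg y.1 → IsNilpotent b) (h : SCond x.1 y.1) : IsNilpotent (sMon x.1 y.1 a b) := by
  obtain ⟨-, h1, h2, h3⟩ := s_rel h
  unfold sMon
  rcases isNeg_of_nsmul_add_pair x.2 y.2 h1 h2 h3 with h | h
  · exact (Commute.all _ _).isNilpotent_mul_right ((ha h).pow_of_pos h1.ne')
  · exact (Commute.all _ _).isNilpotent_mul_left ((hb h).pow_of_pos h2.ne')

theorem isNilpotent_qMon {x y : Idx} {a b : R} (ha : IsNeg x.1 → IsNilpotent a)
    (hb : IsNeg y.1 → IsNilpotent b) (h : QCond x.1 y.1) : IsNilpotent (qMon x.1 y.1 a b) := by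
  obtain ⟨-, h1, h2, h3⟩ := q_rel h
  unfold qMon
  rcases isNeg_of_nsmul_add_pair x.2 y.2 h1 h2 h3 with h | h
  · exact (Commute.all _ _).isNilpotent_mul_right ((ha h).pow_of_pos h1.ne')
  · exact (Commute.all _ _).isNilpotent_mul_left ((hb h).pow_of_pos h2.ne')

theorem oneSub_val {r : R} (h : IsNilpotent r) : (oneSub r : R) = 1 - r := by
  unfold oneSub
  rw [dif_pos h.isUnit_one_sub]
  rfl

@[simp] theorem oneSub_zero : oneSub (0 : R) = 1 :=
  Units.ext (by rw [oneSub_val IsNilpotent.zero]; simp)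

theorem map_oneSub {S : Type v} [CommRing S] (φ : R →+* S) {r : R} (h : IsNilpotent r) :
    Units.map (φ : R →* S) (oneSub r) = oneSub (φ r) := by
  refine Units.ext ?_
  rw [oneSub_val (h.map φ)]
  change φ (oneSub r) = _
  rw [oneSub_val h, map_sub, map_one]

/-! ### Finiteness of the families of factors -/

/-- The bound is on powers rather than on the coefficients: a nontrivial factor requires
nonvanishing powers of its coefficients, and the multiples of the exponents at which they sit must
sum to `0`. -/
theorem finite_rel_triples (hR : IsNilpotent (nilradical R)) (f g h : (DoubleLaurent R)ˣ) :
    {w : Idx × Idx × Idx | ∃ s t r : ℕ, 0 < s ∧ 0 < t ∧ 0 < r ∧ factorCoeff f w.1 ^ s ≠ 0 ∧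
      factorCoeff g w.2.1 ^ t ≠ 0 ∧ factorCoeff h w.2.2 ^ r ≠ 0 ∧
      s • w.1.1 + t • w.2.1.1 + r • w.2.2.1 = 0}.Finite := by
  refine ((finite_pow_triples hR f g h).image fun w => (w.1.1, w.2.1.1, w.2.2.1)).subset ?_
  rintro ⟨x, y, z⟩ ⟨s, t, r, hs, ht, hr, h1, h2, h3, h4⟩
  obtain ⟨s, rfl⟩ := Nat.exists_eq_succ_of_ne_zero hs.ne'
  obtain ⟨t, rfl⟩ := Nat.exists_eq_succ_of_ne_zero ht.ne'
  obtain ⟨r, rfl⟩ := Nat.exists_eq_succ_of_ne_zero hr.ne'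
  exact ⟨((x, s), (y, t), (z, r)), ⟨h1, h2, h3, h4⟩, rfl⟩

theorem finite_rel_pairs (hR : IsNilpotent (nilradical R)) (f g : (DoubleLaurent R)ˣ) :
    {w : Idx × Idx | ∃ s t : ℕ, 0 < s ∧ 0 < t ∧ factorCoeff f w.1 ^ s ≠ 0 ∧
      factorCoeff g w.2 ^ t ≠ 0 ∧ s • w.1.1 + t • w.2.1 = 0}.Finite := by
  refine ((finite_pow_pairs hR f g).image fun w => (w.1.1, w.2.1)).subset ?_
  rintro ⟨x, y⟩ ⟨s, t, hs, ht, h1, h2, h3⟩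
  obtain ⟨s, rfl⟩ := Nat.exists_eq_succ_of_ne_zero hs.ne'
  obtain ⟨t, rfl⟩ := Nat.exists_eq_succ_of_ne_zero ht.ne'
  exact ⟨((x, s), (y, t)), ⟨h1, h2, h3⟩, rfl⟩

theorem tFamily_finite (hR : IsNilpotent (nilradical R)) (f g h : (DoubleLaurent R)ˣ) :
    {w | tFamily f g h w ≠ 1}.Finite := by
  refine (finite_rel_triples hR f g h).subset ?_
  rintro ⟨x, y, z⟩ hw
  have hw : tFactor x.1 y.1 z.1 (factorCoeff f x) (factorCoeff g y) (factorCoeff h z) ≠ 1 := hw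
  have hc : TPos x.1 y.1 z.1 ∨ TNeg x.1 y.1 z.1 := by
    by_contra hc
    push Not at hc
    exact hw (by simp [tFactor, hc.1, hc.2])
  have hm : tMon x.1 y.1 z.1 (factorCoeff f x) (factorCoeff g y) (factorCoeff h z) ≠ 0 := by
    intro h0
    exact hw (by simp [tFactor, h0])
  obtain ⟨-, h1, h2, h3, h4⟩ := t_rel hc rfl
  exact ⟨_, _, _, h1, h2, h3, left_ne_zero_of_mul (left_ne_zero_of_mul hm),
    right_ne_zero_of_mul (left_ne_zero_of_mul hm), right_ne_zero_of_mul hm, h4⟩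

theorem sFamily_finite (hR : IsNilpotent (nilradical R)) (f g : (DoubleLaurent R)ˣ) :
    {w | sFamily f g w ≠ 1}.Finite := by
  refine (finite_rel_pairs hR f g).subset ?_
  rintro ⟨x, y⟩ hw
  have hw : sFactor x.1 y.1 (factorCoeff f x) (factorCoeff g y) ≠ 1 := hw
  have hc : SCond x.1 y.1 := by
    by_contra hc
    exact hw (by simp [sFactor, hc])
  have hm : sMon x.1 y.1 (factorCoeff f x) (factorCoeff g y) ≠ 0 := by
    intro h0
    exact hw (by simp [sFactor, h0])
  obtain ⟨-, h1, h2, h3⟩ := s_rel hc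
  exact ⟨_, _, h1, h2, left_ne_zero_of_mul hm, right_ne_zero_of_mul hm, h3⟩

theorem qFamily_finite (hR : IsNilpotent (nilradical R)) (f g : (DoubleLaurent R)ˣ) :
    {w | qFamily f g w ≠ 1}.Finite := by
  refine (finite_rel_pairs hR f g).subset ?_
  rintro ⟨x, y⟩ hw
  have hw : qFactor x.1 y.1 (factorCoeff f x) (factorCoeff g y) ≠ 1 := hw
  have hc : QCond x.1 y.1 := by
    by_contra hc
    exact hw (by simp [qFactor, hc])
  have hm : qMon x.1 y.1 (factorCoeff f x) (factorCoeff g y) ≠ 0 := by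
    intro h0
    exact hw (by simp [qFactor, h0])
  obtain ⟨-, h1, h2, h3⟩ := q_rel hc
  exact ⟨_, _, h1, h2, left_ne_zero_of_mul hm, right_ne_zero_of_mul hm, h3⟩

end

/-! ### Anti-symmetry and functoriality of the symbol -/

section

variable {R : Type u} [CommRing R]

/-! ### Anti-symmetry -/

theorem gcd3_swap (p q r : ℤ) : gcd3 (-q) (-p) (-r) = gcd3 p q r := by
  unfold gcd3
  rw [Int.gcd_neg, Int.neg_gcd, Int.gcd_comm, Int.natAbs_neg]

theorem gcd3_swap' (p q r : ℤ) : gcd3 (-p) (-r) (-q) = gcd3 p q r := by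
  simp only [gcd3, Int.gcd_eq_natAbs, Int.natAbs_neg]
  rw [Nat.gcd_assoc, Nat.gcd_assoc, Nat.gcd_comm r.natAbs]

theorem tFactor_of_pos {x y z : ℤ × ℤ} (h : TPos x y z) (a b c : R) : tFactor x y z a b c =
    oneSub (tMon x y z a b c) ^ (gcd3 (det2 y z) (det2 z x) (det2 x y) : ℤ) :=
  if_pos h

theorem TPos.not_tNeg {x y z : ℤ × ℤ} (h : TPos x y z) : ¬ TNeg x y z :=
  fun h' => absurd h.1 (by have := h'.1; omega)

theorem tFactor_of_neg {x y z : ℤ × ℤ} (h : TNeg x y z) (a b c : R) : tFactor x y z a b c =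
    oneSub (tMon x y z a b c) ^ (-(gcd3 (det2 y z) (det2 z x) (det2 x y) : ℤ)) :=
  (if_neg fun h' => h'.not_tNeg h).trans (if_pos h)

theorem tFactor_of_not {x y z : ℤ × ℤ} (h : ¬ TPos x y z) (h' : ¬ TNeg x y z) (a b c : R) :
    tFactor x y z a b c = 1 :=
  (if_neg h).trans (if_neg h')

theorem sFactor_of {x y : ℤ × ℤ} (h : SCond x y) (a b : R) : sFactor x y a b =
    oneSub (sMon x y a b) ^ (-(y.2.sign * (Int.gcd x.2 y.2 : ℤ))) :=
  if_pos h

theorem sFactor_of_not {x y : ℤ × ℤ} (h : ¬ SCond x y) (a b : R) : sFactor x y a b = 1 :=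
  if_neg h

theorem qFactor_of {x y : ℤ × ℤ} (h : QCond x y) (a b : R) : qFactor x y a b =
    oneSub (qMon x y a b) ^ (y.1.sign * (Int.gcd x.1 y.1 : ℤ)) :=
  if_pos h

theorem qFactor_of_not {x y : ℤ × ℤ} (h : ¬ QCond x y) (a b : R) : qFactor x y a b = 1 :=
  if_neg h

/-- A transposition permutes the three determinants and changes their signs: the monomial and the
gcd are unaffected while the two sign cases are exchanged, and with them the sign of the exponent.
-/
theorem tFactor_swap12 (x y z : ℤ × ℤ) (a b c : R) :
    tFactor y x z b a c = (tFactor x y z a b c)⁻¹ := by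
  have hm : tMon y x z b a c = tMon x y z a b c := by
    unfold tMon
    simp only [det2_swap z x, det2_swap y z, det2_swap x y, gcd3_swap, Int.natAbs_neg]
    ring
  have h1 : TPos y x z ↔ TNeg x y z := by
    unfold TPos TNeg
    rw [det2_swap z x, det2_swap y z, det2_swap x y]
    constructor <;> rintro ⟨h1, h2, h3⟩ <;> refine ⟨?_, ?_, ?_⟩ <;> omega
  have h2 : TNeg y x z ↔ TPos x y z := by
    unfold TPos TNeg
    rw [det2_swap z x, det2_swap y z, det2_swap x y]
    constructor <;> rintro ⟨h1, h2, h3⟩ <;> refine ⟨?_, ?_, ?_⟩ <;> omega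
  have hd : gcd3 (det2 x z) (det2 z y) (det2 y x) = gcd3 (det2 y z) (det2 z x) (det2 x y) := by
    rw [det2_swap z x, det2_swap y z, det2_swap x y, gcd3_swap]
  by_cases h4 : TPos x y z
  · rw [tFactor_of_pos h4, tFactor_of_neg (h2.2 h4), hm, hd, zpow_neg]
  by_cases h5 : TNeg x y z
  · rw [tFactor_of_neg h5, tFactor_of_pos (h1.2 h5), hm, hd, zpow_neg, inv_inv]
  · rw [tFactor_of_not h4 h5, tFactor_of_not (mt h1.1 h5) (mt h2.1 h4), inv_one]

theorem tFactor_swap23 (x y z : ℤ × ℤ) (a b c : R) :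
    tFactor x z y a c b = (tFactor x y z a b c)⁻¹ := by
  have hm : tMon x z y a c b = tMon x y z a b c := by
    unfold tMon
    simp only [det2_swap z x, det2_swap y z, det2_swap x y, gcd3_swap', Int.natAbs_neg]
    ring
  have h1 : TPos x z y ↔ TNeg x y z := by
    unfold TPos TNeg
    rw [det2_swap z x, det2_swap y z, det2_swap x y]
    constructor <;> rintro ⟨h1, h2, h3⟩ <;> refine ⟨?_, ?_, ?_⟩ <;> omega
  have h2 : TNeg x z y ↔ TPos x y z := by
    unfold TPos TNeg
    rw [det2_swap z x, det2_swap y z, det2_swap x y]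
    constructor <;> rintro ⟨h1, h2, h3⟩ <;> refine ⟨?_, ?_, ?_⟩ <;> omega
  have hd : gcd3 (det2 z y) (det2 y x) (det2 x z) = gcd3 (det2 y z) (det2 z x) (det2 x y) := by
    rw [det2_swap z x, det2_swap y z, det2_swap x y, gcd3_swap']
  by_cases h4 : TPos x y z
  · rw [tFactor_of_pos h4, tFactor_of_neg (h2.2 h4), hm, hd, zpow_neg]
  by_cases h5 : TNeg x y z
  · rw [tFactor_of_neg h5, tFactor_of_pos (h1.2 h5), hm, hd, zpow_neg, inv_inv]
  · rw [tFactor_of_not h4 h5, tFactor_of_not (mt h1.1 h5) (mt h2.1 h4), inv_one]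

theorem sCond_comm (x y : ℤ × ℤ) : SCond y x ↔ SCond x y := by
  unfold SCond
  rw [det2_swap x y, neg_eq_zero, mul_comm y.2, mul_comm y.1]

/-- The monomial and the gcd are symmetric, whereas the second coordinates of `x` and `y` have
opposite signs. -/
theorem sFactor_swap (x y : ℤ × ℤ) (a b : R) : sFactor y x b a = (sFactor x y a b)⁻¹ := by
  by_cases h : SCond x y
  · rw [sFactor_of h, sFactor_of ((sCond_comm x y).2 h)]
    have hm : sMon y x b a = sMon x y a b := by
      unfold sMon; rw [Int.gcd_comm y.2]; ring
    have hs : x.2.sign = -y.2.sign := by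
      have := h.mul_neg
      rcases lt_or_gt_of_ne (left_ne_zero_of_mul h.2.2) with h1 | h1
      · rw [Int.sign_eq_neg_one_of_neg h1, Int.sign_eq_one_of_pos (by nlinarith)]
      · rw [Int.sign_eq_one_of_pos h1, Int.sign_eq_neg_one_of_neg (by nlinarith)]; rfl
    rw [hm, hs, Int.gcd_comm y.2, ← zpow_neg]
    congr 1
    ring
  · rw [sFactor_of_not h, sFactor_of_not (mt (sCond_comm x y).1 h), inv_one]

theorem qFactor_eq (x y : ℤ × ℤ) (a b : R) :
    qFactor x y a b = (sFactor x.swap y.swap a b)⁻¹ := by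
  by_cases h : QCond x y
  · rw [qFactor_of h, sFactor_of ((qCond_iff _ _).1 h), ← zpow_neg, neg_neg]; rfl
  · rw [qFactor_of_not h, sFactor_of_not (mt (qCond_iff _ _).2 h), inv_one]

theorem qFactor_swap (x y : ℤ × ℤ) (a b : R) : qFactor y x b a = (qFactor x y a b)⁻¹ := by
  rw [qFactor_eq, qFactor_eq, sFactor_swap]

/-- The product of the factors `T`. -/
def tProd (f g h : (DoubleLaurent R)ˣ) : Rˣ := ∏ᶠ w, tFamily f g h w

/-- The product of the factors `S`. -/
def sProd (f g : (DoubleLaurent R)ˣ) (n : ZConst R) : Rˣ := ∏ᶠ w, lpow (sFamily f g w) n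

/-- The product of the factors `Q`. -/
def qProd (f g : (DoubleLaurent R)ˣ) (n : ZConst R) : Rˣ := ∏ᶠ w, lpow (qFamily f g w) n

theorem explicitSymbol_eq (f g h : (DoubleLaurent R)ˣ) : explicitSymbol f g h =
    lpow (-1) (signExp f g h) *
    lpow (lead f) (nu g h) * lpow (lead g) (nu h f) * lpow (lead h) (nu f g) *
    tProd f g h * sProd f g (nu1 h) * qProd f g (nu2 h) * sProd h f (nu1 g) * qProd h f (nu2 g) *
    sProd g h (nu1 f) * qProd g h (nu2 f) := rfl

theorem tProd_swap12 (f g h : (DoubleLaurent R)ˣ) : tProd g f h = (tProd f g h)⁻¹ := by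
  unfold tProd
  rw [← finprod_inv_distrib]
  let e : Idx × Idx × Idx ≃ Idx × Idx × Idx :=
    ⟨fun w => (w.2.1, w.1, w.2.2), fun w => (w.2.1, w.1, w.2.2), fun _ => rfl, fun _ => rfl⟩
  rw [← finprod_comp_equiv e]
  exact finprod_congr fun w => tFactor_swap12 _ _ _ _ _ _

theorem tProd_swap23 (f g h : (DoubleLaurent R)ˣ) : tProd f h g = (tProd f g h)⁻¹ := by
  unfold tProd
  rw [← finprod_inv_distrib]
  let e : Idx × Idx × Idx ≃ Idx × Idx × Idx :=
    ⟨fun w => (w.1, w.2.2, w.2.1), fun w => (w.1, w.2.2, w.2.1), fun _ => rfl, fun _ => rfl⟩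
  rw [← finprod_comp_equiv e]
  exact finprod_congr fun w => tFactor_swap23 _ _ _ _ _ _

theorem sProd_swap (f g : (DoubleLaurent R)ˣ) (n : ZConst R) :
    sProd g f n = (sProd f g n)⁻¹ := by
  unfold sProd
  rw [← finprod_inv_distrib, ← finprod_comp_equiv (Equiv.prodComm Idx Idx)]
  refine finprod_congr fun w => ?_
  rw [← lpow_inv]
  exact congrArg (lpow · n) (sFactor_swap _ _ _ _)

theorem qProd_swap (f g : (DoubleLaurent R)ˣ) (n : ZConst R) :
    qProd g f n = (qProd f g n)⁻¹ := by
  unfold qProd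
  rw [← finprod_inv_distrib, ← finprod_comp_equiv (Equiv.prodComm Idx Idx)]
  refine finprod_congr fun w => ?_
  rw [← lpow_inv]
  exact congrArg (lpow · n) (qFactor_swap _ _ _ _)

theorem nu_swap (f g : (DoubleLaurent R)ˣ) : nu g f = -nu f g := by
  unfold nu; ring

/-- Only the parity of the exponent matters, and there `nu` is symmetric; the claim is a polynomial
identity over `ZMod 2`, decided by enumeration. -/
theorem signExp_swap12 (f g h : (DoubleLaurent R)ˣ) :
    lpow (-1 : Rˣ) (signExp g f h) = lpow (-1) (signExp f g h) := by
  refine lpow_neg_one_congr fun p => ?_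
  simp only [signExp, nu_swap f g, nu_swap f h, nu_swap g h, LocallyConstant.add_apply,
    LocallyConstant.mul_apply, LocallyConstant.neg_apply]
  push_cast
  generalize ((nu f g) p : ZMod 2) = a
  generalize ((nu f h) p : ZMod 2) = b
  generalize ((nu g h) p : ZMod 2) = c
  revert a b c
  decide

theorem signExp_swap23 (f g h : (DoubleLaurent R)ˣ) :
    lpow (-1 : Rˣ) (signExp f h g) = lpow (-1) (signExp f g h) := by
  refine lpow_neg_one_congr fun p => ?_
  simp only [signExp, nu_swap f g, nu_swap f h, nu_swap g h, LocallyConstant.add_apply,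
    LocallyConstant.mul_apply, LocallyConstant.neg_apply]
  push_cast
  generalize ((nu f g) p : ZMod 2) = a
  generalize ((nu f h) p : ZMod 2) = b
  generalize ((nu g h) p : ZMod 2) = c
  revert a b c
  decide

theorem explicitSymbol_swap12 (f g h : (DoubleLaurent R)ˣ) :
    explicitSymbol g f h = (explicitSymbol f g h)⁻¹ := by
  rw [explicitSymbol_eq, explicitSymbol_eq, signExp_swap12, tProd_swap12, nu_swap f h, nu_swap g h,
    nu_swap f g, sProd_swap f g, qProd_swap f g, sProd_swap g h, qProd_swap g h, sProd_swap h f,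
    qProd_swap h f]
  simp only [lpow_neg, mul_inv, lpow_neg_one_eq_inv, inv_inv]
  ac_rfl

theorem explicitSymbol_swap23 (f g h : (DoubleLaurent R)ˣ) :
    explicitSymbol f h g = (explicitSymbol f g h)⁻¹ := by
  rw [explicitSymbol_eq, explicitSymbol_eq, signExp_swap23, tProd_swap23, nu_swap f h, nu_swap g h,
    nu_swap f g, sProd_swap g h, qProd_swap g h, sProd_swap h f, qProd_swap h f, sProd_swap f g,
    qProd_swap f g]
  simp only [lpow_neg, mul_inv, lpow_neg_one_eq_inv, inv_inv]
  ac_rfl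

theorem isAntisymm_explicitSymbol : IsAntisymm (explicitSymbol (R := R)) where
  swap12 := explicitSymbol_swap12
  swap23 := explicitSymbol_swap23
  swap13 f g h := by
    rw [explicitSymbol_swap12, explicitSymbol_swap23, explicitSymbol_swap12, inv_inv]

/-! ### Functoriality -/

section Functoriality

variable {S : Type v} [CommRing S] (φ : R →+* S)

theorem isSplitting_map (hR : IsNilpotent (nilradical R)) (hS : IsNilpotent (nilradical S))
    (f : (DoubleLaurent R)ˣ) : IsSplitting (mapUnits φ f)
      ⟨mapLaurent (mapLaurent φ) (splitting f).neg, Units.map (φ : R →* S) (lead f),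
        comapZ φ (nu2 f), comapZ φ (nu1 f), mapLaurent (mapLaurent φ) (splitting f).pos⟩ := by
  have h := isSplitting_splitting hR f
  have hco : ∀ F : DoubleLaurent R, ∀ x, co (mapLaurent (mapLaurent φ) F - 1) x = φ (co (F - 1) x) :=
    fun F x => by rw [← co_mapLaurent, map_sub, map_one]
  refine ⟨?_, ?_, ?_⟩
  · have h1 := (mem_pSet hR).1 h.neg_mem
    rw [mem_pSet hS]
    refine ⟨fun x => ?_, fun x hx => ?_⟩
    · rw [hco]; exact (h1.1 x).map φ
    · rw [hco] at hx
      exact h1.2 x fun h0 => hx (by rw [h0, map_zero])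
  · refine mem_mSet.2 fun x hx => ?_
    rw [hco] at hx
    exact mem_mSet.1 h.pos_mem x fun h0 => hx (by rw [h0, map_zero])
  · change ((mapUnits φ f : (DoubleLaurent S)ˣ) : DoubleLaurent S) =
      mapLaurent (mapLaurent φ) (splitting f).neg * _ * mapLaurent (mapLaurent φ) (splitting f).pos
    rw [mapUnits_val, h.eq]
    dsimp only
    rw [← mapUnits_constUnit, ← mapUnits_uPow, ← mapUnits_tPow, ← map_mul (mapUnits φ),
      ← map_mul (mapUnits φ), mapUnits_val, map_mul, map_mul]
    rfl

theorem lead_map (hR : IsNilpotent (nilradical R)) (hS : IsNilpotent (nilradical S))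
    (f : (DoubleLaurent R)ˣ) : lead (mapUnits φ f) = Units.map (φ : R →* S) (lead f) :=
  congrArg Splitting.unit ((isSplitting_map φ hR hS f).splitting_eq hS)

theorem nu1_map (hR : IsNilpotent (nilradical R)) (hS : IsNilpotent (nilradical S))
    (f : (DoubleLaurent R)ˣ) : nu1 (mapUnits φ f) = comapZ φ (nu1 f) :=
  congrArg Splitting.n1 ((isSplitting_map φ hR hS f).splitting_eq hS)

theorem nu2_map (hR : IsNilpotent (nilradical R)) (hS : IsNilpotent (nilradical S))
    (f : (DoubleLaurent R)ˣ) : nu2 (mapUnits φ f) = comapZ φ (nu2 f) :=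
  congrArg Splitting.n2 ((isSplitting_map φ hR hS f).splitting_eq hS)

theorem nu_map (hR : IsNilpotent (nilradical R)) (hS : IsNilpotent (nilradical S))
    (f g : (DoubleLaurent R)ˣ) : nu (mapUnits φ f) (mapUnits φ g) = comapZ φ (nu f g) := by
  unfold nu
  rw [nu1_map φ hR hS, nu2_map φ hR hS, nu1_map φ hR hS, nu2_map φ hR hS]
  rfl

theorem signExp_map (hR : IsNilpotent (nilradical R)) (hS : IsNilpotent (nilradical S))
    (f g h : (DoubleLaurent R)ˣ) :
    signExp (mapUnits φ f) (mapUnits φ g) (mapUnits φ h) = comapZ φ (signExp f g h) := by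
  unfold signExp
  simp only [nu_map φ hR hS]
  rfl

theorem prodConverges_map {ι : Type} {e : ι → ℤ × ℤ} {a : ι → R} {F : DoubleLaurent R}
    (h : ProdConverges (fun x => 1 - mono (e x) (a x)) F) :
    ProdConverges (fun x => 1 - mono (e x) (φ (a x))) (mapLaurent (mapLaurent φ) F) := by
  intro N c
  obtain ⟨s₀, hs⟩ := h N c
  refine ⟨s₀, fun s hs' => mem_basicNhd.2 fun x hx hx' => ?_⟩
  have h1 := mem_basicNhd.1 (hs s hs') x hx hx'
  have h2 : ∏ x ∈ s, (1 - mono (e x) (φ (a x))) - mapLaurent (mapLaurent φ) F =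
      mapLaurent (mapLaurent φ) (∏ x ∈ s, (1 - mono (e x) (a x)) - F) := by
    rw [map_sub, map_prod]
    simp only [map_sub, map_one, mapLaurent_mono]
  rw [h2, co_mapLaurent, h1, map_zero]

/-- The image of the factor family satisfies the conditions characterizing the family of the image,
so uniqueness over `S` identifies them. No formula for the coefficients is needed. -/
theorem factorCoeff_map (hR : IsNilpotent (nilradical R)) (hS : IsNilpotent (nilradical S))
    (f : (DoubleLaurent R)ˣ) (x : Idx) :
    factorCoeff (mapUnits φ f) x = φ (factorCoeff f x) := by
  have hs := (isSplitting_map φ hR hS f).splitting_eq hS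
  have hf := isFactorFamily_factorCoeff hR f
  have h : IsFactorFamily (mapUnits φ f) fun x => φ (factorCoeff f x) := by
    refine ⟨?_, ?_, fun x hx => (hf.nilp x hx).map φ, ?_⟩
    · rw [hs]; exact prodConverges_map φ hf.pos
    · rw [hs]; exact prodConverges_map φ hf.neg
    · obtain ⟨n, m, hb⟩ := hf.bdd
      exact ⟨n, m, fun x hx hne => hb x hx fun h0 => hne (by rw [h0, map_zero])⟩
  rw [h.factorCoeff_eq hS]

theorem tFactor_map {x y z : Idx} {a b c : R} (ha : IsNeg x.1 → IsNilpotent a)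
    (hb : IsNeg y.1 → IsNilpotent b) (hc : IsNeg z.1 → IsNilpotent c) :
    tFactor x.1 y.1 z.1 (φ a) (φ b) (φ c) =
      Units.map (φ : R →* S) (tFactor x.1 y.1 z.1 a b c) := by
  have hm : tMon x.1 y.1 z.1 (φ a) (φ b) (φ c) = φ (tMon x.1 y.1 z.1 a b c) := by simp [tMon]
  unfold tFactor
  rw [hm]
  split_ifs with h1 h2
  · rw [map_zpow, map_oneSub φ (isNilpotent_tMon ha hb hc (Or.inl h1))]
  · rw [map_zpow, map_oneSub φ (isNilpotent_tMon ha hb hc (Or.inr h2))]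
  · rw [map_one]

theorem sFactor_map {x y : Idx} {a b : R} (ha : IsNeg x.1 → IsNilpotent a)
    (hb : IsNeg y.1 → IsNilpotent b) :
    sFactor x.1 y.1 (φ a) (φ b) = Units.map (φ : R →* S) (sFactor x.1 y.1 a b) := by
  have hm : sMon x.1 y.1 (φ a) (φ b) = φ (sMon x.1 y.1 a b) := by simp [sMon]
  unfold sFactor
  rw [hm]
  split_ifs with h
  · rw [map_zpow, map_oneSub φ (isNilpotent_sMon ha hb h)]
  · rw [map_one]

theorem qFactor_map {x y : Idx} {a b : R} (ha : IsNeg x.1 → IsNilpotent a)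
    (hb : IsNeg y.1 → IsNilpotent b) :
    qFactor x.1 y.1 (φ a) (φ b) = Units.map (φ : R →* S) (qFactor x.1 y.1 a b) := by
  have hm : qMon x.1 y.1 (φ a) (φ b) = φ (qMon x.1 y.1 a b) := by simp [qMon]
  unfold qFactor
  rw [hm]
  split_ifs with h
  · rw [map_zpow, map_oneSub φ (isNilpotent_qMon ha hb h)]
  · rw [map_one]

theorem tProd_map (hR : IsNilpotent (nilradical R)) (hS : IsNilpotent (nilradical S))
    (f g h : (DoubleLaurent R)ˣ) : tProd (mapUnits φ f) (mapUnits φ g) (mapUnits φ h) =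
      Units.map (φ : R →* S) (tProd f g h) := by
  unfold tProd
  rw [MonoidHom.map_finprod _ (tFamily_finite hR f g h)]
  refine finprod_congr fun w => ?_
  unfold tFamily
  rw [factorCoeff_map φ hR hS, factorCoeff_map φ hR hS, factorCoeff_map φ hR hS]
  exact tFactor_map φ ((isFactorFamily_factorCoeff hR f).nilp _)
    ((isFactorFamily_factorCoeff hR g).nilp _) ((isFactorFamily_factorCoeff hR h).nilp _)

/-- Finiteness of the family allows the locally constant exponent to be pulled out of the product.
-/
theorem sProd_eq (hR : IsNilpotent (nilradical R)) (f g : (DoubleLaurent R)ˣ) (n : ZConst R) :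
    sProd f g n = lpow (∏ᶠ w, sFamily f g w) n :=
  ((lpowHom n).map_finprod (sFamily_finite hR f g)).symm

theorem qProd_eq (hR : IsNilpotent (nilradical R)) (f g : (DoubleLaurent R)ˣ) (n : ZConst R) :
    qProd f g n = lpow (∏ᶠ w, qFamily f g w) n :=
  ((lpowHom n).map_finprod (qFamily_finite hR f g)).symm

theorem sProd_map (hR : IsNilpotent (nilradical R)) (hS : IsNilpotent (nilradical S))
    (f g : (DoubleLaurent R)ˣ) (n : ZConst R) : sProd (mapUnits φ f) (mapUnits φ g) (comapZ φ n) =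
      Units.map (φ : R →* S) (sProd f g n) := by
  rw [sProd_eq hR, sProd_eq hS, map_lpow, MonoidHom.map_finprod _ (sFamily_finite hR f g)]
  refine congrArg (lpow · _) (finprod_congr fun w => ?_)
  unfold sFamily
  rw [factorCoeff_map φ hR hS, factorCoeff_map φ hR hS]
  exact sFactor_map φ ((isFactorFamily_factorCoeff hR f).nilp _)
    ((isFactorFamily_factorCoeff hR g).nilp _)

theorem qProd_map (hR : IsNilpotent (nilradical R)) (hS : IsNilpotent (nilradical S))
    (f g : (DoubleLaurent R)ˣ) (n : ZConst R) : qProd (mapUnits φ f) (mapUnits φ g) (comapZ φ n) =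
      Units.map (φ : R →* S) (qProd f g n) := by
  rw [qProd_eq hR, qProd_eq hS, map_lpow, MonoidHom.map_finprod _ (qFamily_finite hR f g)]
  refine congrArg (lpow · _) (finprod_congr fun w => ?_)
  unfold qFamily
  rw [factorCoeff_map φ hR hS, factorCoeff_map φ hR hS]
  exact qFactor_map φ ((isFactorFamily_factorCoeff hR f).nilp _)
    ((isFactorFamily_factorCoeff hR g).nilp _)

theorem explicitSymbol_map (hR : IsNilpotent (nilradical R)) (hS : IsNilpotent (nilradical S))
    (f g h : (DoubleLaurent R)ˣ) :
    explicitSymbol (mapUnits φ f) (mapUnits φ g) (mapUnits φ h) =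
      Units.map (φ : R →* S) (explicitSymbol f g h) := by
  rw [explicitSymbol_eq, explicitSymbol_eq]
  simp only [map_mul, map_lpow, signExp_map φ hR hS, lead_map φ hR hS, nu_map φ hR hS,
    tProd_map φ hR hS, nu1_map φ hR hS, nu2_map φ hR hS, sProd_map φ hR hS, qProd_map φ hR hS]
  congr
  exact Units.ext (by simp)

end Functoriality

end

/-! ### Euler derivations and logarithms over `ℚ`-algebras -/

section

variable {R : Type u} [CommRing R]

/-! ### Euler derivations -/

theorem exists_eulerD (ℓ : ℤ × ℤ →+ ℤ) (f : DoubleLaurent R) :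
    ∃ g : DoubleLaurent R, ∀ x, co g x = (ℓ x : R) * co f x := by
  obtain ⟨n, β, h⟩ := co_bdd f
  exact exists_of_bdd _ n β fun x hx => h x (right_ne_zero_of_mul hx)

/-- The derivation of `R((u))((t))` that multiplies a monomial with exponent `x` by `ℓ x`. -/
def eulerD (ℓ : ℤ × ℤ →+ ℤ) : DoubleLaurent R →+ DoubleLaurent R where
  toFun f := (exists_eulerD ℓ f).choose
  map_zero' := ext_co fun x => by rw [(exists_eulerD ℓ 0).choose_spec, co_zero, mul_zero]
  map_add' f g := ext_co fun x => by
    rw [(exists_eulerD ℓ (f + g)).choose_spec, co_add, co_add, (exists_eulerD ℓ f).choose_spec,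
      (exists_eulerD ℓ g).choose_spec, mul_add]

theorem co_eulerD (ℓ : ℤ × ℤ →+ ℤ) (f : DoubleLaurent R) (x : ℤ × ℤ) :
    co (eulerD ℓ f) x = (ℓ x : R) * co f x :=
  (exists_eulerD ℓ f).choose_spec x

theorem eulerD_mul (ℓ : ℤ × ℤ →+ ℤ) (f g : DoubleLaurent R) :
    eulerD ℓ (f * g) = eulerD ℓ f * g + f * eulerD ℓ g := by
  refine ext_co fun z => ?_
  have hT : ∀ p, co f p ≠ 0 → co g (z - p) ≠ 0 → p ∈ (finite_co_mul f g z).toFinset :=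
    fun p h1 h2 => by simpa using ⟨h1, h2⟩
  rw [co_eulerD, co_add, co_mul_of_subset f g z _ hT,
    co_mul_of_subset (eulerD ℓ f) g z _ fun p h1 h2 => hT p
      (by rw [co_eulerD] at h1; exact right_ne_zero_of_mul h1) h2,
    co_mul_of_subset f (eulerD ℓ g) z _ fun p h1 h2 => hT p h1
      (by rw [co_eulerD] at h2; exact right_ne_zero_of_mul h2), Finset.mul_sum,
    ← Finset.sum_add_distrib]
  refine Finset.sum_congr rfl fun p _ => ?_
  rw [co_eulerD, co_eulerD, map_sub]
  push_cast
  ring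

theorem eulerD_constHom_mul (ℓ : ℤ × ℤ →+ ℤ) (a : R) (f : DoubleLaurent R) :
    eulerD ℓ (constHom R a * f) = constHom R a * eulerD ℓ f :=
  ext_co fun x => by rw [co_eulerD, constHom_co, constHom_co, co_eulerD]; ring

theorem eulerD_one (ℓ : ℤ × ℤ →+ ℤ) : eulerD ℓ (1 : DoubleLaurent R) = 0 :=
  ext_co fun x => by
    rw [co_eulerD, co_one, co_zero]
    split_ifs with h
    · rw [h, map_zero, Int.cast_zero, zero_mul]
    · rw [mul_zero]

theorem eulerD_constHom (ℓ : ℤ × ℤ →+ ℤ) (a : R) : eulerD ℓ (constHom R a) = 0 := by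
  rw [← mul_one (constHom R a), eulerD_constHom_mul, eulerD_one, mul_zero]

theorem eulerD_mono (ℓ : ℤ × ℤ →+ ℤ) (x : ℤ × ℤ) (a : R) :
    eulerD ℓ (mono x a) = constHom R (ℓ x : R) * mono x a :=
  ext_co fun y => by
    rw [co_eulerD, constHom_co, co_mono]
    split_ifs with h
    · rw [h]
    · rw [mul_zero, mul_zero]

theorem eulerD_pow_succ (ℓ : ℤ × ℤ →+ ℤ) (f : DoubleLaurent R) (n : ℕ) :
    eulerD ℓ (f ^ (n + 1)) = constHom R ((n : R) + 1) * (f ^ n * eulerD ℓ f) := by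
  induction n with
  | zero => simp
  | succ n ih =>
    rw [pow_succ, eulerD_mul, ih]
    push_cast
    rw [map_add, map_add, map_add, map_one]
    ring

theorem eulerD_mem_coeffSub (ℓ : ℤ × ℤ →+ ℤ) {w : ℤ × ℤ → Ideal R} {f : DoubleLaurent R}
    (hf : f ∈ coeffSub w) : eulerD ℓ f ∈ coeffSub w :=
  mem_coeffSub.2 fun x => by
    rw [co_eulerD]; exact Ideal.mul_mem_left _ _ (mem_coeffSub.1 hf x)

theorem constHom_mul_mem_coeffSub (a : R) {w : ℤ × ℤ → Ideal R} {f : DoubleLaurent R}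
    (hf : f ∈ coeffSub w) : constHom R a * f ∈ coeffSub w :=
  mem_coeffSub.2 fun x => by
    rw [constHom_co]; exact Ideal.mul_mem_left _ _ (mem_coeffSub.1 hf x)

theorem pow_mem_pSet (hR : IsNilpotent (nilradical R)) {f : DoubleLaurent R} (hf : f ∈ pSet R)
    (n : ℕ) : f ^ (n + 1) ∈ pSet R := by
  induction n with
  | zero => simpa using hf
  | succ n ih => rw [pow_succ]; exact mul_mem_pSet hR ih hf

theorem co_zero_of_mem_pSet {f : DoubleLaurent R} (hf : f ∈ pSet R) : co f 0 = 0 := by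
  by_contra h
  exact (hf.2 0 0 h).ne_zero rfl

/-- `L` has constant coefficient `0` and the logarithmic derivatives of `F` as derivatives. -/
structure IsLog (F L : DoubleLaurent R) : Prop where
  co_zero : co L 0 = 0
  eulerD_mul : ∀ ℓ, eulerD ℓ L * F = eulerD ℓ F

theorem IsLog.mul {F G L M : DoubleLaurent R} (h : IsLog F L) (h' : IsLog G M) :
    IsLog (F * G) (L + M) where
  co_zero := by rw [co_add, h.co_zero, h'.co_zero, add_zero]
  eulerD_mul ℓ := by
    rw [ContouCarrere.eulerD_mul, ← h.eulerD_mul, ← h'.eulerD_mul, map_add]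
    ring

theorem isLog_one : IsLog (1 : DoubleLaurent R) 0 where
  co_zero := ContouCarrere.co_zero 0
  eulerD_mul ℓ := by rw [eulerD_one, map_zero, zero_mul]

theorem IsLog.prod {ι : Type*} (s : Finset ι) {F L : ι → DoubleLaurent R}
    (h : ∀ i ∈ s, IsLog (F i) (L i)) : IsLog (∏ i ∈ s, F i) (∑ i ∈ s, L i) := by
  classical
  induction s using Finset.induction_on with
  | empty => exact isLog_one
  | insert i s hi ih =>
    rw [Finset.prod_insert hi, Finset.sum_insert hi]
    exact (h i (Finset.mem_insert_self i s)).mul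
      (ih fun j hj => h j (Finset.mem_insert_of_mem hj))

variable [Algebra ℚ R]

theorem eq_zero_of_intCast_mul {k : ℤ} (hk : k ≠ 0) {a : R} (h : (k : R) * a = 0) : a = 0 := by
  have h1 : (algebraMap ℚ R (k : ℚ)⁻¹) * (k : R) = 1 := by
    rw [← map_intCast (algebraMap ℚ R), ← map_mul, inv_mul_cancel₀ (by exact_mod_cast hk), map_one]
  calc a = (algebraMap ℚ R (k : ℚ)⁻¹) * (k : R) * a := by rw [h1, one_mul]
    _ = 0 := by rw [mul_assoc, h, mul_zero]

/-- The difference is killed by all Euler derivations. At `x ≠ 0` one of the coordinate derivations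
multiplies the coefficient by a nonzero integer, invertible in a `ℚ`-algebra; the constant
coefficient vanishes by normalization. -/
theorem IsLog.unique {F L L' : DoubleLaurent R} (hF : IsUnit F) (h : IsLog F L)
    (h' : IsLog F L') : L = L' := by
  have hD : ∀ ℓ, eulerD ℓ (L - L') = 0 := fun ℓ => by
    refine hF.mul_left_injective ?_
    change eulerD ℓ (L - L') * F = 0 * F
    rw [map_sub, sub_mul, h.eulerD_mul, h'.eulerD_mul, sub_self, zero_mul]
  have hco : ∀ x : ℤ × ℤ, ∀ ℓ : ℤ × ℤ →+ ℤ, ℓ x ≠ 0 → co (L - L') x = 0 := fun x ℓ hx =>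
    eq_zero_of_intCast_mul hx (by rw [← co_eulerD, hD, ContouCarrere.co_zero])
  refine sub_eq_zero.1 (ext_co fun x => ?_)
  rw [ContouCarrere.co_zero]
  by_cases h1 : x.1 = 0
  · by_cases h2 : x.2 = 0
    · rw [show x = 0 from Prod.ext h1 h2, co_sub, h.co_zero, h'.co_zero, sub_zero]
    · exact hco x (AddMonoidHom.snd ℤ ℤ) h2
  · exact hco x (AddMonoidHom.fst ℤ ℤ) h1

/-! ### The logarithmic series -/

/-- The coefficient `(-1) ^ n / (n + 1)` of the logarithmic series. -/
def logCoeff (R : Type u) [CommRing R] [Algebra ℚ R] (n : ℕ) : R :=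
  algebraMap ℚ R ((-1 : ℚ) ^ n / (n + 1))

theorem logCoeff_mul (n : ℕ) : logCoeff R n * ((n : R) + 1) = (-1) ^ n := by
  have h : ((n : R) + 1) = algebraMap ℚ R (n + 1) := by simp
  rw [logCoeff, h, ← map_mul, div_mul_cancel₀ _ (by positivity)]
  simp

/-- The truncations of the series `log (1 + x)`. -/
def logTrunc (x : DoubleLaurent R) (M : ℕ) : DoubleLaurent R :=
  ∑ n ∈ Finset.range M, constHom R (logCoeff R n) * x ^ (n + 1)

/-- The derivative of the truncated logarithm is a finite geometric sum times the derivative of `x`;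
multiplication by `1 + x` telescopes and leaves one error term. -/
theorem eulerD_logTrunc (ℓ : ℤ × ℤ →+ ℤ) (x : DoubleLaurent R) (M : ℕ) :
    eulerD ℓ (logTrunc x M) * (1 + x) - eulerD ℓ (1 + x) = -((-x) ^ M * eulerD ℓ x) := by
  have h : eulerD ℓ (logTrunc x M) = (∑ n ∈ Finset.range M, (-x) ^ n) * eulerD ℓ x := by
    rw [logTrunc, map_sum, Finset.sum_mul]
    refine Finset.sum_congr rfl fun n _ => ?_
    rw [eulerD_constHom_mul, eulerD_pow_succ, ← mul_assoc, ← map_mul, logCoeff_mul, map_pow,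
      map_neg, map_one, ← mul_assoc]
    exact congrArg (· * eulerD ℓ x) (neg_pow x n).symm
  have hg := geom_sum_mul (-x) M
  rw [h, map_add, eulerD_one]
  linear_combination (-eulerD ℓ x) * hg

/-- `logSeries` selects a series with prescribed coefficients if there is one. Here a candidate `L`
to which the truncations stabilize at each exponent is shown to be that series. -/
theorem logSeries_eq {F L : DoubleLaurent R}
    (h : ∀ z, ∃ M, co L z = co (logTrunc (F - 1) M) z ∧ ∀ n ≥ M, co ((F - 1) ^ (n + 1)) z = 0) :
    logSeries F = L ∧
      ∀ z, co L z = ∑ᶠ n : ℕ, logCoeff R n * co ((F - 1) ^ (n + 1)) z := by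
  have h1 : ∀ z, co L z = ∑ᶠ n : ℕ, logCoeff R n * co ((F - 1) ^ (n + 1)) z := fun z => by
    obtain ⟨M, hM, hM'⟩ := h z
    rw [hM, logTrunc, co_sum, finsum_eq_sum_of_support_subset (s := Finset.range M)]
    · simp only [constHom_co]
    · intro n hn
      by_contra hn'
      exact hn (by simp only; rw [hM' n (by simpa using hn'), mul_zero])
  have h2 : ∀ i j, cf L i j = ∑ᶠ n : ℕ, ((-1 : ℚ) ^ n / (n + 1)) • cf ((F - 1) ^ (n + 1)) i j :=
    fun i j => by
      rw [cf_eq_co, h1]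
      simp only [Algebra.smul_def]
      rfl
  refine ⟨?_, h1⟩
  have hex : ∃ f : DoubleLaurent R, ∀ i j, cf f i j =
      ∑ᶠ n : ℕ, ((-1 : ℚ) ^ n / (n + 1)) • cf ((F - 1) ^ (n + 1)) i j := ⟨L, h2⟩
  rw [logSeries, ofCoeffs, dif_pos hex]
  exact ext_co fun x => (hex.choose_spec x.1 x.2).trans (h2 x.1 x.2).symm

/-- The terms of the logarithmic series have growing weight at every level, so the truncations
converge; the error term of `eulerD_logTrunc` has weight at least `n` for every `n` and disappears
in the limit. -/
theorem exists_log_pos {F : DoubleLaurent R} (hF : F - 1 ∈ mSet R) :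
    ∃ L, IsLog F L ∧ ∀ z, ∃ M, co L z = co (logTrunc (F - 1) M) z ∧
      ∀ n ≥ M, co ((F - 1) ^ (n + 1)) z = 0 := by
  obtain ⟨W, hW⟩ := exists_weight_of_mem_mSet hF
  have hterm : ∀ I n, constHom R (logCoeff R n) * (F - 1) ^ (n + 1) ∈ posFil R I (W I) (n + 1) :=
    fun I n => constHom_mul_mem_coeffSub _ (pow_mem_posFil (hW I) _)
  obtain ⟨L, hL⟩ := exists_limit (W := W) (logTrunc (F - 1))
    (fun I => by rw [logTrunc, Finset.sum_range_zero]; exact AddSubgroup.zero_mem _)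
    (fun I n => by
      rw [logTrunc, logTrunc, Finset.sum_range_succ, add_sub_cancel_left]
      exact posFil_antitone _ _ n.le_succ (hterm I n))
  have hz : ∀ (I : ℤ) (n : ℕ) (f : DoubleLaurent R) (z : ℤ × ℤ), f ∈ posFil R I (W I) n →
      z.1 ≤ I → z.2 + W I * z.1 < n → co f z = 0 := fun I n f z hf h1 h2 => by
    by_contra hne
    have := (mem_posFil.1 hf z hne).2 h1
    omega
  refine ⟨L, ⟨?_, fun ℓ => ?_⟩, fun z => ?_⟩
  · refine hz 0 1 L 0 ?_ le_rfl (by simp)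
    have h1 := hL 0 1
    have h2 : logTrunc (F - 1) 1 ∈ posFil R 0 (W 0) 1 := by
      rw [logTrunc, Finset.sum_range_one]
      exact hterm 0 0
    simpa using AddSubgroup.add_mem _ h1 h2
  · refine sub_eq_zero.1 (eq_zero_of_mem_posFil (W := W) fun I n => ?_)
    have hfil := isMulFiltration_posFil (R := R) I (W I)
    have hF0 : F ∈ posFil R I (W I) 0 := by
      simpa using AddSubgroup.add_mem _ (hfil.mem_zero (hW I)) hfil.one_mem
    have h1 := eulerD_logTrunc ℓ (F - 1) n
    have h2 : eulerD ℓ L * F - eulerD ℓ F = eulerD ℓ (L - logTrunc (F - 1) n) * F +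
        -((-(F - 1)) ^ n * eulerD ℓ (F - 1)) := by
      rw [add_sub_cancel] at h1
      rw [← h1, map_sub]
      ring
    rw [h2]
    refine AddSubgroup.add_mem _ (hfil.mul_mem_right (eulerD_mem_coeffSub ℓ (hL I n)) hF0)
      (AddSubgroup.neg_mem _ (hfil.mul_mem_right ?_ (hfil.mem_zero
        (eulerD_mem_coeffSub ℓ (hW I)))))
    exact pow_mem_posFil (AddSubgroup.neg_mem _ (hW I)) n
  · set M : ℕ := (z.2 + W z.1 * z.1).toNat + 1 with hM
    have hlt : z.2 + W z.1 * z.1 < (M : ℤ) := by omega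
    refine ⟨M, ?_, fun n hn => hz z.1 (n + 1) _ z (pow_mem_posFil (hW _) _) le_rfl ?_⟩
    · rw [← sub_eq_zero, ← co_sub]
      exact hz z.1 M _ z (hL _ _) le_rfl hlt
    · push_cast
      omega

theorem exists_log_neg (hR : IsNilpotent (nilradical R)) {F : DoubleLaurent R}
    (hF : F - 1 ∈ pSet R) :
    ∃ L, IsLog F L ∧ ∀ z, ∃ M, co L z = co (logTrunc (F - 1) M) z ∧
      ∀ n ≥ M, co ((F - 1) ^ (n + 1)) z = 0 := by
  obtain ⟨K, hK⟩ := hF.1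
  refine ⟨logTrunc (F - 1) K, ⟨?_, fun ℓ => ?_⟩, fun z => ⟨K, rfl, fun n hn => ?_⟩⟩
  · rw [logTrunc, co_sum]
    exact Finset.sum_eq_zero fun n _ => by
      rw [constHom_co, co_zero_of_mem_pSet (pow_mem_pSet hR hF n), mul_zero]
  · have h1 := eulerD_logTrunc ℓ (F - 1) K
    have h2 : (-(F - 1)) ^ K = 0 := (neg_pow (F - 1) K).trans (by rw [hK, mul_zero])
    rw [h2, zero_mul, neg_zero, add_sub_cancel] at h1
    exact sub_eq_zero.1 h1
  · rw [pow_eq_zero_of_le (by omega) hK, co_zero]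

theorem isLog_logSeries_pos {F : DoubleLaurent R} (hF : F - 1 ∈ mSet R) :
    IsLog F (logSeries F) ∧ ∀ z, co (logSeries F) z =
      ∑ᶠ n : ℕ, logCoeff R n * co ((F - 1) ^ (n + 1)) z := by
  obtain ⟨L, hL, h⟩ := exists_log_pos hF
  obtain ⟨h1, h2⟩ := logSeries_eq h
  rw [h1]
  exact ⟨hL, h2⟩

theorem isLog_logSeries_neg (hR : IsNilpotent (nilradical R)) {F : DoubleLaurent R}
    (hF : F - 1 ∈ pSet R) :
    IsLog F (logSeries F) ∧ ∀ z, co (logSeries F) z =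
      ∑ᶠ n : ℕ, logCoeff R n * co ((F - 1) ^ (n + 1)) z := by
  obtain ⟨L, hL, h⟩ := exists_log_neg hR hF
  obtain ⟨h1, h2⟩ := logSeries_eq h
  rw [h1]
  exact ⟨hL, h2⟩

end

/-! ### Logarithms of infinite products -/

section

variable {R : Type u} [CommRing R]

/-! ### Logarithms of product decompositions -/

theorem isUnit_of_sub_one_mem (hR : IsNilpotent (nilradical R)) {F G : DoubleLaurent R}
    (hF : F - 1 ∈ pSet R) (hG : G - 1 ∈ mSet R) : IsUnit (F * G) := by
  obtain ⟨F', h, -⟩ := exists_inv_of_sub_one_mem_pSet hR hF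
  obtain ⟨G', h', -⟩ := exists_inv_of_sub_one_mem_mSet hG
  exact (IsUnit.of_mul_eq_one _ h).mul (IsUnit.of_mul_eq_one _ h')

theorem finsum_mem_ideal {ι : Type*} (I : Ideal R) {f : ι → R} (h : ∀ i, f i ∈ I) :
    ∑ᶠ i, f i ∈ I :=
  finsum_induction (· ∈ I) I.zero_mem (fun _ _ => I.add_mem) h

theorem mono_zero_mem (x : ℤ × ℤ) (G : AddSubgroup (DoubleLaurent R)) : mono x (0 : R) ∈ G := by
  rw [mono_zero_right]; exact G.zero_mem

variable [Algebra ℚ R]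

/-- `1 / (n + 1)`. -/
def invSucc (R : Type u) [CommRing R] [Algebra ℚ R] (n : ℕ) : R := algebraMap ℚ R (1 / (n + 1))

theorem invSucc_mul (n : ℕ) : invSucc R n * ((n : R) + 1) = 1 := by
  have h : ((n : R) + 1) = algebraMap ℚ R (n + 1) := by simp
  rw [invSucc, h, ← map_mul, div_mul_cancel₀ _ (by positivity), map_one]

theorem logCoeff_mul_neg_one_pow (n : ℕ) : logCoeff R n * (-1) ^ (n + 1) = -invSucc R n := by
  have h : ((-1 : R)) ^ (n + 1) = algebraMap ℚ R ((-1) ^ (n + 1)) := by simp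
  rw [logCoeff, invSucc, h, ← map_mul, ← map_neg]
  congr 1
  rw [div_mul_eq_mul_div, ← pow_add, show n + (n + 1) = 2 * n + 1 by ring, pow_succ, pow_mul]
  simp [neg_div]

open Classical in
/-- The contribution at the exponent `z` of the power `p.2 + 1` of the member `p.1` of the
family `a` to `-log ∏ (1 - a x * u ^ x.2 * t ^ x.1)`. -/
def logTerm (a : Idx → R) (z : ℤ × ℤ) (p : Idx × ℕ) : R :=
  if pex p = z then invSucc R p.2 * a p.1 ^ (p.2 + 1) else 0

theorem logTerm_support_finite (a : Idx → R) (z : ℤ × ℤ) :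
    (Function.support (logTerm a z)).Finite :=
  (finite_pex_fiber z).subset fun p hp => by
    by_contra h
    exact hp (if_neg h)

theorem co_logSeries_one_sub_mono {x : Idx} {a : Idx → R}
    (h : ∀ z, co (logSeries (1 - mono x.1 (a x))) z =
      ∑ᶠ n : ℕ, logCoeff R n * co ((1 - mono x.1 (a x) - 1) ^ (n + 1)) z) (z : ℤ × ℤ) :
    co (logSeries (1 - mono x.1 (a x))) z = -∑ᶠ n : ℕ, logTerm a z (x, n) := by
  rw [h, ← finsum_neg_distrib]
  refine finsum_congr fun n => ?_
  have h1 : (1 - mono x.1 (a x) - 1) ^ (n + 1) =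
      mono ((n + 1) • x.1) ((-1) ^ (n + 1) * a x ^ (n + 1)) := by
    have h2 : 1 - mono x.1 (a x) - 1 = mono x.1 (-a x) :=
      ext_co fun y => by
        rw [co_sub, co_sub, co_mono, co_mono]
        split_ifs <;> ring
    rw [h2, mono_pow, neg_pow]
  rw [h1, co_mono, logTerm]
  by_cases hz : pex (x, n) = z
  · rw [if_pos hz, if_pos (show z = (n + 1) • x.1 from hz.symm), ← mul_assoc, logCoeff_mul_neg_one_pow, neg_mul]
  · rw [if_neg hz, if_neg (show ¬ z = (n + 1) • x.1 from fun h => hz h.symm), mul_zero, neg_zero]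

theorem isLog_one_sub_mono (hR : IsNilpotent (nilradical R)) {a : Idx → R} (x : Idx)
    (ha : IsNeg x.1 → IsNilpotent (a x)) :
    IsLog (1 - mono x.1 (a x)) (logSeries (1 - mono x.1 (a x))) ∧
      ∀ z, co (logSeries (1 - mono x.1 (a x))) z = -∑ᶠ n : ℕ, logTerm a z (x, n) := by
  have hco : ∀ y, co (1 - mono x.1 (a x) - 1) y ≠ 0 → y = x.1 := fun y hy => by
    by_contra h
    rw [co_sub, co_sub, co_mono, if_neg h] at hy
    simp at hy
  rcases isPos_or_isNeg x.2 with hx | hx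
  · have h := isLog_logSeries_pos (F := 1 - mono x.1 (a x))
      (mem_mSet.2 fun y hy => (hco y hy).symm ▸ hx)
    exact ⟨h.1, co_logSeries_one_sub_mono h.2⟩
  · have h := isLog_logSeries_neg hR (F := 1 - mono x.1 (a x))
      ((mem_pSet hR).2 ⟨fun y => by
        rw [co_sub, co_sub, co_mono]
        split_ifs
        · simpa using (ha hx).neg
        · simp, fun y hy => (hco y hy).symm ▸ hx⟩)
    exact ⟨h.1, co_logSeries_one_sub_mono h.2⟩

theorem logTerm_mem {w : ℕ → ℤ × ℤ → Ideal R} (hw : IsMulFiltration fun n => coeffSub (w n))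
    {a : Idx → R} {n : ℕ} {x : Idx} (hx : mono x.1 (a x) ∈ coeffSub (w n))
    (hx1 : mono x.1 (a x) ∈ coeffSub (w 0)) (z : ℤ × ℤ)
    (k : ℕ) : logTerm a z (x, k) ∈ w n z := by
  rw [logTerm]
  split_ifs with h
  · refine Ideal.mul_mem_left _ _ ?_
    have hp : mono x.1 (a x) ^ (k + 1) ∈ coeffSub (w n) := by
      induction k generalizing z with
      | zero => simpa using hx
      | succ k ih =>
        rw [pow_succ]
        exact hw.mul_mem_right (ih _ rfl) hx1
    have h1 := mem_coeffSub.1 hp z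
    rw [mono_pow, co_mono, if_pos] at h1
    · exact h1
    · exact h.symm
  · exact Ideal.zero_mem _

/-- Compare `F` with a finite product `P`, whose logarithm `Ls` is a finite sum. Modulo order `n`
both `P - F` and `L - Ls` vanish, so the logarithmic differential equation passes from `(P, Ls)` to
`(F, L)`. The statement is uniform in the filtration, to serve positive and negative exponents
alike. -/
theorem isLog_mod {w : ℕ → ℤ × ℤ → Ideal R} (hw : IsMulFiltration fun n => coeffSub (w n))
    {a : Idx → R} (hlog : ∀ x : Idx, IsLog (1 - mono x.1 (a x)) (logSeries (1 - mono x.1 (a x))) ∧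
      ∀ z, co (logSeries (1 - mono x.1 (a x))) z = -∑ᶠ n : ℕ, logTerm a z (x, n))
    {F L : DoubleLaurent R} (hL : ∀ z, co L z = -∑ᶠ p, logTerm a z p)
    (h1 : ∀ x : Idx, mono x.1 (a x) ∈ coeffSub (w 1)) {n : ℕ} (s : Finset Idx)
    (hs : ∀ x ∉ s, mono x.1 (a x) ∈ coeffSub (w n))
    (hF : ∏ x ∈ s, (1 - mono x.1 (a x)) - F ∈ coeffSub (w n)) (ℓ : ℤ × ℤ →+ ℤ) :
    eulerD ℓ L * F - eulerD ℓ F ∈ coeffSub (w n) := by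
  classical
  have h0 : ∀ x : Idx, mono x.1 (a x) ∈ coeffSub (w 0) := fun x => hw.mem_zero (h1 x)
  set P := ∏ x ∈ s, (1 - mono x.1 (a x)) with hP
  set Ls := ∑ x ∈ s, logSeries (1 - mono x.1 (a x)) with hLs
  have hlogs : IsLog P Ls := IsLog.prod s fun x _ => (hlog x).1
  have hP0 : P ∈ coeffSub (w 0) := hw.prod_one_sub_mem s _ fun x _ => h0 x
  have hF0 : F ∈ coeffSub (w 0) := by
    have := AddSubgroup.sub_mem _ hP0 (hw.mem_zero hF)
    rwa [sub_sub_cancel] at this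
  have hLs0 : Ls ∈ coeffSub (w 0) := AddSubgroup.sum_mem _ fun x _ => mem_coeffSub.2 fun z => by
    rw [(hlog x).2]
    exact neg_mem (finsum_mem_ideal _ fun k => logTerm_mem hw (h0 x) (h0 x) z k)
  have hdiff : L - Ls ∈ coeffSub (w n) := mem_coeffSub.2 fun z => by
    have h2 : co Ls z = -∑ᶠ p : Idx × ℕ, if p.1 ∈ s then logTerm a z p else 0 := by
      rw [finsum_curry, hLs, co_sum, Finset.sum_congr rfl fun x _ => (hlog x).2 z,
        Finset.sum_neg_distrib, finsum_eq_sum_of_support_subset (s := s)]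
      · exact congrArg _ (Finset.sum_congr rfl fun x hx => finsum_congr fun k => by
          rw [if_pos hx])
      · intro x hx
        by_contra hxs
        refine hx ?_
        exact (finsum_congr fun k => if_neg hxs).trans finsum_zero
      · refine (logTerm_support_finite a z).subset fun p hp h => hp ?_
        simp only
        split_ifs
        · exact h
        · rfl
    rw [co_sub, hL, h2, neg_sub_neg, ← finsum_sub_distrib]
    · refine finsum_mem_ideal _ fun p => ?_
      split_ifs with hp
      · rw [sub_self]; exact Ideal.zero_mem _
      · rw [zero_sub]
        exact neg_mem (logTerm_mem hw (hs _ hp) (h0 _) z p.2)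
    · refine (logTerm_support_finite a z).subset fun p hp h => hp ?_
      simp only
      split_ifs
      · exact h
      · rfl
    · exact logTerm_support_finite a z
  have hdec : eulerD ℓ L * F - eulerD ℓ F = eulerD ℓ (L - Ls) * F - eulerD ℓ Ls * (P - F) +
      eulerD ℓ (P - F) := by
    rw [map_sub, map_sub, ← hlogs.eulerD_mul]
    ring
  rw [hdec]
  exact AddSubgroup.add_mem _ (AddSubgroup.sub_mem _
    (hw.mul_mem_right (eulerD_mem_coeffSub ℓ hdiff) hF0)
    (hw.mul_mem_left (eulerD_mem_coeffSub ℓ hLs0) hF)) (eulerD_mem_coeffSub ℓ hF)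

theorem co_zero_of_logTerm {a : Idx → R} {L : DoubleLaurent R}
    (hL : ∀ z, co L z = -∑ᶠ p, logTerm a z p) : co L 0 = 0 := by
  rw [hL, neg_eq_zero]
  refine (finsum_congr fun p => if_neg fun h => ?_).trans finsum_zero
  have h1 : (p.2 + 1 : ℕ) • p.1.1 = 0 := h
  exact p.1.2 ((smul_eq_zero.1 h1).resolve_left (Nat.succ_ne_zero _))

-- `isLog_mod` is applied in every order `n` and at every level. The finite set contains a box so
-- large that all monomials outside it have order `n`; the family is extended by zero to the other
-- exponents.
open Classical in
theorem isLog_pos (hR : IsNilpotent (nilradical R)) {a : Idx → R} {F L : DoubleLaurent R}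
    (hF : F - 1 ∈ mSet R)
    (h : ProdConverges (fun x : {x : Idx // IsPos x.1} => 1 - mono x.1.1 (a x.1)) F)
    (hL : ∀ z, co L z = -∑ᶠ p, logTerm (fun x => if IsPos x.1 then a x else 0) z p) :
    IsLog F L where
  co_zero := co_zero_of_logTerm hL
  eulerD_mul ℓ := by
    obtain ⟨W, hW⟩ := exists_posConv_of_prodConverges (a := fun x => a x.1) hF h
    refine sub_eq_zero.1 (eq_zero_of_mem_posFil (W := W) fun I n => ?_)
    obtain ⟨s₀, hs₀⟩ := (hW I).2.2.conv n
    refine isLog_mod (isMulFiltration_posFil I (W I))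
      (fun x => isLog_one_sub_mono hR (a := fun x => if IsPos x.1 then a x else 0) x
        fun hx => by rw [if_neg fun h => h.not_isNeg hx]; exact IsNilpotent.zero) hL (fun x => ?_)
      ((s₀ ∪ posBox I (W I) n).map ⟨Subtype.val, Subtype.val_injective⟩) (fun x hx => ?_) ?_ ℓ
    · split_ifs with h
      · exact (hW I).2.2.mono_mem ⟨x, h⟩
      · exact mono_zero_mem _ _
    · split_ifs with h
      · refine mono_mem_posFil fun hne => ⟨h.fst_nonneg, fun hI => ?_⟩
        by_contra hc
        have h1 := (hW I).2.2.weight ⟨x, h⟩ hI hne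
        exact hx (Finset.mem_map.2 ⟨⟨x, h⟩, Finset.mem_union_right _
          (mem_posBox.2 ⟨hI, h1, not_le.1 hc⟩), rfl⟩)
      · exact mono_zero_mem _ _
    · rw [Finset.prod_map, Finset.prod_congr rfl fun x _ => ?_]
      · exact hs₀ _ Finset.subset_union_left
      · change 1 - mono x.1.1 (if IsPos x.1.1 then a x.1 else 0) = _
        rw [if_pos x.2]

-- The same argument for the filtration `negFil`, which is separated because the nilradical is
-- nilpotent.
open Classical in
theorem isLog_neg (hR : IsNilpotent (nilradical R)) {a : Idx → R} {F L : DoubleLaurent R}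
    (hF : F - 1 ∈ pSet R)
    (h : ProdConverges (fun x : {x : Idx // IsNeg x.1} => 1 - mono x.1.1 (a x.1)) F)
    (hnil : ∀ x : Idx, IsNeg x.1 → IsNilpotent (a x))
    (hbdd : ∃ n m : ℤ, ∀ x : Idx, IsNeg x.1 → a x ≠ 0 → n < x.1.1 ∧ m < x.1.2)
    (hL : ∀ z, co L z = -∑ᶠ p, logTerm (fun x => if IsNeg x.1 then a x else 0) z p) :
    IsLog F L where
  co_zero := co_zero_of_logTerm hL
  eulerD_mul ℓ := by
    obtain ⟨n, m, hb⟩ := hbdd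
    obtain ⟨C₀, hC₀⟩ := exists_bound_of_mem_pSet hF
    -- Large enough to bound both the given family and the support of `F - 1`, with room for the
    -- shift by `1` in `negFil R C 1`.
    set C : ℤ := |n| + |m| + |C₀| + 1 with hCdef
    have hn := neg_abs_le n
    have hm := neg_abs_le m
    have hc := le_abs_self C₀
    have hn' := abs_nonneg n
    have hm' := abs_nonneg m
    have hc' := abs_nonneg C₀
    have hC : 0 < C := by omega
    have ha : NegBdd C (fun x : NegIdx => a x.1) := ⟨hC, fun x => hnil x.1 x.2, fun x hx => by
      have := hb x.1 x.2 hx; omega⟩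
    have hF1 : F - 1 ∈ negFil R C 1 := mem_negFil_one_of_mem_pSet hR hF
      (fun x hx => by have := hC₀ x hx; omega) hC
    refine sub_eq_zero.1 (eq_zero_of_mem_negFil hR hC fun n => ?_)
    obtain ⟨s₀, hs₀⟩ := negFil_conv_of_prodConverges ha hF1 h n
    refine isLog_mod (isMulFiltration_negFil hC)
      (fun x => isLog_one_sub_mono hR (a := fun x => if IsNeg x.1 then a x else 0) x
        fun hx => by rw [if_pos hx]; exact hnil x hx) hL (fun x => ?_)
      ((s₀ ∪ negBox C n).map ⟨Subtype.val, Subtype.val_injective⟩) (fun x hx => ?_) ?_ ℓ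
    · split_ifs with h
      · exact ha.mono_mem ⟨x, h⟩
      · exact mono_zero_mem _ _
    · split_ifs with h
      · refine mono_mem_negFil hC (hnil x h) fun hne => ?_
        have h1 := ha.bdd ⟨x, h⟩ hne
        refine ⟨h1.1, h.fst_nonpos, ?_⟩
        by_contra hc
        refine hx (Finset.mem_map.2 ⟨⟨x, h⟩, Finset.mem_union_right _
          (mem_negBox.2 ⟨h1.1, ?_, ?_⟩), rfl⟩)
        · have := h1.2; simp only at this ⊢; omega
        · simp only; omega
      · exact mono_zero_mem _ _
    · rw [Finset.prod_map, Finset.prod_congr rfl fun x _ => ?_]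
      · exact hs₀ _ Finset.subset_union_left
      · change 1 - mono x.1.1 (if IsNeg x.1.1 then a x.1 else 0) = _
        rw [if_pos x.2]

theorem exists_co_eq_logTerm {a b : Idx → R} (h : IsBdd (powSupp a))
    (hab : ∀ x, b x ≠ 0 → b x = a x) :
    ∃ L : DoubleLaurent R, ∀ z, co L z = -∑ᶠ p, logTerm b z p := by
  obtain ⟨n, β, hβ⟩ := h
  refine exists_of_bdd _ n β fun z hz => hβ z ?_
  by_contra hc
  refine hz ?_
  rw [neg_eq_zero]
  refine (finsum_congr fun p => ?_).trans finsum_zero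
  rw [logTerm]
  split_ifs with hp
  · by_contra h0
    have h1 := right_ne_zero_of_mul h0
    have h2 : b p.1 ≠ 0 := fun h => h1 (by rw [h, zero_pow (Nat.succ_ne_zero _)])
    exact hc ⟨p, by rwa [← hab p.1 h2], hp⟩
  · rfl

/-- The logarithm of `f₋₁ * f₁`. -/
def logOf (f : (DoubleLaurent R)ˣ) : DoubleLaurent R :=
  logSeries (splitting f).neg + logSeries (splitting f).pos

theorem isLog_logOf (hR : IsNilpotent (nilradical R)) (f : (DoubleLaurent R)ˣ) :
    IsLog ((splitting f).neg * (splitting f).pos) (logOf f) :=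
  (isLog_logSeries_neg hR (isSplitting_splitting hR f).neg_mem).1.mul
    (isLog_logSeries_pos (isSplitting_splitting hR f).pos_mem).1

/-- The series of coefficients predicted by expanding the logarithm of each factor exists by the
support bounds and satisfies the equations of a logarithm of `f₋₁ * f₁`. By `IsLog.unique` it is
`logOf f`. -/
theorem co_logOf (hR : IsNilpotent (nilradical R)) (f : (DoubleLaurent R)ˣ) (z : ℤ × ℤ) :
    co (logOf f) z = -∑ᶠ p, logTerm (factorCoeff f) z p := by
  classical
  have hf := isFactorFamily_factorCoeff hR f
  have hs := isSplitting_splitting hR f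
  obtain ⟨L, hL⟩ := exists_co_eq_logTerm (isBdd_powSupp hR f)
    (b := fun x => if IsPos x.1 then factorCoeff f x else 0) fun x hx => by
      split_ifs at hx ⊢ with h
      · rfl
      · exact (hx rfl).elim
  obtain ⟨M, hM⟩ := exists_co_eq_logTerm (isBdd_powSupp hR f)
    (b := fun x => if IsNeg x.1 then factorCoeff f x else 0) fun x hx => by
      split_ifs at hx ⊢ with h
      · rfl
      · exact (hx rfl).elim
  have h1 := isLog_pos hR hs.pos_mem hf.pos hL
  have h2 := isLog_neg hR hs.neg_mem hf.neg hf.nilp hf.bdd hM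
  rw [(isLog_logOf hR f).unique (isUnit_of_sub_one_mem hR hs.neg_mem hs.pos_mem) (h2.mul h1),
    co_add, hL, hM, ← neg_add, ← finsum_add_distrib (logTerm_support_finite _ _)
      (logTerm_support_finite _ _)]
  refine congrArg _ (finsum_congr fun p => ?_)
  simp only [logTerm]
  rcases isPos_or_isNeg p.1.2 with hx | hx
  · rw [if_neg (fun h => hx.not_isNeg h : ¬ IsNeg p.1.1), if_pos hx, zero_pow (Nat.succ_ne_zero _)]
    split_ifs <;> simp
  · rw [if_neg (fun h => h.not_isNeg hx : ¬ IsPos p.1.1), if_pos hx, zero_pow (Nat.succ_ne_zero _)]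
    split_ifs <;> simp

end

/-! ### Exponentials and logarithms of nilpotent elements -/

section

variable {R : Type u} [CommRing R]

/-! ### Exponentials of nilpotent elements -/

open Polynomial in
theorem eval_one_eq_eval_zero [Algebra ℚ R] {q : R[X]} (h : derivative q = 0) :
    q.eval 1 = q.eval 0 := by
  have h1 : ∀ n, q.coeff (n + 1) = 0 := fun n => by
    have h2 := congrArg (fun r => coeff r n) h
    simp only [coeff_derivative, coeff_zero] at h2
    calc q.coeff (n + 1) = q.coeff (n + 1) * (n + 1) * invSucc R n := by
          rw [mul_assoc, mul_comm _ (invSucc R n), invSucc_mul, mul_one]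
      _ = 0 := by rw [h2, zero_mul]
  have h3 : q = C (q.coeff 0) := by
    ext n
    cases n with
    | zero => simp
    | succ n => rw [h1, coeff_C_succ]
  rw [h3, eval_C, eval_C]

open Polynomial in
theorem derivative_exp [Algebra ℚ R] {N : R[X]} (hN : IsNilpotent N) :
    derivative (IsNilpotent.exp N) = derivative N * IsNilpotent.exp N := by
  obtain ⟨K, hK⟩ := hN
  -- On the side that is differentiated the exponential is written with one more term, so that its
  -- derivative is again a sum of `K` terms.
  have hK' : N ^ (K + 1) = 0 := by rw [pow_succ, hK, zero_mul]
  rw [IsNilpotent.exp_eq_sum hK]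
  conv_lhs => rw [← IsNilpotent.exp_eq_sum hK, IsNilpotent.exp_eq_sum hK', Finset.sum_range_succ']
  rw [map_add, map_sum, Finset.mul_sum]
  simp only [pow_zero, Nat.factorial_zero, Nat.cast_one, inv_one, one_smul, derivative_one, add_zero]
  refine Finset.sum_congr rfl fun n _ => ?_
  rw [derivative_smul, derivative_pow_succ, Nat.factorial_succ]
  have h : C ((n : R) + 1) = algebraMap ℚ R[X] ((n : ℚ) + 1) := by simp
  have h2 : ((((n + 1) * n.factorial : ℕ) : ℚ))⁻¹ * ((n : ℚ) + 1) = (n.factorial : ℚ)⁻¹ := by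
    push_cast
    have : ((n : ℚ) + 1) ≠ 0 := by positivity
    field_simp
  rw [Algebra.smul_def, Algebra.smul_def, ← h2, map_mul, ← h]
  push_cast
  ring

theorem isNilpotent_add {a b : R} (ha : IsNilpotent a) (hb : IsNilpotent b) :
    IsNilpotent (a + b) := (Commute.all a b).isNilpotent_add ha hb

theorem isNilpotent_finsum {ι : Type*} {f : ι → R} (h : ∀ i, IsNilpotent (f i)) :
    IsNilpotent (∑ᶠ i, f i) :=
  mem_nilradical.1 (finsum_mem_ideal _ fun i => mem_nilradical.2 (h i))

/-- The element of `R` that is `k` on the part of `Spec R` where `n` has the value `k`. -/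
def zval (n : ZConst R) : R := ∑ k ∈ valueSet n, (k : R) * idem n k

theorem idem_mul_zval (n : ZConst R) (k : ℤ) : idem n k * zval n = idem n k * (k : R) := by
  rw [zval, Finset.mul_sum, Finset.sum_eq_single k]
  · rw [mul_left_comm, idem_isIdempotent n k, mul_comm]
  · intro l _ hl
    rw [mul_left_comm, idem_mul_of_ne n hl.symm, mul_zero]
  · intro hk
    rw [idem_eq_zero_of_notMem hk, zero_mul]

theorem zval_add (n m : ZConst R) : zval (n + m) = zval n + zval m := by
  refine eq_of_idem_mul_eq (RingHom.id R) n fun k => ?_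
  refine eq_of_idem_mul_eq (RingHom.id R) m fun l => ?_
  simp only [RingHom.id_apply]
  have h : idem n k * idem m l * idem (n + m) (k + l) = idem n k * idem m l :=
    idem_mul_idem_mul_idem fun p h1 h2 => by rw [← h1, ← h2]; rfl
  have h1 := idem_mul_zval (n + m) (k + l)
  have h2 := idem_mul_zval n k
  have h3 := idem_mul_zval m l
  push_cast at h1
  linear_combination (idem n k * idem m l) * h1 - (zval (n + m) - (k : R) - (l : R)) * h -
    idem m l * h2 - idem n k * h3

theorem zval_zero : zval (0 : ZConst R) = 0 := by
  have := zval_add (R := R) 0 0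
  rw [add_zero] at this
  exact left_eq_add.1 this

variable [Algebra ℚ R]

/-- `-log (1 - M)` for nilpotent `M`. -/
def nlog (M : R) : R := ∑ᶠ n : ℕ, invSucc R n * M ^ (n + 1)

theorem nlog_eq_sum {M : R} {K : ℕ} (hK : M ^ K = 0) :
    nlog M = ∑ n ∈ Finset.range K, invSucc R n * M ^ (n + 1) := by
  refine finsum_eq_sum_of_support_subset _ fun n hn => ?_
  by_contra h
  refine hn ?_
  simp only
  rw [pow_eq_zero_of_le (by simp at h; omega) hK, mul_zero]

theorem isNilpotent_nlog {M : R} (hM : IsNilpotent M) : IsNilpotent (nlog M) := by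
  obtain ⟨K, hK⟩ := id hM
  rw [nlog_eq_sum hK]
  refine mem_nilradical.1 (Ideal.sum_mem _ fun n _ => Ideal.mul_mem_left _ _ ?_)
  exact Ideal.pow_mem_of_mem _ (mem_nilradical.2 hM) _ n.succ_pos

-- `M` is replaced by `M * X` in a polynomial ring. There `exp (log (1 - M X)) * (1 - M X)⁻¹`, with
-- both series finite, has derivative `0` and is therefore constant in characteristic `0`. Its value
-- at `0` is `1`; evaluation at `1` is the claim.
open Polynomial in
theorem exp_neg_nlog {M : R} (hM : IsNilpotent M) : IsNilpotent.exp (-nlog M) = 1 - M := by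
  obtain ⟨K, hK⟩ := id hM
  set y : R[X] := C M * X with hy
  have hyK : y ^ K = 0 := by rw [hy, mul_pow, ← C_pow, hK, C_0, zero_mul]
  set N : R[X] := -∑ n ∈ Finset.range K, C (invSucc R n) * y ^ (n + 1) with hN
  set g : R[X] := ∑ n ∈ Finset.range K, y ^ n with hg
  have hNn : IsNilpotent N := by
    rw [hN]
    refine IsNilpotent.neg (mem_nilradical.1 (Ideal.sum_mem _ fun n _ => Ideal.mul_mem_left _ _ ?_))
    exact Ideal.pow_mem_of_mem _ (mem_nilradical.2 ⟨K, hyK⟩) _ n.succ_pos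
  have hdy : derivative y = C M := by rw [hy, derivative_C_mul, derivative_X, mul_one]
  have hgy : (1 - y) * g = 1 := by
    have h := geom_sum_mul y K
    rw [hyK] at h
    linear_combination -h
  have hdN : derivative N = -(C M * g) := by
    rw [hN, map_neg, map_sum, hg, Finset.mul_sum]
    refine congrArg _ (Finset.sum_congr rfl fun n _ => ?_)
    rw [derivative_C_mul, derivative_pow_succ, hdy]
    have h : C (invSucc R n) * C ((n : R) + 1) = 1 := by rw [← C_mul, invSucc_mul, C_1]
    linear_combination (y ^ n * C M) * h
  have hdg : derivative g = C M * g ^ 2 := by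
    have h := congrArg derivative hgy
    rw [derivative_mul, derivative_one, map_sub, derivative_one, hdy] at h
    linear_combination g * h - derivative g * hgy
  have hq : derivative (IsNilpotent.exp N * g) = 0 := by
    rw [derivative_mul, derivative_exp hNn, hdN, hdg]
    ring
  have he := eval_one_eq_eval_zero hq
  have hev : ∀ r : R, (IsNilpotent.exp N).eval r = IsNilpotent.exp (N.eval r) := fun r =>
    IsNilpotent.map_exp hNn (evalRingHom r)
  have hN1 : N.eval 1 = -nlog M := by
    rw [nlog_eq_sum hK, hN, eval_neg, eval_finsetSum]
    simp [hy]
  have hN0 : N.eval 0 = 0 := by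
    rw [hN, eval_neg, eval_finsetSum, neg_eq_zero]
    exact Finset.sum_eq_zero fun n _ => by simp [hy]
  have hg1 : (1 - M) * g.eval 1 = 1 := by
    have := congrArg (eval 1) hgy
    simpa [hy] using this
  have hg0 : g.eval 0 = 1 := by
    have := congrArg (eval 0) hgy
    simpa [hy] using this
  rw [eval_mul, eval_mul, hev, hev, hN1, hN0, IsNilpotent.exp_zero, hg0, mul_one] at he
  calc IsNilpotent.exp (-nlog M) = (1 - M) * (IsNilpotent.exp (-nlog M) * g.eval 1) := by
        rw [mul_left_comm, hg1, mul_one]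
    _ = 1 - M := by rw [he, mul_one]

open Classical in
/-- The exponential of a nilpotent element as a unit (`1` for elements that are not nilpotent). -/
def expU (N : R) : Rˣ := if h : IsNilpotent N then (IsNilpotent.isUnit_exp h).unit else 1

theorem expU_val {N : R} (h : IsNilpotent N) : (expU N : R) = IsNilpotent.exp N := by
  rw [expU, dif_pos h]; rfl

theorem expU_add {a b : R} (ha : IsNilpotent a) (hb : IsNilpotent b) :
    expU (a + b) = expU a * expU b := by
  ext
  rw [Units.val_mul, expU_val (isNilpotent_add ha hb), expU_val ha, expU_val hb,
    IsNilpotent.exp_add_of_commute (Commute.all a b) ha hb]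

theorem expU_zero : expU (0 : R) = 1 := by
  ext; rw [expU_val IsNilpotent.zero, IsNilpotent.exp_zero, Units.val_one]

/-- The exponential as a homomorphism. -/
def expHom (R : Type u) [CommRing R] [Algebra ℚ R] : Multiplicative (nilradical R) →* Rˣ where
  toFun N := expU (N.toAdd : R)
  map_one' := expU_zero
  map_mul' a b := expU_add (mem_nilradical.1 a.toAdd.2) (mem_nilradical.1 b.toAdd.2)

theorem expU_neg {a : R} (ha : IsNilpotent a) : expU (-a) = (expU a)⁻¹ :=
  map_inv (expHom R) (Multiplicative.ofAdd ⟨a, mem_nilradical.2 ha⟩)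

theorem expU_intCast_mul {a : R} (ha : IsNilpotent a) (k : ℤ) :
    expU ((k : R) * a) = expU a ^ k := by
  rw [← zsmul_eq_mul]
  exact map_zpow (expHom R) (Multiplicative.ofAdd ⟨a, mem_nilradical.2 ha⟩) k

theorem expU_sum {ι : Type*} (s : Finset ι) {f : ι → R} (h : ∀ i, IsNilpotent (f i)) :
    expU (∑ i ∈ s, f i) = ∏ i ∈ s, expU (f i) := by
  classical
  induction s using Finset.induction_on with
  | empty => exact expU_zero
  | insert i s hi ih =>
    rw [Finset.sum_insert hi, Finset.prod_insert hi, expU_add (h i), ih]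
    exact mem_nilradical.1 (Ideal.sum_mem _ fun j _ => mem_nilradical.2 (h j))

theorem expU_finsum {ι : Type*} {f : ι → R} (h : ∀ i, IsNilpotent (f i))
    (hf : (Function.support f).Finite) : expU (∑ᶠ i, f i) = ∏ᶠ i, expU (f i) := by
  rw [finsum_eq_sum_of_support_subset f (s := hf.toFinset) (by simp), expU_sum _ h,
    finprod_eq_prod_of_mulSupport_subset]
  intro i hi
  by_contra hc
  refine hi ?_
  have h0 : f i = 0 := by simpa using hc
  simp only
  rw [h0, expU_zero]

theorem expU_neg_nlog {M : R} (hM : IsNilpotent M) : expU (-nlog M) = oneSub M := by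
  ext
  rw [expU_val (isNilpotent_nlog hM).neg, exp_neg_nlog hM, oneSub_val hM]

theorem mul_exp_congr {e a b : R} (ha : IsNilpotent a) (hb : IsNilpotent b) (h : e * a = e * b) :
    e * IsNilpotent.exp a = e * IsNilpotent.exp b := by
  obtain ⟨K, hK⟩ := ha
  obtain ⟨K', hK'⟩ := hb
  rw [IsNilpotent.exp_eq_sum (pow_eq_zero_of_le (le_max_left K K') hK),
    IsNilpotent.exp_eq_sum (pow_eq_zero_of_le (le_max_right K K') hK'), Finset.mul_sum,
    Finset.mul_sum]
  have key : ∀ n, e * a ^ n = e * b ^ n := fun n => by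
    induction n with
    | zero => simp
    | succ n ih => rw [pow_succ, pow_succ]; linear_combination b ^ n * h + a * ih
  exact Finset.sum_congr rfl fun n _ => by rw [mul_smul_comm, mul_smul_comm, key]

/-- On the piece `{n = k}` the element `zval n` is the integer `k`, and an integral power of an
exponential is the exponential of the multiple. -/
theorem lpow_expU {N : R} (hN : IsNilpotent N) (n : ZConst R) :
    lpow (expU N) n = expU (zval n * N) := by
  have hn : IsNilpotent (zval n * N) := (Commute.all _ _).isNilpotent_mul_left hN
  refine powAlong_ext _ _ _ _ fun k => ?_
  have hk : IsNilpotent ((k : R) * N) := (Commute.all _ _).isNilpotent_mul_left hN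
  rw [← expU_intCast_mul hN, expU_val hn, expU_val hk]
  refine mul_exp_congr hn hk ?_
  rw [RingHom.id_apply, ← mul_assoc, idem_mul_zval, mul_assoc]

end

/-! ### The elementary factors as exponentials -/

section

variable {R : Type u} [CommRing R]

/-! ### The elementary factors as exponentials -/

theorem finsum_eq_finsum_comp {α M : Type*} [AddCommMonoid M] {f : α → M} {e : ℕ → α}
    (he : Function.Injective e) (h : ∀ x, f x ≠ 0 → x ∈ Set.range e) :
    ∑ᶠ x, f x = ∑ᶠ n, f (e n) := by
  rw [← finsum_mem_range he, finsum_mem_def]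
  exact finsum_congr fun x => (congrFun (Set.indicator_eq_self.2 h) x).symm

theorem exists_eq_mul_of_coprime {p q s t : ℕ} (hp : 0 < p) (hs : 0 < s)
    (hpq : Nat.Coprime p q) (h : s * q = t * p) : ∃ n, s = (n + 1) * p ∧ t = (n + 1) * q := by
  obtain ⟨m, hm⟩ := hpq.dvd_of_dvd_mul_right (Dvd.intro_left _ h.symm : p ∣ s * q)
  have hm0 : 0 < m := Nat.pos_of_ne_zero fun h0 => by rw [hm, h0] at hs; simp at hs
  obtain ⟨n, rfl⟩ := Nat.exists_eq_succ_of_ne_zero hm0.ne'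
  refine ⟨n, by rw [hm, mul_comm], ?_⟩
  rw [hm] at h
  refine Nat.eq_of_mul_eq_mul_right hp ?_
  rw [← h, Nat.succ_eq_add_one]
  ring

theorem exists_eq_mul_of_gcd_eq_one {p q r s t v : ℕ} (hp : 0 < p) (hs : 0 < s)
    (hpq : Nat.gcd (Nat.gcd p q) r = 1) (h : s * q = t * p) (h' : s * r = v * p) :
    ∃ n, s = (n + 1) * p ∧ t = (n + 1) * q ∧ v = (n + 1) * r := by
  have hdvd : p ∣ s := by
    have h1 : p ∣ Nat.gcd (Nat.gcd (s * p) (s * q)) (s * r) :=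
      Nat.dvd_gcd (Nat.dvd_gcd (Dvd.intro_left _ rfl) (h ▸ Dvd.intro_left _ rfl))
        (h' ▸ Dvd.intro_left _ rfl)
    rwa [Nat.gcd_mul_left, Nat.gcd_mul_left, hpq, mul_one] at h1
  obtain ⟨m, hm⟩ := hdvd
  have hm0 : 0 < m := Nat.pos_of_ne_zero fun h0 => by rw [hm, h0] at hs; simp at hs
  obtain ⟨n, rfl⟩ := Nat.exists_eq_succ_of_ne_zero hm0.ne'
  refine ⟨n, by rw [hm, mul_comm], Nat.eq_of_mul_eq_mul_right hp ?_,
    Nat.eq_of_mul_eq_mul_right hp ?_⟩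
  · rw [← h, hm, Nat.succ_eq_add_one]; ring
  · rw [← h', hm, Nat.succ_eq_add_one]; ring

variable [Algebra ℚ R]

theorem mul_invSucc_eq {p k n : ℕ} (h : k + 1 = (n + 1) * p) :
    (p : R) * invSucc R k = invSucc R n := by
  have h1 := invSucc_mul (R := R) k
  have h2 := invSucc_mul (R := R) n
  have h3 : (k : R) + 1 = ((n : R) + 1) * p := by exact_mod_cast congrArg (Nat.cast (R := R)) h
  rw [h3] at h1
  linear_combination invSucc R n * h1 - (p : R) * invSucc R k * h2

open Classical in
/-- The term with exponents `m.1 + 1`, `m.2 + 1` in the logarithm of the factor `S`. -/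
def sTerm (x y : ℤ × ℤ) (a b : R) (m : ℕ × ℕ) : R :=
  if (m.1 + 1) • x + (m.2 + 1) • y = 0 then
    invSucc R m.1 * a ^ (m.1 + 1) * b ^ (m.2 + 1) * (y.2 : R) else 0

omit [Algebra ℚ R] in
-- A relation with positive coefficients makes the exponents antiparallel; `y.2 ≠ 0` then gives a
-- strict sign.
theorem SCond.of_rel {x y : ℤ × ℤ} {s t : ℕ} (h : (s + 1) • x + (t + 1) • y = 0) (hy : y.2 ≠ 0) :
    SCond x y := by
  have h1 : (s + 1 : ℤ) * x.1 + (t + 1) * y.1 = 0 := by simpa using congrArg Prod.fst h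
  have h2 : (s + 1 : ℤ) * x.2 + (t + 1) * y.2 = 0 := by simpa using congrArg Prod.snd h
  have hs : (0 : ℤ) < s + 1 := by positivity
  have ht : (0 : ℤ) < t + 1 := by positivity
  have hy2 : 0 < y.2 * y.2 := mul_self_pos.2 hy
  have e2 : (s + 1 : ℤ) * (x.2 * y.2) = -((t + 1) * (y.2 * y.2)) := by linear_combination y.2 * h2
  have e1 : (s + 1 : ℤ) * (x.1 * y.1) = -((t + 1) * (y.1 * y.1)) := by linear_combination y.1 * h1
  have hx2 : x.2 * y.2 < 0 := by
    by_contra hc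
    have := mul_nonneg hs.le (not_lt.1 hc)
    have := mul_pos ht hy2
    omega
  have hx1 : x.1 * y.1 ≤ 0 := by
    by_contra hc
    have := mul_pos hs (not_le.1 hc)
    have := mul_nonneg ht.le (mul_self_nonneg y.1)
    omega
  refine ⟨?_, by omega, hx2.ne⟩
  have e3 : (s + 1 : ℤ) * det2 x y = 0 := by
    unfold det2; linear_combination y.1 * h2 - y.2 * h1
  exact (mul_eq_zero.1 e3).resolve_left hs.ne'

theorem finite_support_nlog {M : R} (hM : IsNilpotent M) :
    (Function.support fun n : ℕ => invSucc R n * M ^ (n + 1)).Finite := by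
  obtain ⟨K, hK⟩ := hM
  refine (Set.finite_Iio K).subset fun n hn => ?_
  by_contra h
  refine hn ?_
  simp only
  rw [pow_eq_zero_of_le (by simp at h; omega) hK, mul_zero]

/-- The positive relations between `x` and `y` are the multiples `n + 1` of the primitive one `(p,
q)`. Along these the terms are `1 / ((n + 1) p) * M ^ (n + 1) * y.2`, where `M` is the monomial of
`S`; as `y.2` is `p` times the signed gcd, they sum to that gcd times `-log (1 - M)`. -/
theorem finsum_sTerm {x y : ℤ × ℤ} {a b : R} (h : SCond x y)
    (hM : IsNilpotent (sMon x y a b)) :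
    ∑ᶠ m, sTerm x y a b m =
      ((y.2.sign * (Int.gcd x.2 y.2 : ℤ) : ℤ) : R) * nlog (sMon x y a b) := by
  obtain ⟨hd, hp, hq, hrel⟩ := s_rel h
  set d := Int.gcd x.2 y.2 with hdef
  set p := y.2.natAbs / d with hpdef
  set q := x.2.natAbs / d with hqdef
  have hpd : p * d = y.2.natAbs := Nat.div_mul_cancel (Int.gcd_dvd_natAbs_right _ _)
  have hqd : q * d = x.2.natAbs := Nat.div_mul_cancel (Int.gcd_dvd_natAbs_left _ _)
  have hcop : Nat.Coprime p q := by
    have h1 := Nat.coprime_div_gcd_div_gcd (m := y.2.natAbs) (n := x.2.natAbs)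
      (by rw [Nat.gcd_comm]; exact hd)
    rw [Nat.gcd_comm] at h1
    exact h1
  have hsub : ∀ n r : ℕ, 0 < r → (n + 1) * r - 1 + 1 = (n + 1) * r := fun n r hr =>
    Nat.sub_add_cancel (Nat.mul_pos n.succ_pos hr)
  -- An index `m` of `sTerm` stands for the exponent `m + 1`, which explains the subtraction of `1`.
  let e : ℕ → ℕ × ℕ := fun n => ((n + 1) * p - 1, (n + 1) * q - 1)
  have he : Function.Injective e := fun n m hnm => by
    have h1 : (n + 1) * p - 1 = (m + 1) * p - 1 := congrArg Prod.fst hnm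
    have h2 : (n + 1) * p = (m + 1) * p := by rw [← hsub n p hp, ← hsub m p hp, h1]
    have := Nat.eq_of_mul_eq_mul_right hp h2
    omega
  rw [finsum_eq_finsum_comp he, nlog, mul_finsum' _ _ (finite_support_nlog hM)]
  · refine finsum_congr fun n => ?_
    have hr : ((n + 1) * p) • x + ((n + 1) * q) • y = 0 := by
      rw [mul_smul, mul_smul, ← smul_add, hrel, smul_zero]
    have hy : (y.2 : R) = ((y.2.sign * (d : ℤ) : ℤ) : R) * p := by
      have : y.2 = y.2.sign * d * p := by
        rw [mul_assoc, mul_comm (d : ℤ), ← Nat.cast_mul, hpd, Int.sign_mul_natAbs]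
      calc (y.2 : R) = ((y.2.sign * d * p : ℤ) : R) := by rw [← this]
        _ = _ := by push_cast; ring
    have hinv := mul_invSucc_eq (R := R) (hsub n p hp)
    rw [sTerm, if_pos]
    · change invSucc R ((n + 1) * p - 1) * a ^ ((n + 1) * p - 1 + 1) *
        b ^ ((n + 1) * q - 1 + 1) * (y.2 : R) = _
      rw [hsub n p hp, hsub n q hq, hy, sMon, ← hinv, mul_pow, ← pow_mul, ← pow_mul,
        mul_comm p, mul_comm q]
      ring
    · change ((n + 1) * p - 1 + 1) • x + ((n + 1) * q - 1 + 1) • y = 0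
      rw [hsub n p hp, hsub n q hq, hr]
  · intro m hm
    rw [sTerm] at hm
    have hm1 : (m.1 + 1) • x + (m.2 + 1) • y = 0 := by
      by_contra hc; exact hm (if_neg hc)
    have h2 : (m.1 + 1 : ℤ) * x.2 + (m.2 + 1) * y.2 = 0 := by simpa using congrArg Prod.snd hm1
    have h3 : (m.1 + 1) * x.2.natAbs = (m.2 + 1) * y.2.natAbs := by
      have := congrArg Int.natAbs (eq_neg_of_add_eq_zero_left h2)
      rw [Int.natAbs_neg, Int.natAbs_mul, Int.natAbs_mul] at this
      exact_mod_cast this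
    have h4 : (m.1 + 1) * q = (m.2 + 1) * p := by
      refine Nat.eq_of_mul_eq_mul_right hd ?_
      rw [mul_assoc, mul_assoc, hqd, hpd, h3]
    obtain ⟨n, hn1, hn2⟩ := exists_eq_mul_of_coprime hp (Nat.succ_pos _) hcop h4
    exact ⟨n, Prod.ext (by change (n + 1) * p - 1 = _; omega)
      (by change (n + 1) * q - 1 = _; omega)⟩

/-- Outside `SCond` every term vanishes: a positive relation with `y.2 ≠ 0` would imply `SCond`, and
a term with `y.2 = 0` carries the factor `0`. -/
theorem expU_finsum_sTerm {x y : ℤ × ℤ} {a b : R} (h : SCond x y → IsNilpotent (sMon x y a b)) :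
    IsNilpotent (∑ᶠ m, sTerm x y a b m) ∧ expU (∑ᶠ m, sTerm x y a b m) = sFactor x y a b := by
  by_cases hc : SCond x y
  · have hn := isNilpotent_nlog (h hc)
    rw [finsum_sTerm hc (h hc), expU_intCast_mul hn, sFactor_of hc, ← expU_neg_nlog (h hc), expU_neg hn,
      zpow_neg, inv_zpow, inv_inv]
    exact ⟨(Commute.all _ _).isNilpotent_mul_left hn, rfl⟩
  · have h0 : ∑ᶠ m, sTerm x y a b m = 0 := by
      refine (finsum_congr fun m => ?_).trans finsum_zero
      rw [sTerm]
      split_ifs with hr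
      · by_cases hy : y.2 = 0
        · rw [hy, Int.cast_zero, mul_zero]
        · exact (hc (SCond.of_rel hr hy)).elim
      · rfl
    rw [h0, expU_zero, sFactor_of_not hc]
    exact ⟨IsNilpotent.zero, rfl⟩

theorem expU_finsum_sTerm_swap {x y : ℤ × ℤ} {a b : R}
    (h : QCond x y → IsNilpotent (qMon x y a b)) :
    IsNilpotent (∑ᶠ m, sTerm x.swap y.swap a b m) ∧
      expU (∑ᶠ m, sTerm x.swap y.swap a b m) = (qFactor x y a b)⁻¹ := by
  rw [qFactor_eq, inv_inv]
  refine expU_finsum_sTerm fun hs => ?_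
  rw [← qMon_eq]
  exact h ((qCond_iff x y).2 hs)

open Classical in
/-- The term with exponents `m.1 + 1`, `m.2.1 + 1`, `m.2.2 + 1` in the logarithm of the
factor `T`. -/
def tTerm (x y z : ℤ × ℤ) (a b c : R) (m : ℕ × ℕ × ℕ) : R :=
  if (m.1 + 1) • x + (m.2.1 + 1) • y + (m.2.2 + 1) • z = 0 then
    -(invSucc R m.1 * a ^ (m.1 + 1) * b ^ (m.2.1 + 1) * c ^ (m.2.2 + 1) * (det2 y z : R)) else 0

-- Take determinants of the relation with `z` and with `y`.
omit [Algebra ℚ R] in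
theorem det2_eq_of_rel {x y z : ℤ × ℤ} {s t r : ℤ} (h : s • x + t • y + r • z = 0) :
    s * det2 z x = t * det2 y z ∧ s * det2 x y = r * det2 y z := by
  have h1 : s * x.1 + t * y.1 + r * z.1 = 0 := by simpa using congrArg Prod.fst h
  have h2 : s * x.2 + t * y.2 + r * z.2 = 0 := by simpa using congrArg Prod.snd h
  unfold det2
  exact ⟨by linear_combination z.2 * h1 - z.1 * h2, by linear_combination y.1 * h2 - y.2 * h1⟩

omit [Algebra ℚ R] in
theorem det2_eq_of_nat_rel {x y z : ℤ × ℤ} {s t r : ℕ}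
    (h : (s + 1) • x + (t + 1) • y + (r + 1) • z = 0) :
    (s + 1 : ℤ) * det2 z x = (t + 1) * det2 y z ∧ (s + 1 : ℤ) * det2 x y = (r + 1) * det2 y z := by
  refine det2_eq_of_rel (x := x) ?_
  rw [← h]
  simp only [← natCast_zsmul]
  push_cast
  rfl

omit [Algebra ℚ R] in
theorem tPos_or_tNeg_of_rel {x y z : ℤ × ℤ} {s t r : ℕ}
    (h : (s + 1) • x + (t + 1) • y + (r + 1) • z = 0) (h0 : det2 y z ≠ 0) :
    TPos x y z ∨ TNeg x y z := by
  obtain ⟨h1, h2⟩ := det2_eq_of_nat_rel h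
  have hs : (0 : ℤ) < s + 1 := by positivity
  have ht : (0 : ℤ) < t + 1 := by positivity
  have hr : (0 : ℤ) < r + 1 := by positivity
  rcases lt_or_gt_of_ne h0 with hn | hp
  · exact Or.inr ⟨hn, by have := mul_pos_of_neg_of_neg (neg_neg_of_pos ht) hn; nlinarith,
      by have := mul_pos_of_neg_of_neg (neg_neg_of_pos hr) hn; nlinarith⟩
  · exact Or.inl ⟨hp, by have := mul_pos ht hp; nlinarith, by have := mul_pos hr hp; nlinarith⟩

/-- As for `S`: here nonzero determinants make the relation unique up to scaling, so the positive
relations are the multiples of the primitive triple `(p, q, r)`, and the determinant of `y`, `z` is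
`p` times the signed gcd. -/
theorem finsum_tTerm {x y z : ℤ × ℤ} {a b c : R} (h : TPos x y z ∨ TNeg x y z)
    (hM : IsNilpotent (tMon x y z a b c)) :
    ∑ᶠ m, tTerm x y z a b c m =
      ((-((det2 y z).sign * (gcd3 (det2 y z) (det2 z x) (det2 x y) : ℤ)) : ℤ) : R) *
        nlog (tMon x y z a b c) := by
  obtain ⟨hd, hp, hq, hr, hrel⟩ := t_rel h rfl
  obtain ⟨hd1, hd2, hd3⟩ := gcd3_dvd (det2 y z) (det2 z x) (det2 x y)
  set d := gcd3 (det2 y z) (det2 z x) (det2 x y) with hdef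
  set p := (det2 y z).natAbs / d with hpdef
  set q := (det2 z x).natAbs / d with hqdef
  set r := (det2 x y).natAbs / d with hrdef
  have hpd : p * d = (det2 y z).natAbs := Nat.div_mul_cancel hd1
  have hqd : q * d = (det2 z x).natAbs := Nat.div_mul_cancel hd2
  have hrd : r * d = (det2 x y).natAbs := Nat.div_mul_cancel hd3
  have hgcd : Nat.gcd (Nat.gcd p q) r = 1 := by
    refine Nat.eq_of_mul_eq_mul_right hd ?_
    rw [← Nat.gcd_mul_right, ← Nat.gcd_mul_right, hpd, hqd, hrd, one_mul]
    rfl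
  have hsub : ∀ n r : ℕ, 0 < r → (n + 1) * r - 1 + 1 = (n + 1) * r := fun n r hr =>
    Nat.sub_add_cancel (Nat.mul_pos n.succ_pos hr)
  let e : ℕ → ℕ × ℕ × ℕ := fun n => ((n + 1) * p - 1, (n + 1) * q - 1, (n + 1) * r - 1)
  have he : Function.Injective e := fun n m hnm => by
    have h1 : (n + 1) * p - 1 = (m + 1) * p - 1 := congrArg Prod.fst hnm
    have h2 : (n + 1) * p = (m + 1) * p := by rw [← hsub n p hp, ← hsub m p hp, h1]
    have := Nat.eq_of_mul_eq_mul_right hp h2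
    omega
  rw [finsum_eq_finsum_comp he, nlog, mul_finsum' _ _ (finite_support_nlog hM)]
  · refine finsum_congr fun n => ?_
    have hr' : ((n + 1) * p) • x + ((n + 1) * q) • y + ((n + 1) * r) • z = 0 := by
      rw [mul_smul, mul_smul, mul_smul, ← smul_add, ← smul_add, hrel, smul_zero]
    have hy : (det2 y z : R) = (((det2 y z).sign * (d : ℤ) : ℤ) : R) * p := by
      have : det2 y z = (det2 y z).sign * d * p := by
        rw [mul_assoc, mul_comm (d : ℤ), ← Nat.cast_mul, hpd, Int.sign_mul_natAbs]
      calc (det2 y z : R) = (((det2 y z).sign * d * p : ℤ) : R) := by rw [← this]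
        _ = _ := by push_cast; ring
    have hinv := mul_invSucc_eq (R := R) (hsub n p hp)
    rw [tTerm, if_pos]
    · change -(invSucc R ((n + 1) * p - 1) * a ^ ((n + 1) * p - 1 + 1) *
        b ^ ((n + 1) * q - 1 + 1) * c ^ ((n + 1) * r - 1 + 1) * (det2 y z : R)) = _
      rw [hsub n p hp, hsub n q hq, hsub n r hr, hy, tMon, ← hinv, Int.cast_neg]
      change _ = _ * (_ * (a ^ p * b ^ q * c ^ r) ^ (n + 1))
      rw [mul_pow, mul_pow, ← pow_mul, ← pow_mul, ← pow_mul, mul_comm p, mul_comm q, mul_comm r]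
      ring
    · change ((n + 1) * p - 1 + 1) • x + ((n + 1) * q - 1 + 1) • y +
        ((n + 1) * r - 1 + 1) • z = 0
      rw [hsub n p hp, hsub n q hq, hsub n r hr, hr']
  · intro m hm
    rw [tTerm] at hm
    have hm1 : (m.1 + 1) • x + (m.2.1 + 1) • y + (m.2.2 + 1) • z = 0 := by
      by_contra hc; exact hm (if_neg hc)
    obtain ⟨h2, h3⟩ := det2_eq_of_nat_rel hm1
    have h2 := congrArg Int.natAbs h2
    have h3 := congrArg Int.natAbs h3
    simp only [Int.natAbs_mul] at h2 h3
    have h2' : (m.1 + 1) * (det2 z x).natAbs = (m.2.1 + 1) * (det2 y z).natAbs := by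
      exact_mod_cast h2
    have h3' : (m.1 + 1) * (det2 x y).natAbs = (m.2.2 + 1) * (det2 y z).natAbs := by
      exact_mod_cast h3
    obtain ⟨n, hn1, hn2, hn3⟩ := exists_eq_mul_of_gcd_eq_one hp (Nat.succ_pos m.1) hgcd
      (t := m.2.1 + 1) (v := m.2.2 + 1)
      (Nat.eq_of_mul_eq_mul_right hd (by rw [mul_assoc, mul_assoc, hqd, hpd]; exact h2'))
      (Nat.eq_of_mul_eq_mul_right hd (by rw [mul_assoc, mul_assoc, hrd, hpd]; exact h3'))
    exact ⟨n, Prod.ext (by change (n + 1) * p - 1 = _; omega)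
      (Prod.ext (by change (n + 1) * q - 1 = _; omega) (by change (n + 1) * r - 1 = _; omega))⟩

theorem expU_finsum_tTerm {x y z : ℤ × ℤ} {a b c : R}
    (h : TPos x y z ∨ TNeg x y z → IsNilpotent (tMon x y z a b c)) :
    IsNilpotent (∑ᶠ m, tTerm x y z a b c m) ∧
      expU (∑ᶠ m, tTerm x y z a b c m) = tFactor x y z a b c := by
  by_cases hc : TPos x y z ∨ TNeg x y z
  · have hn := isNilpotent_nlog (h hc)
    rw [finsum_tTerm hc (h hc), expU_intCast_mul hn]
    refine ⟨(Commute.all _ _).isNilpotent_mul_left hn, ?_⟩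
    rw [zpow_neg, ← inv_zpow, ← expU_neg hn, expU_neg_nlog (h hc)]
    rcases hc with hc | hc
    · rw [tFactor_of_pos hc, Int.sign_eq_one_of_pos hc.1, one_mul]
    · rw [tFactor_of_neg hc, Int.sign_eq_neg_one_of_neg hc.1, neg_one_mul]
  · have h0 : ∑ᶠ m, tTerm x y z a b c m = 0 := by
      refine (finsum_congr fun m => ?_).trans finsum_zero
      rw [tTerm]
      split_ifs with hr
      · by_cases hy : det2 y z = 0
        · rw [hy, Int.cast_zero, mul_zero, neg_zero]
        · exact (hc (tPos_or_tNeg_of_rel hr hy)).elim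
      · rfl
    rw [h0, expU_zero, tFactor_of_not (fun h => hc (Or.inl h)) (fun h => hc (Or.inr h))]
    exact ⟨IsNilpotent.zero, rfl⟩

end

/-! ### Constant coefficients of products of logarithms -/

section

variable {R : Type u} [CommRing R]

/-! ### Series given as sums of monomials -/

/-- `F` is the sum of the monomials with exponents `e p` and coefficients `v p`. -/
structure IsMonoSum {ι : Type*} (e : ι → ℤ × ℤ) (v : ι → R) (F : DoubleLaurent R) : Prop where
  finite : ∀ z, {p | v p ≠ 0 ∧ e p = z}.Finite
  co_eq : ∀ z, co F z = ∑ᶠ p, v p * (if e p = z then 1 else 0)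

theorem finite_support_ite {ι : Type*} {e : ι → ℤ × ℤ} {v : ι → R} {z : ℤ × ℤ}
    (h : {p | v p ≠ 0 ∧ e p = z}.Finite) :
    (Function.support fun p => v p * (if e p = z then 1 else 0)).Finite :=
  h.subset fun p hp => ⟨left_ne_zero_of_mul hp, by
    by_contra hc
    exact right_ne_zero_of_mul hp (if_neg hc)⟩

theorem finsum_mul_finsum {ι κ : Type*} {f : ι → R} {g : κ → R} (hf : (Function.support f).Finite)
    (hg : (Function.support g).Finite) :
    (∑ᶠ i, f i) * ∑ᶠ j, g j = ∑ᶠ p : ι × κ, f p.1 * g p.2 := by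
  rw [finsum_curry, finsum_mul' _ _ hf]
  · exact finsum_congr fun i => mul_finsum' _ _ hg
  · exact (hf.prod hg).subset fun p hp => ⟨left_ne_zero_of_mul hp, right_ne_zero_of_mul hp⟩

/-- The convolution is written as a sum over triples consisting of an exponent and two indices, and
the order of summation is exchanged; the exponent is then determined by the first index. -/
theorem IsMonoSum.mul {ι κ : Type*} {e : ι → ℤ × ℤ} {v : ι → R} {F : DoubleLaurent R}
    {e' : κ → ℤ × ℤ} {v' : κ → R} {G : DoubleLaurent R} (hF : IsMonoSum e v F)
    (hG : IsMonoSum e' v' G) (z : ℤ × ℤ)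
    (hfin : {p : ι × κ | v p.1 ≠ 0 ∧ v' p.2 ≠ 0 ∧ e p.1 + e' p.2 = z}.Finite) :
    co (F * G) z =
      ∑ᶠ p : ι × κ, v p.1 * v' p.2 * (if e p.1 + e' p.2 = z then 1 else 0) := by
  let Φ : (ℤ × ℤ) × (ι × κ) → R := fun w =>
    (v w.2.1 * (if e w.2.1 = w.1 then 1 else 0)) *
      (v' w.2.2 * (if e' w.2.2 = z - w.1 then 1 else 0))
  have hΦ : (Function.support Φ).Finite := by
    refine (hfin.image fun p => (e p.1, p)).subset fun w hw => ?_
    have h1 := left_ne_zero_of_mul hw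
    have h2 := right_ne_zero_of_mul hw
    have h3 : e w.2.1 = w.1 := by by_contra hc; exact right_ne_zero_of_mul h1 (if_neg hc)
    have h4 : e' w.2.2 = z - w.1 := by by_contra hc; exact right_ne_zero_of_mul h2 (if_neg hc)
    exact ⟨w.2, ⟨left_ne_zero_of_mul h1, left_ne_zero_of_mul h2, by rw [h3, h4]; abel⟩,
      Prod.ext h3 rfl⟩
  rw [co_mul]
  have h1 : ∀ x, co F x * co G (z - x) = ∑ᶠ p, Φ (x, p) := fun x => by
    rw [hF.co_eq, hG.co_eq, finsum_mul_finsum (finite_support_ite (hF.finite _))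
      (finite_support_ite (hG.finite _))]
  rw [finsum_congr h1, ← finsum_curry Φ hΦ,
    ← finsum_comp_equiv (Equiv.prodComm (ι × κ) (ℤ × ℤ)), finsum_curry]
  · refine finsum_congr fun p => ?_
    rw [finsum_eq_single _ (e p.1)]
    · change (v p.1 * (if e p.1 = e p.1 then 1 else 0)) *
        (v' p.2 * (if e' p.2 = z - e p.1 then 1 else 0)) = _
      rw [if_pos rfl, mul_one, ← mul_assoc]
      congr 1
      exact if_congr (by rw [eq_sub_iff_add_eq, add_comm]) rfl rfl
    · intro x hx
      change (v p.1 * (if e p.1 = x then 1 else 0)) * _ = 0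
      rw [if_neg (Ne.symm hx), mul_zero, zero_mul]
  · exact hΦ.preimage (Equiv.injective _).injOn

theorem IsMonoSum.eulerD {ι : Type*} {e : ι → ℤ × ℤ} {v : ι → R} {F : DoubleLaurent R}
    (h : IsMonoSum e v F) (ℓ : ℤ × ℤ →+ ℤ) :
    IsMonoSum e (fun p => (ℓ (e p) : R) * v p) (eulerD ℓ F) where
  finite z := (h.finite z).subset fun p hp => ⟨right_ne_zero_of_mul hp.1, hp.2⟩
  co_eq z := by
    rw [co_eulerD, h.co_eq, mul_finsum' _ _ (finite_support_ite (h.finite z))]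
    refine finsum_congr fun p => ?_
    split_ifs with hp
    · rw [hp, mul_assoc]
    · simp

theorem finite_support_curry {α β : Type*} {f : α × β → R} (hf : (Function.support f).Finite) :
    (Function.support fun a => ∑ᶠ b, f (a, b)).Finite := by
  refine (hf.image Prod.fst).subset fun a ha => ?_
  by_contra hc
  refine ha ((finsum_congr fun b => ?_).trans finsum_zero)
  by_contra hb
  exact hc ⟨(a, b), hb, rfl⟩

variable [Algebra ℚ R]

/-- The coefficients of the monomials in the logarithm of a product decomposition. -/
def logFam (a : Idx → R) (p : Idx × ℕ) : R := -(invSucc R p.2 * a p.1 ^ (p.2 + 1))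

theorem pow_ne_zero_of_logFam {a : Idx → R} {p : Idx × ℕ} (h : logFam a p ≠ 0) :
    a p.1 ^ (p.2 + 1) ≠ 0 := fun h0 => h (by rw [logFam, h0, mul_zero, neg_zero])

theorem isMonoSum_logOf (hR : IsNilpotent (nilradical R)) (f : (DoubleLaurent R)ˣ) :
    IsMonoSum pex (logFam (factorCoeff f)) (logOf f) where
  finite z := (finite_pex_fiber z).subset fun p hp => hp.2
  co_eq z := by
    rw [co_logOf hR, ← finsum_neg_distrib]
    refine finsum_congr fun p => ?_
    rw [logTerm, logFam]
    split_ifs <;> simp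

theorem finite_logFam_pairs (hR : IsNilpotent (nilradical R)) (f g : (DoubleLaurent R)ˣ)
    (z : ℤ × ℤ) : {p : (Idx × ℕ) × (Idx × ℕ) | logFam (factorCoeff f) p.1 ≠ 0 ∧
      logFam (factorCoeff g) p.2 ≠ 0 ∧ pex p.1 + pex p.2 = z}.Finite := by
  have h1 := finite_triples (isBdd_powSupp hR f) (isBdd_powSupp hR g) (C := {-z})
    ⟨-z.1, fun _ => -z.2, by simp⟩
  refine (h1.preimage' (f := fun w : (Idx × ℕ) × (Idx × ℕ) => (pex w.1, pex w.2, -z))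
    fun b _ => ?_).subset fun w hw => ⟨⟨w.1, pow_ne_zero_of_logFam hw.1, rfl⟩,
      ⟨w.2, pow_ne_zero_of_logFam hw.2.1, rfl⟩, rfl, ?_⟩
  · refine ((finite_pex_fiber b.1).prod (finite_pex_fiber b.2.1)).subset fun w hw => ?_
    have hw : (pex w.1, pex w.2, -z) = b := hw
    rw [← hw]
    exact ⟨rfl, rfl⟩
  · change pex w.1 + pex w.2 + -z = 0
    rw [hw.2.2, add_neg_cancel]

/-- `u ∂/∂u`. -/
abbrev dU (F : DoubleLaurent R) : DoubleLaurent R := eulerD (AddMonoidHom.snd ℤ ℤ) F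

/-- `t ∂/∂t`. -/
abbrev dT (F : DoubleLaurent R) : DoubleLaurent R := eulerD (AddMonoidHom.fst ℤ ℤ) F

/-- The double sum over powers of members of both families is regrouped: outside over the pair of
exponents, giving one elementary factor each, inside over the pair of powers. -/
theorem co_mul_eulerD_logOf (hR : IsNilpotent (nilradical R)) (f g : (DoubleLaurent R)ˣ)
    (ℓ : ℤ × ℤ →+ ℤ) {τ : Idx × Idx → ℕ × ℕ → R}
    (hτ : ∀ p : (Idx × ℕ) × (Idx × ℕ), logFam (factorCoeff f) p.1 *
      ((ℓ (pex p.2) : R) * logFam (factorCoeff g) p.2) * (if pex p.1 + pex p.2 = 0 then 1 else 0) =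
        τ (p.1.1, p.2.1) (p.1.2, p.2.2)) :
    (Function.support fun w => ∑ᶠ m, τ w m).Finite ∧
      co (logOf f * eulerD ℓ (logOf g)) 0 = ∑ᶠ w, ∑ᶠ m, τ w m := by
  have hsupp : (Function.support fun w : (Idx × Idx) × (ℕ × ℕ) => τ w.1 w.2).Finite := by
    refine ((finite_logFam_pairs hR f g 0).image (Equiv.prodProdProdComm Idx ℕ Idx ℕ)).subset
      fun w hw => ⟨((w.1.1, w.2.1), (w.1.2, w.2.2)), ?_, rfl⟩
    have hw : τ w.1 w.2 ≠ 0 := hw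
    rw [← hτ ((w.1.1, w.2.1), (w.1.2, w.2.2))] at hw
    refine ⟨left_ne_zero_of_mul (left_ne_zero_of_mul hw),
      right_ne_zero_of_mul (right_ne_zero_of_mul (left_ne_zero_of_mul hw)), ?_⟩
    by_contra hc
    exact right_ne_zero_of_mul hw (if_neg hc)
  refine ⟨finite_support_curry hsupp, ?_⟩
  rw [(isMonoSum_logOf hR f).mul ((isMonoSum_logOf hR g).eulerD ℓ) 0
    ((finite_logFam_pairs hR f g 0).subset fun p hp =>
      ⟨hp.1, right_ne_zero_of_mul hp.2.1, hp.2.2⟩),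
    ← finsum_curry (fun w : (Idx × Idx) × (ℕ × ℕ) => τ w.1 w.2) hsupp,
    ← finsum_comp_equiv (Equiv.prodProdProdComm Idx ℕ Idx ℕ)]
  exact finsum_congr fun p => hτ p

/-- The derivation contributes the factor `(t + 1) * l` at the power `t + 1` of `b`, which cancels
the denominator of that logarithm and leaves exactly `sTerm`. -/
theorem expU_co_mul_dU (hR : IsNilpotent (nilradical R)) (f g : (DoubleLaurent R)ˣ) :
    IsNilpotent (co (logOf f * dU (logOf g)) 0) ∧
      expU (co (logOf f * dU (logOf g)) 0) = ∏ᶠ w, sFamily f g w := by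
  obtain ⟨h1, h2⟩ := co_mul_eulerD_logOf hR f g (AddMonoidHom.snd ℤ ℤ)
    (τ := fun w m => sTerm w.1.1 w.2.1 (factorCoeff f w.1) (factorCoeff g w.2) m) fun p => by
      rw [sTerm]
      by_cases hp : pex p.1 + pex p.2 = 0
      · rw [if_pos hp, if_pos (show (p.1.2 + 1) • p.1.1.1 + (p.2.2 + 1) • p.2.1.1 = 0 from hp),
          AddMonoidHom.coe_snd, pex_snd, logFam, logFam]
        have := invSucc_mul (R := R) p.2.2
        push_cast
        linear_combination (invSucc R p.1.2 * factorCoeff f p.1.1 ^ (p.1.2 + 1) *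
          factorCoeff g p.2.1 ^ (p.2.2 + 1) * (p.2.1.1.2 : R)) * this
      · rw [if_neg hp, if_neg (show ¬(p.1.2 + 1) • p.1.1.1 + (p.2.2 + 1) • p.2.1.1 = 0 from hp),
          mul_zero]
  have hf := isFactorFamily_factorCoeff hR f
  have hg := isFactorFamily_factorCoeff hR g
  have h3 := fun w : Idx × Idx => expU_finsum_sTerm (x := w.1.1) (y := w.2.1)
    (a := factorCoeff f w.1) (b := factorCoeff g w.2)
    fun h => isNilpotent_sMon (hf.nilp _) (hg.nilp _) h
  rw [h2]
  refine ⟨isNilpotent_finsum fun w => (h3 w).1, ?_⟩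
  rw [expU_finsum (fun w => (h3 w).1) h1]
  exact finprod_congr fun w => (h3 w).2

theorem expU_co_mul_dT (hR : IsNilpotent (nilradical R)) (f g : (DoubleLaurent R)ˣ) :
    IsNilpotent (co (logOf f * dT (logOf g)) 0) ∧
      expU (co (logOf f * dT (logOf g)) 0) = (∏ᶠ w, qFamily f g w)⁻¹ := by
  obtain ⟨h1, h2⟩ := co_mul_eulerD_logOf hR f g (AddMonoidHom.fst ℤ ℤ)
    (τ := fun w m => sTerm w.1.1.swap w.2.1.swap (factorCoeff f w.1) (factorCoeff g w.2) m)
    fun p => by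
      have hsw : pex p.1 + pex p.2 = 0 ↔
          (p.1.2 + 1) • p.1.1.1.swap + (p.2.2 + 1) • p.2.1.1.swap = 0 := by
        rw [Prod.ext_iff, Prod.ext_iff, and_comm]; rfl
      rw [sTerm]
      by_cases hp : pex p.1 + pex p.2 = 0
      · rw [if_pos hp, if_pos (hsw.1 hp), AddMonoidHom.coe_fst, pex_fst, logFam, logFam,
          Prod.snd_swap]
        have := invSucc_mul (R := R) p.2.2
        push_cast
        linear_combination (invSucc R p.1.2 * factorCoeff f p.1.1 ^ (p.1.2 + 1) *
          factorCoeff g p.2.1 ^ (p.2.2 + 1) * (p.2.1.1.1 : R)) * this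
      · rw [if_neg hp, if_neg (mt hsw.2 hp), mul_zero]
  have hf := isFactorFamily_factorCoeff hR f
  have hg := isFactorFamily_factorCoeff hR g
  have h3 := fun w : Idx × Idx => expU_finsum_sTerm_swap (x := w.1.1) (y := w.2.1)
    (a := factorCoeff f w.1) (b := factorCoeff g w.2)
    fun h => isNilpotent_qMon (hf.nilp _) (hg.nilp _) h
  rw [h2]
  refine ⟨isNilpotent_finsum fun w => (h3 w).1, ?_⟩
  rw [expU_finsum (fun w => (h3 w).1) h1, ← finprod_inv_distrib]
  exact finprod_congr fun w => (h3 w).2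

/-- The regrouping `(Idx × ℕ)³ ≃ Idx³ × ℕ³`. -/
def tripleEquiv : (Idx × ℕ) × (Idx × ℕ) × (Idx × ℕ) ≃ (Idx × Idx × Idx) × (ℕ × ℕ × ℕ) where
  toFun w := ((w.1.1, w.2.1.1, w.2.2.1), (w.1.2, w.2.1.2, w.2.2.2))
  invFun w := ((w.1.1, w.2.1), (w.1.2.1, w.2.2.1), (w.1.2.2, w.2.2.2))
  left_inv _ := rfl
  right_inv _ := rfl

theorem co_mul_eulerD_mul_eulerD (hR : IsNilpotent (nilradical R)) (f g h : (DoubleLaurent R)ˣ)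
    (ℓ ℓ' : ℤ × ℤ →+ ℤ) :
    (Function.support fun w : (Idx × ℕ) × (Idx × ℕ) × (Idx × ℕ) => logFam (factorCoeff f) w.1 *
      (((ℓ (pex w.2.1) : R) * logFam (factorCoeff g) w.2.1) *
        ((ℓ' (pex w.2.2) : R) * logFam (factorCoeff h) w.2.2)) *
      (if pex w.1 + (pex w.2.1 + pex w.2.2) = 0 then 1 else 0)).Finite ∧
    co (logOf f * (eulerD ℓ (logOf g) * eulerD ℓ' (logOf h))) 0 =
      ∑ᶠ w : (Idx × ℕ) × (Idx × ℕ) × (Idx × ℕ), logFam (factorCoeff f) w.1 *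
      (((ℓ (pex w.2.1) : R) * logFam (factorCoeff g) w.2.1) *
        ((ℓ' (pex w.2.2) : R) * logFam (factorCoeff h) w.2.2)) *
      (if pex w.1 + (pex w.2.1 + pex w.2.2) = 0 then 1 else 0) := by
  have hfin : {w : (Idx × ℕ) × (Idx × ℕ) × (Idx × ℕ) | logFam (factorCoeff f) w.1 ≠ 0 ∧
      ((ℓ (pex w.2.1) : R) * logFam (factorCoeff g) w.2.1) *
        ((ℓ' (pex w.2.2) : R) * logFam (factorCoeff h) w.2.2) ≠ 0 ∧
      pex w.1 + (pex w.2.1 + pex w.2.2) = 0}.Finite :=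
    (finite_pow_triples hR f g h).subset fun w hw => ⟨pow_ne_zero_of_logFam hw.1,
      pow_ne_zero_of_logFam (right_ne_zero_of_mul (left_ne_zero_of_mul hw.2.1)),
      pow_ne_zero_of_logFam (right_ne_zero_of_mul (right_ne_zero_of_mul hw.2.1)),
      by rw [add_assoc]; exact hw.2.2⟩
  constructor
  · refine hfin.subset fun w hw => ⟨left_ne_zero_of_mul (left_ne_zero_of_mul hw),
      right_ne_zero_of_mul (left_ne_zero_of_mul hw), ?_⟩
    by_contra hc
    exact right_ne_zero_of_mul hw (if_neg hc)
  · have hpair : ∀ z, {p : (Idx × ℕ) × (Idx × ℕ) |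
        (ℓ (pex p.1) : R) * logFam (factorCoeff g) p.1 ≠ 0 ∧
        (ℓ' (pex p.2) : R) * logFam (factorCoeff h) p.2 ≠ 0 ∧ pex p.1 + pex p.2 = z}.Finite :=
      fun z => (finite_logFam_pairs hR g h z).subset fun p hp =>
        ⟨right_ne_zero_of_mul hp.1, right_ne_zero_of_mul hp.2.1, hp.2.2⟩
    have hGH : IsMonoSum (fun p : (Idx × ℕ) × (Idx × ℕ) => pex p.1 + pex p.2)
        (fun p => ((ℓ (pex p.1) : R) * logFam (factorCoeff g) p.1) *
          ((ℓ' (pex p.2) : R) * logFam (factorCoeff h) p.2))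
        (eulerD ℓ (logOf g) * eulerD ℓ' (logOf h)) :=
      ⟨fun z => (hpair z).subset fun p hp =>
        ⟨left_ne_zero_of_mul hp.1, right_ne_zero_of_mul hp.1, hp.2⟩,
        fun z => ((isMonoSum_logOf hR g).eulerD ℓ).mul ((isMonoSum_logOf hR h).eulerD ℓ') z
          (hpair z)⟩
    exact (isMonoSum_logOf hR f).mul hGH 0 hfin

/-- The two products of derivations combine into the determinant of the exponents of `g` and `h`;
the denominators of their logarithms cancel, leaving `tTerm`. -/
theorem expU_co_mul_dU_mul_dT (hR : IsNilpotent (nilradical R)) (f g h : (DoubleLaurent R)ˣ) :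
    IsNilpotent (co (logOf f *
        (dU (logOf g) * dT (logOf h) - dU (logOf h) * dT (logOf g))) 0) ∧
      expU (co (logOf f *
        (dU (logOf g) * dT (logOf h) - dU (logOf h) * dT (logOf g))) 0) = tProd f g h := by
  obtain ⟨h1, h2⟩ := co_mul_eulerD_mul_eulerD hR f g h (AddMonoidHom.snd ℤ ℤ)
    (AddMonoidHom.fst ℤ ℤ)
  obtain ⟨h3, h4⟩ := co_mul_eulerD_mul_eulerD hR f g h (AddMonoidHom.fst ℤ ℤ)
    (AddMonoidHom.snd ℤ ℤ)
  have hsum : co (logOf f * (dU (logOf g) * dT (logOf h) - dU (logOf h) * dT (logOf g))) 0 =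
      ∑ᶠ w : (Idx × ℕ) × (Idx × ℕ) × (Idx × ℕ), tTerm w.1.1.1 w.2.1.1.1 w.2.2.1.1
        (factorCoeff f w.1.1) (factorCoeff g w.2.1.1) (factorCoeff h w.2.2.1)
        (w.1.2, w.2.1.2, w.2.2.2) := by
    rw [mul_sub, co_sub, h2, mul_comm (dU (logOf h)), h4, ← finsum_sub_distrib h1 h3]
    refine finsum_congr fun w => ?_
    have hiff : pex w.1 + (pex w.2.1 + pex w.2.2) = 0 ↔ (w.1.2 + 1) • w.1.1.1 +
        (w.2.1.2 + 1) • w.2.1.1.1 + (w.2.2.2 + 1) • w.2.2.1.1 = 0 := by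
      rw [← add_assoc]; rfl
    rw [tTerm]
    by_cases hw : pex w.1 + (pex w.2.1 + pex w.2.2) = 0
    · rw [if_pos hw, if_pos (hiff.1 hw), AddMonoidHom.coe_fst, AddMonoidHom.coe_snd, pex_fst,
        pex_fst, pex_snd, pex_snd, logFam, logFam, logFam, det2]
      have e1 := invSucc_mul (R := R) w.2.1.2
      have e2 := invSucc_mul (R := R) w.2.2.2
      push_cast
      have e3 : (invSucc R w.2.1.2 * ((w.2.1.2 : R) + 1)) *
        (invSucc R w.2.2.2 * ((w.2.2.2 : R) + 1)) = 1 := by rw [e1, e2, one_mul]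
      linear_combination (-(invSucc R w.1.2 * factorCoeff f w.1.1 ^ (w.1.2 + 1) *
        factorCoeff g w.2.1.1 ^ (w.2.1.2 + 1) * factorCoeff h w.2.2.1 ^ (w.2.2.2 + 1) *
        ((w.2.1.1.1.2 : R) * (w.2.2.1.1.1 : R) - (w.2.2.1.1.2 : R) * (w.2.1.1.1.1 : R)))) * e3
    · rw [if_neg hw, if_neg (mt hiff.2 hw), mul_zero, mul_zero, sub_zero]
  have hsupp : (Function.support fun w : (Idx × Idx × Idx) × (ℕ × ℕ × ℕ) =>
      tTerm w.1.1.1 w.1.2.1.1 w.1.2.2.1 (factorCoeff f w.1.1) (factorCoeff g w.1.2.1)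
        (factorCoeff h w.1.2.2) w.2).Finite := by
    refine ((finite_pow_triples hR f g h).image tripleEquiv).subset fun w hw =>
      ⟨tripleEquiv.symm w, ?_, tripleEquiv.apply_symm_apply w⟩
    have hw : tTerm w.1.1.1 w.1.2.1.1 w.1.2.2.1 (factorCoeff f w.1.1) (factorCoeff g w.1.2.1)
        (factorCoeff h w.1.2.2) w.2 ≠ 0 := hw
    rw [tTerm] at hw
    have hr : (w.2.1 + 1) • w.1.1.1 + (w.2.2.1 + 1) • w.1.2.1.1 + (w.2.2.2 + 1) • w.1.2.2.1 = 0 := by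
      by_contra hc; exact hw (if_neg hc)
    rw [if_pos hr, neg_ne_zero] at hw
    have k1 := left_ne_zero_of_mul hw
    have k2 := left_ne_zero_of_mul k1
    exact ⟨right_ne_zero_of_mul (left_ne_zero_of_mul k2), right_ne_zero_of_mul k2,
      right_ne_zero_of_mul k1, hr⟩
  have hf := isFactorFamily_factorCoeff hR f
  have hg := isFactorFamily_factorCoeff hR g
  have hh := isFactorFamily_factorCoeff hR h
  have k := fun w : Idx × Idx × Idx => expU_finsum_tTerm (x := w.1.1) (y := w.2.1.1) (z := w.2.2.1)
    (a := factorCoeff f w.1) (b := factorCoeff g w.2.1) (c := factorCoeff h w.2.2)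
    fun h => isNilpotent_tMon (hf.nilp _) (hg.nilp _) (hh.nilp _) h
  have hsum2 : co (logOf f * (dU (logOf g) * dT (logOf h) - dU (logOf h) * dT (logOf g))) 0 =
      ∑ᶠ (w : Idx × Idx × Idx) (m : ℕ × ℕ × ℕ), tTerm w.1.1 w.2.1.1 w.2.2.1
        (factorCoeff f w.1) (factorCoeff g w.2.1) (factorCoeff h w.2.2) m := by
    rw [hsum, ← finsum_curry (fun w : (Idx × Idx × Idx) × (ℕ × ℕ × ℕ) =>
      tTerm w.1.1.1 w.1.2.1.1 w.1.2.2.1 (factorCoeff f w.1.1) (factorCoeff g w.1.2.1)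
        (factorCoeff h w.1.2.2) w.2) hsupp, ← finsum_comp_equiv tripleEquiv]
    rfl
  rw [hsum2]
  refine ⟨isNilpotent_finsum fun w => (k w).1, ?_⟩
  rw [expU_finsum (fun w => (k w).1) (finite_support_curry hsupp)]
  exact finprod_congr fun w => (k w).2

end

/-! ### Logarithmic derivatives of units, the symbol as an exponential, multiplicativity -/

section

variable {R : Type u} [CommRing R]

/-! ### Logarithmic derivatives of units -/

theorem eulerD_eq_mul_mul {ℓ : ℤ × ℤ →+ ℤ} {F G a b : DoubleLaurent R} (hF : eulerD ℓ F = a * F)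
    (hG : eulerD ℓ G = b * G) : eulerD ℓ (F * G) = (a + b) * (F * G) := by
  rw [eulerD_mul, hF, hG]; ring

theorem eulerD_powAlong (ℓ : ℤ × ℤ →+ ℤ) {a : (DoubleLaurent R)ˣ} {x : ℤ × ℤ}
    (ha : ∀ k : ℤ, ((a ^ k : (DoubleLaurent R)ˣ) : DoubleLaurent R) = mono (k • x) 1)
    (n : ZConst R) : eulerD ℓ (powAlong (constHom R) a n : DoubleLaurent R) =
      constHom R (zval n * (ℓ x : R)) * (powAlong (constHom R) a n : DoubleLaurent R) := by
  refine eq_of_idem_mul_eq (constHom R) n fun k => ?_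
  have h1 := idem_mul_powAlong (constHom R) a n k
  have h2 : constHom R (idem n k) * constHom R (zval n) =
      constHom R (idem n k) * constHom R (k : R) := by rw [← map_mul, idem_mul_zval, map_mul]
  have h3 : constHom R (ℓ (k • x) : R) = constHom R (k : R) * constHom R (ℓ x : R) := by
    rw [← map_mul, map_zsmul, smul_eq_mul, Int.cast_mul]
  rw [← eulerD_constHom_mul, h1, eulerD_constHom_mul, ha, eulerD_mono, h3, map_mul]
  rw [ha] at h1
  linear_combination (-constHom R (ℓ x : R) * (powAlong (constHom R) a n : DoubleLaurent R)) * h2 -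
    (constHom R (ℓ x : R) * constHom R (k : R)) * h1

theorem eulerD_uPow (ℓ : ℤ × ℤ →+ ℤ) (n : ZConst R) : eulerD ℓ (uPow n : DoubleLaurent R) =
    constHom R (zval n * (ℓ (0, 1) : R)) * (uPow n : DoubleLaurent R) :=
  eulerD_powAlong ℓ (fun k => by rw [uUnit_zpow]; simp) n

theorem eulerD_tPow (ℓ : ℤ × ℤ →+ ℤ) (n : ZConst R) : eulerD ℓ (tPow n : DoubleLaurent R) =
    constHom R (zval n * (ℓ (1, 0) : R)) * (tPow n : DoubleLaurent R) :=
  eulerD_powAlong ℓ (fun k => by rw [tUnit_zpow]; simp) n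

theorem derivU_eq (f : DoubleLaurent R) : derivU f = mono (0, -1) 1 * dU f :=
  ext_co fun x => by
    rw [co_mono_mul, one_mul, dU, co_eulerD]
    simp only [co, derivU, AddMonoidHom.coe_snd]
    simp [cf]

theorem derivT_eq (f : DoubleLaurent R) : derivT f = mono (-1, 0) 1 * dT f :=
  ext_co fun x => by
    rw [co_mono_mul, one_mul, dT, co_eulerD]
    simp only [co, derivT, LaurentSeries.derivative_apply, cf,
      LaurentSeries.hasseDeriv_coeff, AddMonoidHom.coe_fst]
    refine (map_zsmul (HahnSeries.coeff.addMonoidHom x.2) _ _).trans ?_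
    simp

/-- The partial derivatives are the Euler derivations divided by `u` and by `t`, so a residue at
`u⁻¹ t⁻¹` becomes a constant coefficient of logarithmic Euler derivatives. -/
theorem res_mul_dlogWedge (F A B A' B' : DoubleLaurent R) (g h : (DoubleLaurent R)ˣ)
    (hA : dU (g : DoubleLaurent R) = A * g) (hB : dT (g : DoubleLaurent R) = B * g)
    (hA' : dU (h : DoubleLaurent R) = A' * h) (hB' : dT (h : DoubleLaurent R) = B' * h) :
    res (F * dlogWedge g h) = co (F * (A * B' - A' * B)) 0 := by
  have h1 : F * dlogWedge g h = mono (-1, -1) 1 * (F * (A * B' - A' * B)) := by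
    have hm : mono (0, -1) 1 * mono (-1, 0) (1 : R) = mono (-1, -1) 1 := by
      rw [mono_mul, one_mul]; rfl
    have hu : ((g⁻¹ * h⁻¹ : (DoubleLaurent R)ˣ) : DoubleLaurent R) * (g * h) = 1 := by
      rw [Units.val_mul]
      linear_combination (↑h⁻¹ * (h : DoubleLaurent R)) * g.inv_mul + h.inv_mul
    rw [dlogWedge, derivU_eq, derivU_eq, derivT_eq, derivT_eq, hA, hB, hA', hB', ← hm]
    linear_combination (F * mono (0, -1) 1 * mono (-1, 0) (1 : R) * (A * B' - A' * B)) * hu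
  rw [h1, res, cf_eq_co, co_mono_mul, one_mul]
  rfl

/-! ### The symbol in terms of logarithms -/

variable [Algebra ℚ R]

/-- Logarithmic derivatives add over the splitting: the constant contributes `0`, the monomial its
locally constant exponents, and `f₋₁ * f₁` the derivative of its logarithm. -/
theorem eulerD_unit (hR : IsNilpotent (nilradical R)) (ℓ : ℤ × ℤ →+ ℤ) (f : (DoubleLaurent R)ˣ) :
    eulerD ℓ (f : DoubleLaurent R) = (constHom R (zval (nu2 f) * (ℓ (0, 1) : R) +
      zval (nu1 f) * (ℓ (1, 0) : R)) + eulerD ℓ (logOf f)) * f := by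
  have hs := isSplitting_splitting hR f
  have h0 : eulerD ℓ (constUnit (splitting f).unit : DoubleLaurent R) =
      0 * (constUnit (splitting f).unit : DoubleLaurent R) := by
    rw [zero_mul]; exact eulerD_constHom ℓ _
  have h1 := eulerD_eq_mul_mul (eulerD_eq_mul_mul (eulerD_eq_mul_mul h0
    (eulerD_uPow ℓ (splitting f).n2)) (eulerD_tPow ℓ (splitting f).n1))
    ((isLog_logOf hR f).eulerD_mul ℓ).symm
  have h2 : (f : DoubleLaurent R) = (constUnit (splitting f).unit : DoubleLaurent R) *
      (uPow (splitting f).n2 : DoubleLaurent R) * (tPow (splitting f).n1 : DoubleLaurent R) *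
      ((splitting f).neg * (splitting f).pos) := by
    rw [hs.eq, Units.val_mul, Units.val_mul]; ring
  rw [← h2, zero_add, ← map_add] at h1
  exact h1

theorem dU_unit (hR : IsNilpotent (nilradical R)) (f : (DoubleLaurent R)ˣ) :
    dU (f : DoubleLaurent R) = (constHom R (zval (nu2 f)) + dU (logOf f)) * f := by
  have := eulerD_unit hR (AddMonoidHom.snd ℤ ℤ) f
  simpa using this

theorem dT_unit (hR : IsNilpotent (nilradical R)) (f : (DoubleLaurent R)ˣ) :
    dT (f : DoubleLaurent R) = (constHom R (zval (nu1 f)) + dT (logOf f)) * f := by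
  have := eulerD_unit hR (AddMonoidHom.fst ℤ ℤ) f
  simpa using this

/-- The logarithm of the part of the symbol given by the factors `T`, `S` and `Q`, for units with
exponents `(m₁, n₁)`, `(m₂, n₂)`, `(m₃, n₃)` and logarithms `F`, `G`, `H`. -/
def logSymbol (m₁ n₁ m₂ n₂ m₃ n₃ : R) (F G H : DoubleLaurent R) : R :=
  co (F * (dU G * dT H - dU H * dT G)) 0 + m₃ * co (F * dU G) 0 - n₃ * co (F * dT G) 0 +
    m₂ * co (H * dU F) 0 - n₂ * co (H * dT F) 0 + m₁ * co (G * dU H) 0 - n₁ * co (G * dT H) 0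

/-- The logarithm of the part of the symbol given by the factors `T`, `S` and `Q`. -/
def logSym (f g h : (DoubleLaurent R)ˣ) : R :=
  logSymbol (zval (nu1 f)) (zval (nu2 f)) (zval (nu1 g)) (zval (nu2 g)) (zval (nu1 h))
    (zval (nu2 h)) (logOf f) (logOf g) (logOf h)

theorem sProd_eq_expU (hR : IsNilpotent (nilradical R)) (f g : (DoubleLaurent R)ˣ)
    (n : ZConst R) : IsNilpotent (zval n * co (logOf f * dU (logOf g)) 0) ∧
      sProd f g n = expU (zval n * co (logOf f * dU (logOf g)) 0) := by
  obtain ⟨h1, h2⟩ := expU_co_mul_dU hR f g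
  exact ⟨(Commute.all _ _).isNilpotent_mul_left h1, by
    rw [sProd_eq hR, ← h2, lpow_expU h1]⟩

theorem qProd_eq_expU (hR : IsNilpotent (nilradical R)) (f g : (DoubleLaurent R)ˣ)
    (n : ZConst R) : IsNilpotent (-(zval n * co (logOf f * dT (logOf g)) 0)) ∧
      qProd f g n = expU (-(zval n * co (logOf f * dT (logOf g)) 0)) := by
  obtain ⟨h1, h2⟩ := expU_co_mul_dT hR f g
  have h3 : IsNilpotent (zval n * co (logOf f * dT (logOf g)) 0) :=
    (Commute.all _ _).isNilpotent_mul_left h1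
  refine ⟨h3.neg, ?_⟩
  rw [qProd_eq hR, ← inv_inv (∏ᶠ w, qFamily f g w), ← h2, lpow_inv, lpow_expU h1, expU_neg h3]

/-- The seven products over `T`, `S`, `Q` are the exponentials of the seven summands of `logSymbol`,
each nilpotent on its own. -/
theorem explicitSymbol_eq_expU (hR : IsNilpotent (nilradical R)) (f g h : (DoubleLaurent R)ˣ) :
    IsNilpotent (logSym f g h) ∧ explicitSymbol f g h = lpow (-1) (signExp f g h) *
      lpow (lead f) (nu g h) * lpow (lead g) (nu h f) * lpow (lead h) (nu f g) *
      expU (logSym f g h) := by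
  obtain ⟨t1, t2⟩ := expU_co_mul_dU_mul_dT hR f g h
  obtain ⟨a1, a2⟩ := sProd_eq_expU hR f g (nu1 h)
  obtain ⟨b1, b2⟩ := qProd_eq_expU hR f g (nu2 h)
  obtain ⟨c1, c2⟩ := sProd_eq_expU hR h f (nu1 g)
  obtain ⟨d1, d2⟩ := qProd_eq_expU hR h f (nu2 g)
  obtain ⟨e1, e2⟩ := sProd_eq_expU hR g h (nu1 f)
  obtain ⟨f1, f2⟩ := qProd_eq_expU hR g h (nu2 f)
  have n1 := isNilpotent_add t1 a1
  have n2 := isNilpotent_add n1 b1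
  have n3 := isNilpotent_add n2 c1
  have n4 := isNilpotent_add n3 d1
  have n5 := isNilpotent_add n4 e1
  have n6 := isNilpotent_add n5 f1
  have hl : logSym f g h = co (logOf f *
        (dU (logOf g) * dT (logOf h) - dU (logOf h) * dT (logOf g))) 0 +
      zval (nu1 h) * co (logOf f * dU (logOf g)) 0 +
      -(zval (nu2 h) * co (logOf f * dT (logOf g)) 0) +
      zval (nu1 g) * co (logOf h * dU (logOf f)) 0 +
      -(zval (nu2 g) * co (logOf h * dT (logOf f)) 0) +
      zval (nu1 f) * co (logOf g * dU (logOf h)) 0 +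
      -(zval (nu2 f) * co (logOf g * dT (logOf h)) 0) := by
    simp only [logSym, logSymbol, sub_eq_add_neg]
  rw [hl]
  refine ⟨n6, ?_⟩
  rw [expU_add n5 f1, expU_add n4 e1, expU_add n3 d1, expU_add n2 c1, expU_add n1 b1,
    expU_add t1 a1, explicitSymbol_eq, t2, a2, b2, c2, d2, e2, f2]
  simp only [mul_assoc]

/-! ### Multiplicativity -/

omit [Algebra ℚ R] in
theorem isSplitting_mul (hR : IsNilpotent (nilradical R)) (f g : (DoubleLaurent R)ˣ) :
    IsSplitting (f * g) ⟨(splitting f).neg * (splitting g).neg, lead f * lead g, nu2 f + nu2 g,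
      nu1 f + nu1 g, (splitting f).pos * (splitting g).pos⟩ := by
  have hf := isSplitting_splitting hR f
  have hg := isSplitting_splitting hR g
  refine ⟨mul_sub_one_mem_pSet hR hf.neg_mem hg.neg_mem, mul_sub_one_mem_mSet hf.pos_mem hg.pos_mem,
    ?_⟩
  rw [Units.val_mul, hf.eq, hg.eq]
  simp only [uPow_add, tPow_add, Units.val_mul]
  have : (constUnit (lead f * lead g) : DoubleLaurent R) =
      (constUnit (lead f) : DoubleLaurent R) * (constUnit (lead g) : DoubleLaurent R) := by
    rw [← Units.val_mul]; exact congrArg Units.val (map_mul (Units.map _) _ _)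
  rw [this]
  simp only [lead, nu1, nu2]
  ring

omit [Algebra ℚ R] in
theorem lead_mul (hR : IsNilpotent (nilradical R)) (f g : (DoubleLaurent R)ˣ) :
    lead (f * g) = lead f * lead g :=
  congrArg Splitting.unit ((isSplitting_mul hR f g).splitting_eq hR)

omit [Algebra ℚ R] in
theorem nu1_mul (hR : IsNilpotent (nilradical R)) (f g : (DoubleLaurent R)ˣ) :
    nu1 (f * g) = nu1 f + nu1 g :=
  congrArg Splitting.n1 ((isSplitting_mul hR f g).splitting_eq hR)

omit [Algebra ℚ R] in
theorem nu2_mul (hR : IsNilpotent (nilradical R)) (f g : (DoubleLaurent R)ˣ) :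
    nu2 (f * g) = nu2 f + nu2 g :=
  congrArg Splitting.n2 ((isSplitting_mul hR f g).splitting_eq hR)

omit [Algebra ℚ R] in
theorem nu_mul_left (hR : IsNilpotent (nilradical R)) (f f' g : (DoubleLaurent R)ˣ) :
    nu (f * f') g = nu f g + nu f' g := by
  simp only [nu, nu1_mul hR, nu2_mul hR]; ring

omit [Algebra ℚ R] in
theorem nu_mul_right (hR : IsNilpotent (nilradical R)) (f g g' : (DoubleLaurent R)ˣ) :
    nu f (g * g') = nu f g + nu f g' := by
  simp only [nu, nu1_mul hR, nu2_mul hR]; ring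

/-- Splittings multiply factorwise, and the sum of two logarithms satisfies the equations of a
logarithm of the product. This avoids any manipulation of the logarithmic series. -/
theorem logOf_mul (hR : IsNilpotent (nilradical R)) (f g : (DoubleLaurent R)ˣ) :
    logOf (f * g) = logOf f + logOf g := by
  have hs := isSplitting_splitting hR (f * g)
  refine (isLog_logOf hR (f * g)).unique (isUnit_of_sub_one_mem hR hs.neg_mem hs.pos_mem) ?_
  rw [(isSplitting_mul hR f g).splitting_eq hR]
  have h := (isLog_logOf hR f).mul (isLog_logOf hR g)
  rwa [mul_mul_mul_comm] at h

-- Modulo `2` the exponent `A` is additive in `f`, although it has terms quadratic and cubic in the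
-- `nu`; this is verified on all parities of the eight exponents.
omit [Algebra ℚ R] in
theorem lpow_signExp_mul (hR : IsNilpotent (nilradical R)) (f f' g h : (DoubleLaurent R)ˣ) :
    lpow (-1 : Rˣ) (signExp (f * f') g h) =
      lpow (-1) (signExp f g h) * lpow (-1) (signExp f' g h) := by
  rw [← lpow_add]
  refine lpow_neg_one_congr fun p => ?_
  simp only [signExp, nu, nu1_mul hR, nu2_mul hR, LocallyConstant.add_apply,
    LocallyConstant.mul_apply, LocallyConstant.sub_apply]
  push_cast
  generalize ((nu1 f) p : ZMod 2) = a
  generalize ((nu2 f) p : ZMod 2) = a'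
  generalize ((nu1 f') p : ZMod 2) = b
  generalize ((nu2 f') p : ZMod 2) = b'
  generalize ((nu1 g) p : ZMod 2) = c
  generalize ((nu2 g) p : ZMod 2) = c'
  generalize ((nu1 h) p : ZMod 2) = d
  generalize ((nu2 h) p : ZMod 2) = d'
  revert a a' b b' c c' d d'
  decide

omit [Algebra ℚ R] in
theorem logSymbol_add (m m' n n' m₂ n₂ m₃ n₃ : R) (F F' G H : DoubleLaurent R) :
    logSymbol (m + m') (n + n') m₂ n₂ m₃ n₃ (F + F') G H =
      logSymbol m n m₂ n₂ m₃ n₃ F G H + logSymbol m' n' m₂ n₂ m₃ n₃ F' G H := by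
  simp only [logSymbol, dU, dT, map_add, add_mul, mul_add, co_add]
  ring

/-- The sign, the powers of leading constants and `logSym` are separately additive or multiplicative
in `f`. The factor coefficients of `f * f'` are never compared with those of `f` and `f'`. -/
theorem explicitSymbol_mul (hR : IsNilpotent (nilradical R)) (f f' g h : (DoubleLaurent R)ˣ) :
    explicitSymbol (f * f') g h = explicitSymbol f g h * explicitSymbol f' g h := by
  obtain ⟨h1, h2⟩ := explicitSymbol_eq_expU hR f g h
  obtain ⟨h3, h4⟩ := explicitSymbol_eq_expU hR f' g h
  have hl : logSym (f * f') g h = logSym f g h + logSym f' g h := by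
    simp only [logSym, logOf_mul hR, nu1_mul hR, nu2_mul hR, zval_add, logSymbol_add]
  rw [(explicitSymbol_eq_expU hR (f * f') g h).2, h2, h4, hl, expU_add h1 h3,
    lpow_signExp_mul hR, lead_mul hR, lpow_mul, nu_mul_right hR, nu_mul_left hR, lpow_add, lpow_add]
  ac_rfl

theorem isTrimultiplicative_explicitSymbol (hR : IsNilpotent (nilradical R)) :
    IsTrimultiplicative (explicitSymbol (R := R)) where
  mul1 := explicitSymbol_mul hR
  mul2 f g g' h := by
    rw [← inv_inv (explicitSymbol f (g * g') h), ← explicitSymbol_swap12, explicitSymbol_mul hR,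
      mul_inv, ← explicitSymbol_swap12, ← explicitSymbol_swap12]
  mul3 f g h h' := by
    rw [← inv_inv (explicitSymbol f g (h * h')), ← isAntisymm_explicitSymbol.swap13,
      explicitSymbol_mul hR, mul_inv, ← isAntisymm_explicitSymbol.swap13,
      ← isAntisymm_explicitSymbol.swap13]

end

/-! ### The exp-Res description and uniqueness -/

section

variable {R : Type u} [CommRing R]

/-! ### The exp-Res description and uniqueness -/

theorem isSplitting_neg_mul_pos {f : (DoubleLaurent R)ˣ} {fm fp : DoubleLaurent R}
    (hm : fm - 1 ∈ pSet R) (hp : fp - 1 ∈ mSet R) (hf : (f : DoubleLaurent R) = fm * fp) :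
    IsSplitting f ⟨fm, 1, 0, 0, fp⟩ := by
  refine ⟨hm, hp, ?_⟩
  have h1 : (constUnit (1 : Rˣ) : (DoubleLaurent R)ˣ) = 1 := map_one (Units.map _)
  rw [hf, h1, uPow_zero, tPow_zero, mul_one, mul_one, Units.val_one, mul_one]

theorem one_sub_one_mem_pSet : (1 : DoubleLaurent R) - 1 ∈ pSet R := by
  rw [sub_self]; exact zero_mem_pSet

theorem one_sub_one_mem_mSet : (1 : DoubleLaurent R) - 1 ∈ mSet R := by
  rw [sub_self]; exact zero_mem_mSet

theorem isSplitting_constUnit (a : Rˣ) : IsSplitting (constUnit a) ⟨1, a, 0, 0, 1⟩ := by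
  refine ⟨one_sub_one_mem_pSet, one_sub_one_mem_mSet, ?_⟩
  rw [uPow_zero, tPow_zero, mul_one, mul_one, one_mul, mul_one]

theorem isSplitting_uPow_mul_tPow (j i : ZConst R) :
    IsSplitting (uPow j * tPow i) ⟨1, 1, j, i, 1⟩ := by
  refine ⟨one_sub_one_mem_pSet, one_sub_one_mem_mSet, ?_⟩
  have h1 : (constUnit (1 : Rˣ) : (DoubleLaurent R)ˣ) = 1 := map_one (Units.map _)
  rw [h1, one_mul, one_mul, mul_one]

/-- Integration by parts: an Euler derivative has constant coefficient `0`. -/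
theorem co_mul_eulerD_swap (ℓ : ℤ × ℤ →+ ℤ) (F G : DoubleLaurent R) :
    co (G * eulerD ℓ F) 0 = -co (F * eulerD ℓ G) 0 := by
  have h := co_eulerD ℓ (F * G) 0
  rw [map_zero, Int.cast_zero, zero_mul, eulerD_mul, co_add, mul_comm (eulerD ℓ F)] at h
  exact eq_neg_of_add_eq_zero_left h

theorem nu_eq_zero_left {f : (DoubleLaurent R)ˣ} (h1 : nu1 f = 0) (h2 : nu2 f = 0)
    (g : (DoubleLaurent R)ˣ) : nu f g = 0 := by
  rw [nu, h1, h2, zero_mul, mul_zero, sub_zero]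

theorem nu_eq_zero_right {f : (DoubleLaurent R)ˣ} (h1 : nu1 f = 0) (h2 : nu2 f = 0)
    (g : (DoubleLaurent R)ˣ) : nu g f = 0 := by
  rw [nu_swap, nu_eq_zero_left h1 h2, neg_zero]

theorem signExp_eq_zero {f : (DoubleLaurent R)ˣ} (h1 : nu1 f = 0) (h2 : nu2 f = 0)
    (g h : (DoubleLaurent R)ˣ) : signExp f g h = 0 := by
  rw [signExp, nu_eq_zero_left h1 h2, nu_eq_zero_left h1 h2, nu_eq_zero_right h1 h2,
    nu_eq_zero_right h1 h2]
  ring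

variable [Algebra ℚ R]

theorem logSeries_one : logSeries (1 : DoubleLaurent R) = 0 :=
  (isLog_logSeries_pos one_sub_one_mem_mSet).1.unique isUnit_one isLog_one

theorem explicitSymbol_constUnit (hR : IsNilpotent (nilradical R)) (a : Rˣ)
    (g h : (DoubleLaurent R)ˣ) : explicitSymbol (constUnit a) g h = lpow a (nu g h) := by
  have hs := (isSplitting_constUnit a).splitting_eq hR
  have h1 : nu1 (constUnit a) = 0 := congrArg Splitting.n1 hs
  have h2 : nu2 (constUnit a) = 0 := congrArg Splitting.n2 hs
  have h3 : lead (constUnit a) = a := congrArg Splitting.unit hs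
  have h4 : logOf (constUnit a) = 0 := by rw [logOf, hs]; simp [logSeries_one]
  have h5 : logSym (constUnit a) g h = 0 := by
    simp [logSym, logSymbol, h1, h2, h4, zval_zero, co_zero]
  rw [(explicitSymbol_eq_expU hR _ _ _).2, h5, expU_zero, signExp_eq_zero h1 h2,
    nu_eq_zero_left h1 h2, nu_eq_zero_right h1 h2, lpow_zero, lpow_zero, lpow_zero, h3, one_mul,
    mul_one, mul_one, mul_one]

theorem explicitSymbol_monomial (hR : IsNilpotent (nilradical R)) (j₁ i₁ j₂ i₂ j₃ i₃ : ZConst R) :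
    explicitSymbol (uPow j₁ * tPow i₁) (uPow j₂ * tPow i₂) (uPow j₃ * tPow i₃) =
      lpow (-1) (signExp (uPow j₁ * tPow i₁) (uPow j₂ * tPow i₂) (uPow j₃ * tPow i₃)) := by
  have hs := fun j i : ZConst R => (isSplitting_uPow_mul_tPow j i).splitting_eq hR
  have h3 : ∀ j i : ZConst R, lead (uPow j * tPow i) = 1 :=
    fun j i => congrArg Splitting.unit (hs j i)
  have h4 : ∀ j i : ZConst R, logOf (uPow j * tPow i) = 0 :=
    fun j i => by rw [logOf, hs]; simp [logSeries_one]
  have h5 : logSym (uPow j₁ * tPow i₁) (uPow j₂ * tPow i₂) (uPow j₃ * tPow i₃) = 0 := by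
    simp [logSym, logSymbol, h4, co_zero]
  rw [(explicitSymbol_eq_expU hR _ _ _).2, h5, expU_zero, h3, h3, h3, lpow_one_left,
    lpow_one_left, lpow_one_left, mul_one, mul_one, mul_one, mul_one]

/-- Inserting the logarithmic derivatives of `g` and `h` and expanding, the purely constant term
meets `co (logOf f) 0 = 0`. The remaining terms are those of `logSymbol` after integration by parts
in those where the derivative falls on `log f`; the terms with `ν₁ f` and `ν₂ f` are absent. -/
theorem logSym_eq_res (hR : IsNilpotent (nilradical R)) {f : (DoubleLaurent R)ˣ}
    (h1 : nu1 f = 0) (h2 : nu2 f = 0) (g h : (DoubleLaurent R)ˣ) :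
    logSym f g h = res (logOf f * dlogWedge g h) := by
  rw [res_mul_dlogWedge (logOf f) _ _ _ _ g h (dU_unit hR g) (dT_unit hR g) (dU_unit hR h)
    (dT_unit hR h)]
  have hF := (isLog_logOf hR f).co_zero
  simp only [logSym, logSymbol, h1, h2, zval_zero]
  set F := logOf f
  set U := dU (logOf g)
  set T := dT (logOf g)
  set U' := dU (logOf h)
  set T' := dT (logOf h)
  set a := zval (nu2 g)
  set b := zval (nu1 g)
  set a' := zval (nu2 h)
  set b' := zval (nu1 h)
  have e1 : F * ((constHom R a + U) * (constHom R b' + T') -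
      (constHom R a' + U') * (constHom R b + T)) =
      constHom R (a * b' - a' * b) * F + constHom R a * (F * T') + constHom R b' * (F * U) -
        constHom R a' * (F * T) - constHom R b * (F * U') + F * (U * T' - U' * T) := by
    rw [map_sub, map_mul, map_mul]; ring
  have e2 : co (logOf h * dU F) 0 = -co (F * U') 0 := co_mul_eulerD_swap _ _ _
  have e3 : co (logOf h * dT F) 0 = -co (F * T') 0 := co_mul_eulerD_swap _ _ _
  rw [e1, e2, e3]
  simp only [co_add, co_sub, constHom_co, hF]
  ring

theorem explicitSymbol_exp_res (hR : IsNilpotent (nilradical R)) (f g h : (DoubleLaurent R)ˣ)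
    (fm fp : DoubleLaurent R) (hm : fm - 1 ∈ pSet R) (hp : fp - 1 ∈ mSet R)
    (hf : (f : DoubleLaurent R) = fm * fp) :
    IsNilpotent (res ((logSeries fm + logSeries fp) * dlogWedge g h)) ∧
    (explicitSymbol f g h : R) =
      IsNilpotent.exp (res ((logSeries fm + logSeries fp) * dlogWedge g h)) := by
  have hs := (isSplitting_neg_mul_pos hm hp hf).splitting_eq hR
  have h1 : nu1 f = 0 := congrArg Splitting.n1 hs
  have h2 : nu2 f = 0 := congrArg Splitting.n2 hs
  have h3 : lead f = 1 := congrArg Splitting.unit hs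
  have h4 : logOf f = logSeries fm + logSeries fp := by rw [logOf, hs]
  obtain ⟨h5, h6⟩ := explicitSymbol_eq_expU hR f g h
  rw [← h4, ← logSym_eq_res hR h1 h2]
  refine ⟨h5, ?_⟩
  rw [h6, signExp_eq_zero h1 h2, nu_eq_zero_left h1 h2, nu_eq_zero_right h1 h2, h3, lpow_zero,
    lpow_zero, lpow_zero, lpow_one_left, one_mul, one_mul, one_mul, one_mul, expU_val h5]

theorem isExpResSymbol_explicitSymbol (hR : IsNilpotent (nilradical R)) :
    IsExpResSymbol (explicitSymbol (R := R)) where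
  trimul := isTrimultiplicative_explicitSymbol hR
  antisymm := isAntisymm_explicitSymbol
  exp_res := explicitSymbol_exp_res hR
  const := explicitSymbol_constUnit hR
  monomial := by
    rintro _ _ _ j₁ i₁ j₂ i₂ j₃ i₃ rfl rfl rfl
    exact explicitSymbol_monomial hR j₁ i₁ j₂ i₂ j₃ i₃

/-- The axioms fix the value when the first argument is a constant or lies in `(1 + 𝔭)(1 + 𝔪)`.
Anti-symmetry carries this to the other arguments, so by multiplicativity only triples of monomials
remain. -/
theorem IsExpResSymbol.unique (hR : IsNilpotent (nilradical R))
    {σ τ : (DoubleLaurent R)ˣ → (DoubleLaurent R)ˣ → (DoubleLaurent R)ˣ → Rˣ}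
    (hσ : IsExpResSymbol σ) (hτ : IsExpResSymbol τ) : σ = τ := by
  have hdec : ∀ f : (DoubleLaurent R)ˣ, ∃ (k : (DoubleLaurent R)ˣ) (j i : ZConst R),
      f = k * (uPow j * tPow i) ∧ ∀ g h, σ k g h = τ k g h := fun f => by
    have hs := isSplitting_splitting hR f
    obtain ⟨w, hw⟩ := isUnit_of_sub_one_mem hR hs.neg_mem hs.pos_mem
    refine ⟨constUnit (splitting f).unit * w, (splitting f).n2, (splitting f).n1, ?_, fun g h => ?_⟩
    · ext1
      rw [hs.eq]
      simp only [Units.val_mul, hw]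
      ring
    · rw [hσ.trimul.mul1, hτ.trimul.mul1, hσ.const, hτ.const]
      congr 1
      ext1
      rw [(hσ.exp_res w g h _ _ hs.neg_mem hs.pos_mem hw).2,
        (hτ.exp_res w g h _ _ hs.neg_mem hs.pos_mem hw).2]
  funext f g h
  obtain ⟨k₁, j₁, i₁, hf, e₁⟩ := hdec f
  obtain ⟨k₂, j₂, i₂, hg, e₂⟩ := hdec g
  obtain ⟨k₃, j₃, i₃, hh, e₃⟩ := hdec h
  rw [hf, hσ.trimul.mul1, hτ.trimul.mul1, e₁]
  congr 1
  rw [hg, hσ.trimul.mul2, hτ.trimul.mul2, hσ.antisymm.swap12 k₂, hτ.antisymm.swap12 k₂, e₂]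
  congr 1
  rw [hh, hσ.trimul.mul3, hτ.trimul.mul3, hσ.antisymm.swap13 k₃, hτ.antisymm.swap13 k₃, e₃]
  congr 1
  rw [hσ.monomial _ _ _ _ _ _ _ _ _ rfl rfl rfl, hτ.monomial _ _ _ _ _ _ _ _ _ rfl rfl rfl]

end

end ContouCarrere

end

theorem mainTheorem9 (R : Type*) [CommRing R] (hR : IsNilpotent (nilradical R)) :
    -- the decompositions of units of `R((u))((t))` exist and are unique
    (∀ f : (DoubleLaurent R)ˣ, ∃! s : Splitting R, IsSplitting f s) ∧
    (∀ f : (DoubleLaurent R)ˣ, ∃! a : Idx → R, IsFactorFamily f a) ∧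
    -- all factors in the formula are meaningful: the elements `1 - r` involved are invertible
    (∀ (f g h : (DoubleLaurent R)ˣ) (x y z : Idx), TPos x.1 y.1 z.1 ∨ TNeg x.1 y.1 z.1 →
      IsUnit (1 - tMon x.1 y.1 z.1 (factorCoeff f x) (factorCoeff g y) (factorCoeff h z))) ∧
    (∀ (f g : (DoubleLaurent R)ˣ) (x y : Idx), SCond x.1 y.1 →
      IsUnit (1 - sMon x.1 y.1 (factorCoeff f x) (factorCoeff g y))) ∧
    (∀ (f g : (DoubleLaurent R)ˣ) (x y : Idx), QCond x.1 y.1 →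
      IsUnit (1 - qMon x.1 y.1 (factorCoeff f x) (factorCoeff g y))) ∧
    -- only finitely many factors are different from `1`
    (∀ f g h : (DoubleLaurent R)ˣ, {w | tFamily f g h w ≠ 1}.Finite) ∧
    (∀ f g : (DoubleLaurent R)ˣ, {w | sFamily f g w ≠ 1}.Finite) ∧
    (∀ f g : (DoubleLaurent R)ˣ, {w | qFamily f g w ≠ 1}.Finite) ∧
    -- the symbol is anti-symmetric
    IsAntisymm (explicitSymbol (R := R)) ∧
    -- the symbol is functorial in `R`
    (∀ (S : Type*) [CommRing S], IsNilpotent (nilradical S) → ∀ (φ : R →+* S)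
      (f g h : (DoubleLaurent R)ˣ),
      explicitSymbol (mapUnits φ f) (mapUnits φ g) (mapUnits φ h) =
        Units.map (φ : R →* S) (explicitSymbol f g h)) ∧
    -- if `ℚ ⊆ R`, it is the unique symbol satisfying the exp-Res definition
    (∀ [Algebra ℚ R], IsExpResSymbol (explicitSymbol (R := R)) ∧
      ∀ σ : (DoubleLaurent R)ˣ → (DoubleLaurent R)ˣ → (DoubleLaurent R)ˣ → Rˣ,
        IsExpResSymbol σ → σ = explicitSymbol) := by
  refine ⟨existsUnique_isSplitting hR, existsUnique_isFactorFamily hR, fun f g h x y z hc => ?_,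
    fun f g x y hc => ?_, fun f g x y hc => ?_, tFamily_finite hR, sFamily_finite hR,
    qFamily_finite hR, isAntisymm_explicitSymbol, fun S _ hS φ => explicitSymbol_map φ hR hS,
    ⟨isExpResSymbol_explicitSymbol hR, fun σ hσ => hσ.unique hR
      (isExpResSymbol_explicitSymbol hR)⟩⟩
  · exact (isNilpotent_tMon ((isFactorFamily_factorCoeff hR f).nilp x)
      ((isFactorFamily_factorCoeff hR g).nilp y)
      ((isFactorFamily_factorCoeff hR h).nilp z) hc).isUnit_one_sub
  · exact (isNilpotent_sMon ((isFactorFamily_factorCoeff hR f).nilp x)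
      ((isFactorFamily_factorCoeff hR g).nilp y) hc).isUnit_one_sub
  · exact (isNilpotent_qMon ((isFactorFamily_factorCoeff hR f).nilp x)
      ((isFactorFamily_factorCoeff hR g).nilp y) hc).isUnit_one_sub
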